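/- **Setting.** Let $m,n\ge 1$, $N=m+n$, let $q>0$ be real, $q\neq 1$, and let $k\ge 0$ be an integer. Put $[a]=0$ for $1\le a\le m$ and $[a]=1$ for $m<a\le N$, and $q_a=q^{(-1)^{[a]}}$. Let $U=U_q(gl(m|n))$ be the associative superalgebra over $\mathbb C$ generated by $K_a^{\pm1}$ ($1\le a\le N$), $E_b=E_{b,b+1}$ and $F_b=E_{b+1,b}$ ($1\le b<N$), where only $E_m,F_m$ are odd, with relations $$K_aK_a^{-1}=K_a^{-1}K_a=1,\quad K_aK_b=K_bK_a,\quad K_aE_bK_a^{-1}=q_a^{\delta_{ab}-\delta_{a,b+1}}E_b,\quad K_aF_bK_a^{-1}=q_a^{-\delta_{ab}+\delta_{a,b+1}}F_b,$$ $$E_aF_b-(-1)^{[E_a][F_b]}F_bE_a=\delta_{ab}\,\frac{K_aK_{a+1}^{-1}-K_a^{-1}K_{a+1}}{q_a-q_a^{-1}},\qquad E_m^2=F_m^2=0,$$ $$E_aE_b=E_bE_a,\quad F_aF_b=F_bF_a\quad(|a-b|\ge2),\qquad X_a^2X_b-(q+q^{-1})X_aX_bX_a+X_bX_a^2=0\quad(X=E,F;\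 a\ne m,\ |a-b|=1),$$ and, if $m,n\ge2$, $\{E_{m-1,m+2},E_m\}=0=\{E_{m+2,m-1},F_m\}$, where $\{x,y\}=xy+yx$, $E_{a,b}=E_{a,c}E_{c,b}-q_c^{-1}E_{c,b}E_{a,c}$ and $E_{b,a}=E_{b,c}E_{c,a}-q_cE_{c,a}E_{b,c}$ for $a<c<b$. It is a Hopf superalgebra with $$\Delta(K_a)=K_a\otimes K_a,\quad \Delta(E_a)=E_a\otimes K_aK_{a+1}^{-1}+1\otimes E_a,\quad \Delta(F_a)=F_a\otimes1+K_a^{-1}K_{a+1}\otimes F_a,$$ $\epsilon(K_a)=1$, $\epsilon(E_a)=\epsilon(F_a)=0$, $S(K_a)=K_a^{-1}$, $S(E_a)=-E_aK_a^{-1}K_{a+1}$, $S(F_a)=-K_aK_{a+1}^{-1}F_a$, $S(xy)=(-1)^{[x][y]}S(y)S(x)$. Let $\pi$ be the vector representation on $\mathbb E=\bigoplus_a\mathbb Cv_a$ ($[v_a]=[a]$): $K_av_b=q_a^{\delta_{ab}}v_b$, $E_bv_c=\delta_{c,b+1}v_b$, $F_bv_c=\delta_{c,b}v_{b+1}$.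 Let $\bar\pi$ be the dual representation in the dual basis, $\bar\pi(x)_{ab}=(-1)^{[x][b]}\pi(S(x))_{ba}$. Put $t_{ab}(x)=\pi(x)_{ab}$, $\bar t_{ab}(x)=\bar\pi(x)_{ab}$. On the dual space $U^*$ use the product $(fg)(x)=\sum(-1)^{[g][x_{(1)}]}f(x_{(1)})g(x_{(2)})$ with unit $\epsilon$. Let $G_q^{\pi}$ and $G_q^{\bar\pi}$ be the unital subalgebras generated by all $t_{ab}$ and by all $\bar t_{ab}$, respectively. $U$ acts on $U^*$ by $(x\circ f)(y)=f(yx)$ and by $(x\cdot f)(y)=(-1)^{[x][y]}f(S^{-1}(x)y)$. Both actions are extended to $V\otimes U^*$, for a one-dimensional even space $V$, by letting $U$ act on the second factor. Let $U_q(\mathfrak p_+)$ be the subalgebra generated by all $K_a^{\pm1}$, all $E_b$, and the $F_c$ with $c<N-1$. Let $U_q(\mathfrak p_-)$ be the subalgebra generated by all $K_a^{\pm1}$, all $F_b$, and the $E_c$ with $c<N-1$. Put $z_a=t_{a,N}$ and $\bar z_a=\bar t_{a,N}$. For $L=(L_1,\dots,L_N)\in\{0,1\}^m\times\mathbb Z_{\ge0}^n$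 put $|L|=\sum_aL_a$, $Z^L=z_1^{L_1}\cdots z_N^{L_N}$, $\overline Z^L=\bar z_1^{L_1}\cdots\bar z_N^{L_N}$. **Theorem.** 1. There is a unique one-dimensional representation $\phi$ of $U_q(\mathfrak p_+)$, on an even space $V_+=\mathbb Cv$, such that all $E_b$ and all $F_c$ ($c<N-1$) act by $0$, $K_b$ acts by $1$ for $b<N$, and $K_N$ acts by $q^{-k}$. There is a unique one-dimensional representation $\psi$ of $U_q(\mathfrak p_-)$, on an even space $V_-=\mathbb Cw$, such that all $F_b$ and all $E_c$ ($c<N-1$) act by $0$, $K_b$ acts by $1$ for $b<N$, and $K_N$ acts by $q^{k}$. 2. Let $$\mathcal O_k=\{\zeta\in V_+\otimes G_q^{\bar\pi}\mid p\circ\zeta=\phi(S(p))\,\zeta\ \ \forall p\in U_q(\mathfrak p_+)\},\qquad \overline{\mathcal O}_k=\{\zeta\in V_-\otimes G_q^{\pi}\mid p\circ\zeta=\psi(S(p))\,\zeta\ \ \forall p\in U_q(\mathfrak p_-)\}.$$ Then $$\mathcal O_k=\bigoplus_{|L|=k}\mathbb C\,v\otimes\overline Z^L,\qquad \overline{\mathcal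 O}_k=\bigoplus_{|L|=k}\mathbb C\,w\otimes Z^L ,$$ that is, the elements $v\otimes\overline Z^L$ with $|L|=k$ form a basis of $\mathcal O_k$, and the elements $w\otimes Z^L$ with $|L|=k$ form a basis of $\overline{\mathcal O}_k$. 3. Under the action "$\cdot$", $\mathcal O_k$ is an irreducible $U$-module with highest weight $\sum_{i\le k}\epsilon_i$ if $k\le m$, and $\sum_{i\le m}\epsilon_i+(k-m)\epsilon_{m+1}$ if $k>m$ (a highest weight vector of weight $\sum_a\lambda_a\epsilon_a$ is a nonzero vector killed by all $E_b$ on which each $K_a$ acts by $q_a^{\lambda_a}$). It is the rank $k$ skew supersymmetric tensor representation: it is isomorphic to the submodule of $\mathbb E^{\otimes k}$ (with $x(v\otimes w)=\sum(-1)^{[x_{(2)}][v]}x_{(1)}v\otimes x_{(2)}w$) consisting of the tensors $\sum c_{a_1\dots a_k}v_{a_1}\otimes\cdots\otimes v_{a_k}$ such that for every pair of adjacent positions $c_{\dots bb\dots}=0$ if $b\le m$, and $c_{\dots ba\dots}=-(-1)^{[a][b]}q^{-1}c_{\dots ab\dots}$ if $a<b$. 4. Under the action "$\cdot$", $\overline{\mathcal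 O}_k$ is an irreducible $U$-module with highest weight $-k\epsilon_{N}$, and it is isomorphic to the dual module of $\mathcal O_k$, on which $U$ acts by $(xf)(\zeta)=(-1)^{[x][f]}f(S(x)\cdot\zeta)$. -/

import Mathlib

open scoped TensorProduct

set_option linter.unusedSimpArgs false
set_option linter.unusedSectionVars false
set_option linter.style.longLine false

namespace QuantumGL

/-- Generators `K_a`, `K_a⁻¹`, `E_b = E_{b,b+1}`, `F_b = E_{b+1,b}` of `U_q(gl(m|n))`.
Indices are counted from `0`. -/
inductive Gen (m n : ℕ) : Type
  | K (a : Fin (m + n))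
  | Kinv (a : Fin (m + n))
  | E (b : Fin (m + n - 1))
  | F (b : Fin (m + n - 1))

section Indices
variable {m n : ℕ}

/-- The index `b` of the simple root `ε_b - ε_{b+1}`. -/
def lo (b : Fin (m + n - 1)) : Fin (m + n) := ⟨b, by omega⟩

/-- The index `b + 1` of the simple root `ε_b - ε_{b+1}`. -/
def hi (b : Fin (m + n - 1)) : Fin (m + n) := ⟨(b : ℕ) + 1, by omega⟩

/-- The parity `[a]` of an index: `0` for the first `m` indices, `1` for the last `n`. -/
def par (a : Fin (m + n)) : ZMod 2 := if (a : ℕ) < m then 0 else 1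

/-- The parity of `E_b` and `F_b`: odd exactly for the `m`-th simple root. -/
def odd (b : Fin (m + n - 1)) : ZMod 2 := if (b : ℕ) + 1 = m then 1 else 0

/-- The sign `(-1)^i`. -/
def sgn (i : ZMod 2) : ℂ := if i = 0 then 1 else -1

/-- `q_a = q^{(-1)^{[a]}}`. -/
noncomputable def qa (q : ℝ) (a : Fin (m + n)) : ℂ := if (a : ℕ) < m then (q : ℂ) else (q : ℂ)⁻¹

/-- `q_a` raised to the power `δ_{a,b} - δ_{a,b+1}`. -/
noncomputable def wt (q : ℝ) (a : Fin (m + n)) (b : Fin (m + n - 1)) : ℂ :=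
  if a = lo b then qa q a else if a = hi b then (qa q a)⁻¹ else 1

end Indices

section Relations
variable {B : Type*} [Ring B] [Algebra ℂ B]

/-- The `q`-commutator `x y - r y x`. -/
def qcomm (r : ℂ) (x y : B) : B := x * y - r • (y * x)

/-- The left-hand side of the cubic Serre relation. -/
noncomputable def serre (q : ℝ) (x y : B) : B :=
  x * x * y - ((q : ℂ) + (q : ℂ)⁻¹) • (x * y * x) + y * x * x

end Relations

/-- The defining relations of `U_q(gl(m|n))`. -/
inductive Rel (m n : ℕ) (q : ℝ) :
    FreeAlgebra ℂ (Gen m n) → FreeAlgebra ℂ (Gen m n) → Prop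
  | k_ki (a) : Rel m n q (.ι ℂ (.K a) * .ι ℂ (.Kinv a)) 1
  | ki_k (a) : Rel m n q (.ι ℂ (.Kinv a) * .ι ℂ (.K a)) 1
  | k_comm (a b) : Rel m n q (.ι ℂ (.K a) * .ι ℂ (.K b)) (.ι ℂ (.K b) * .ι ℂ (.K a))
  | k_e (a b) : Rel m n q (.ι ℂ (.K a) * .ι ℂ (.E b) * .ι ℂ (.Kinv a)) (wt q a b • .ι ℂ (.E b))
  | k_f (a b) : Rel m n q (.ι ℂ (.K a) * .ι ℂ (.F b) * .ι ℂ (.Kinv a)) ((wt q a b)⁻¹ • .ι ℂ (.F b))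
  | e_f (a b) : Rel m n q (qcomm (sgn (odd a * odd b)) (.ι ℂ (.E a)) (.ι ℂ (.F b)))
      (if a = b then (qa q (lo a) - (qa q (lo a))⁻¹)⁻¹ •
        (.ι ℂ (.K (lo a)) * .ι ℂ (.Kinv (hi a)) - .ι ℂ (.Kinv (lo a)) * .ι ℂ (.K (hi a))) else 0)
  | e_sq (b) (h : odd b = 1) : Rel m n q (.ι ℂ (.E b) * .ι ℂ (.E b)) 0
  | f_sq (b) (h : odd b = 1) : Rel m n q (.ι ℂ (.F b) * .ι ℂ (.F b)) 0
  | e_comm (a b : Fin (m + n - 1)) (h : (a : ℕ) + 2 ≤ b) :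
      Rel m n q (.ι ℂ (.E a) * .ι ℂ (.E b)) (.ι ℂ (.E b) * .ι ℂ (.E a))
  | f_comm (a b : Fin (m + n - 1)) (h : (a : ℕ) + 2 ≤ b) :
      Rel m n q (.ι ℂ (.F a) * .ι ℂ (.F b)) (.ι ℂ (.F b) * .ι ℂ (.F a))
  | e_serre (a b : Fin (m + n - 1)) (h : odd a = 0) (hab : (a : ℕ) + 1 = b ∨ (b : ℕ) + 1 = a) :
      Rel m n q (serre q (.ι ℂ (.E a)) (.ι ℂ (.E b))) 0
  | f_serre (a b : Fin (m + n - 1)) (h : odd a = 0) (hab : (a : ℕ) + 1 = b ∨ (b : ℕ) + 1 = a) :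
      Rel m n q (serre q (.ι ℂ (.F a)) (.ι ℂ (.F b))) 0
  /- `{E_{m-1,m+2}, E_{m,m+1}} = 0`, with the root vector built through `m` and `m+1`. -/
  | e_quartic (a b c : Fin (m + n - 1)) (h : odd b = 1) (hab : (a : ℕ) + 1 = b) (hbc : (b : ℕ) + 1 = c) :
      Rel m n q (qcomm (-1) (qcomm (qa q (hi a))⁻¹ (.ι ℂ (.E a))
        (qcomm (qa q (hi b))⁻¹ (.ι ℂ (.E b)) (.ι ℂ (.E c)))) (.ι ℂ (.E b))) 0
  /- `{E_{m+2,m-1}, E_{m+1,m}} = 0`, with the root vector built through `m` and `m+1`. -/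
  | f_quartic (a b c : Fin (m + n - 1)) (h : odd b = 1) (hab : (a : ℕ) + 1 = b) (hbc : (b : ℕ) + 1 = c) :
      Rel m n q (qcomm (-1) (qcomm (qa q (hi a))
        (qcomm (qa q (hi b)) (.ι ℂ (.F c)) (.ι ℂ (.F b))) (.ι ℂ (.F a))) (.ι ℂ (.F b))) 0

/-- The quantum general linear superalgebra `U_q(gl(m|n))` over `ℂ` at the parameter `q`. -/
def Uq (m n : ℕ) (q : ℝ) : Type := RingQuot (Rel m n q)

noncomputable instance (m n : ℕ) (q : ℝ) : Ring (Uq m n q) :=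
  inferInstanceAs (Ring (RingQuot (Rel m n q)))

noncomputable instance (m n : ℕ) (q : ℝ) : Algebra ℂ (Uq m n q) :=
  inferInstanceAs (Algebra ℂ (RingQuot (Rel m n q)))

/-- The quotient map from the free algebra onto `U_q(gl(m|n))`. -/
noncomputable def Uq.mk (m n : ℕ) (q : ℝ) : FreeAlgebra ℂ (Gen m n) →ₐ[ℂ] Uq m n q :=
  RingQuot.mkAlgHom ℂ (Rel m n q)

/-- The image of a generator in `U_q(gl(m|n))`. -/
noncomputable def gen {m n : ℕ} (q : ℝ) (x : Gen m n) : Uq m n q :=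
  Uq.mk m n q (FreeAlgebra.ι ℂ x)

section Lift
variable {m n : ℕ} {q : ℝ} {B : Type*} [Ring B] [Algebra ℂ B]

/-- A family of elements of an algebra satisfies the defining relations of `U_q(gl(m|n))`. -/
structure IsRel (q : ℝ) (g : Gen m n → B) : Prop where
  k_ki : ∀ a, g (.K a) * g (.Kinv a) = 1
  ki_k : ∀ a, g (.Kinv a) * g (.K a) = 1
  k_comm : ∀ a b, g (.K a) * g (.K b) = g (.K b) * g (.K a)
  k_e : ∀ a b, g (.K a) * g (.E b) * g (.Kinv a) = wt q a b • g (.E b)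
  k_f : ∀ a b, g (.K a) * g (.F b) * g (.Kinv a) = (wt q a b)⁻¹ • g (.F b)
  e_f : ∀ a b, qcomm (sgn (odd a * odd b)) (g (.E a)) (g (.F b)) =
    if a = b then (qa q (lo a) - (qa q (lo a))⁻¹)⁻¹ •
      (g (.K (lo a)) * g (.Kinv (hi a)) - g (.Kinv (lo a)) * g (.K (hi a))) else 0
  e_sq : ∀ b, odd b = 1 → g (.E b) * g (.E b) = 0
  f_sq : ∀ b, odd b = 1 → g (.F b) * g (.F b) = 0
  e_comm : ∀ a b : Fin (m + n - 1), (a : ℕ) + 2 ≤ b → g (.E a) * g (.E b) = g (.E b) * g (.E a)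
  f_comm : ∀ a b : Fin (m + n - 1), (a : ℕ) + 2 ≤ b → g (.F a) * g (.F b) = g (.F b) * g (.F a)
  e_serre : ∀ a b : Fin (m + n - 1), odd a = 0 → ((a : ℕ) + 1 = b ∨ (b : ℕ) + 1 = a) →
    serre q (g (.E a)) (g (.E b)) = 0
  f_serre : ∀ a b : Fin (m + n - 1), odd a = 0 → ((a : ℕ) + 1 = b ∨ (b : ℕ) + 1 = a) →
    serre q (g (.F a)) (g (.F b)) = 0
  e_quartic : ∀ a b c : Fin (m + n - 1), odd b = 1 → (a : ℕ) + 1 = b → (b : ℕ) + 1 = c →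
    qcomm (-1) (qcomm (qa q (hi a))⁻¹ (g (.E a)) (qcomm (qa q (hi b))⁻¹ (g (.E b)) (g (.E c)))) (g (.E b)) = 0
  f_quartic : ∀ a b c : Fin (m + n - 1), odd b = 1 → (a : ℕ) + 1 = b → (b : ℕ) + 1 = c →
    qcomm (-1) (qcomm (qa q (hi a)) (qcomm (qa q (hi b)) (g (.F c)) (g (.F b))) (g (.F a))) (g (.F b)) = 0

theorem map_qcomm {A : Type*} [Ring A] [Algebra ℂ A] (φ : A →ₐ[ℂ] B) (r : ℂ) (x y : A) :
    φ (qcomm r x y) = qcomm r (φ x) (φ y) := by simp [qcomm]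

theorem map_serre {A : Type*} [Ring A] [Algebra ℂ A] (φ : A →ₐ[ℂ] B) (q : ℝ) (x y : A) :
    φ (serre q x y) = serre q (φ x) (φ y) := by simp [serre]

/-- The algebra homomorphism out of `U_q(gl(m|n))` given by the images of the generators. -/
noncomputable def IsRel.lift {g : Gen m n → B} (h : IsRel q g) : Uq m n q →ₐ[ℂ] B :=
  RingQuot.liftAlgHom ℂ (s := Rel m n q) ⟨FreeAlgebra.lift ℂ g, by
    intro x y hxy
    induction hxy with
    | k_ki a => simpa using h.k_ki a
    | ki_k a => simpa using h.ki_k a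
    | k_comm a b => simpa using h.k_comm a b
    | k_e a b => simpa using h.k_e a b
    | k_f a b => simpa using h.k_f a b
    | e_f a b =>
      have := h.e_f a b
      rw [map_qcomm]
      split_ifs at this ⊢ <;> simpa using this
    | e_sq b hb => simpa using h.e_sq b hb
    | f_sq b hb => simpa using h.f_sq b hb
    | e_comm a b hb => simpa using h.e_comm a b hb
    | f_comm a b hb => simpa using h.f_comm a b hb
    | e_serre a b h1 h2 => simpa [map_serre] using h.e_serre a b h1 h2
    | f_serre a b h1 h2 => simpa [map_serre] using h.f_serre a b h1 h2
    | e_quartic a b c h1 h2 h3 => simpa [map_qcomm] using h.e_quartic a b c h1 h2 h3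
    | f_quartic a b c h1 h2 h3 => simpa [map_qcomm] using h.f_quartic a b c h1 h2 h3⟩

theorem IsRel.map {A : Type*} [Ring A] [Algebra ℂ A] {g : Gen m n → A} (h : IsRel q g)
    (f : A →ₐ[ℂ] B) : IsRel q (fun u => f (g u)) where
  k_ki a := by simp [← map_mul, h.k_ki]
  ki_k a := by simp [← map_mul, h.ki_k]
  k_comm a b := by simp [← map_mul, h.k_comm a b]
  k_e a b := by simp [← map_mul, h.k_e]
  k_f a b := by simp [← map_mul, h.k_f]
  e_f a b := by
    rw [← map_qcomm, h.e_f]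
    split_ifs <;> simp
  e_sq b hb := by simp [← map_mul, h.e_sq b hb]
  f_sq b hb := by simp [← map_mul, h.f_sq b hb]
  e_comm a b hb := by simp [← map_mul, h.e_comm a b hb]
  f_comm a b hb := by simp [← map_mul, h.f_comm a b hb]
  e_serre a b h1 h2 := by simp [← map_serre, h.e_serre a b h1 h2]
  f_serre a b h1 h2 := by simp [← map_serre, h.f_serre a b h1 h2]
  e_quartic a b c h1 h2 h3 := by simp [← map_qcomm, h.e_quartic a b c h1 h2 h3]
  f_quartic a b c h1 h2 h3 := by simp [← map_qcomm, h.f_quartic a b c h1 h2 h3]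

theorem IsRel.lift_gen {g : Gen m n → B} (h : IsRel q g) (x : Gen m n) :
    h.lift (gen q x) = g x := by
  unfold IsRel.lift gen Uq.mk
  erw [RingQuot.liftAlgHom_mkAlgHom_apply]
  simp

theorem Uq.hom_ext {φ ψ : Uq m n q →ₐ[ℂ] B} (h : ∀ x, φ (gen q x) = ψ (gen q x)) : φ = ψ := by
  refine RingQuot.ringQuot_ext' ℂ φ ψ ?_
  exact FreeAlgebra.hom_ext (funext h)

theorem isRel_gen : IsRel q (gen (m := m) (n := n) q) := by
  have key : ∀ {x y}, Rel m n q x y →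
      Uq.mk m n q x = Uq.mk m n q y :=
    fun h => RingQuot.mkAlgHom_rel ℂ h
  constructor
  · intro a; simpa [gen] using key (.k_ki a)
  · intro a; simpa [gen] using key (.ki_k a)
  · intro a b; simpa [gen] using key (.k_comm a b)
  · intro a b; simpa [gen] using key (.k_e a b)
  · intro a b; simpa [gen] using key (.k_f a b)
  · intro a b
    have := key (.e_f a b)
    rw [map_qcomm] at this
    split_ifs at this ⊢ <;> simpa [gen] using this
  · intro b h; simpa [gen] using key (.e_sq b h)
  · intro b h; simpa [gen] using key (.f_sq b h)
  · intro a b h; simpa [gen] using key (.e_comm a b h)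
  · intro a b h; simpa [gen] using key (.f_comm a b h)
  · intro a b h1 h2; simpa [gen, map_serre] using key (.e_serre a b h1 h2)
  · intro a b h1 h2; simpa [gen, map_serre] using key (.f_serre a b h1 h2)
  · intro a b c h1 h2 h3; simpa [gen, map_qcomm] using key (.e_quartic a b c h1 h2 h3)
  · intro a b c h1 h2 h3; simpa [gen, map_qcomm] using key (.f_quartic a b c h1 h2 h3)

end Lift

section
variable {B : Type*} [Ring B] [Algebra ℂ B]

theorem swap_assoc {x y : B} {c : ℂ} (h : y * x = c • (x * y)) (z : B) :
    y * (x * z) = c • (x * (y * z)) := by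
  rw [← mul_assoc, h, smul_mul_assoc, mul_assoc]

theorem serre_add {q : ℝ} {t t' : ℂ} (ht : t * t' = 1) (hq : (q : ℂ) + (q : ℂ)⁻¹ = t + t')
    {x₁ x₂ y₁ y₂ : B} (hx : serre q x₁ x₂ = 0) (hy : serre q y₁ y₂ = 0)
    (h11 : y₁ * x₁ = (t' * t') • (x₁ * y₁)) (h12 : y₁ * x₂ = t • (x₂ * y₁))
    (h21 : y₂ * x₁ = t • (x₁ * y₂)) : serre q (x₁ + y₁) (x₂ + y₂) = 0 := by
  have h11' := swap_assoc h11
  have h12' := swap_assoc h12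
  have h21' := swap_assoc h21
  unfold serre at *
  rw [hq] at *
  simp only [mul_add, add_mul, mul_assoc, h11, h12, h21, h11', h12', h21', mul_smul_comm,
    smul_smul, smul_mul_assoc] at *
  linear_combination (norm := skip) hx + hy
  match_scalars <;> grind

theorem quartic_add {t t' : ℂ} (ht : t * t' = 1)
    {x₁ x₂ x₃ y₁ y₂ y₃ : B}
    (hx : qcomm (-1) (qcomm t' x₁ (qcomm t x₂ x₃)) x₂ = 0)
    (hy : qcomm (-1) (qcomm t' y₁ (qcomm t y₂ y₃)) y₂ = 0)
    (hx2 : x₂ * x₂ = 0) (hy2 : y₂ * y₂ = 0) (hx3 : x₃ * x₁ = x₁ * x₃) (hy3 : y₃ * y₁ = y₁ * y₃)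
    (h12 : y₁ * x₂ = t • (x₂ * y₁)) (h21 : y₂ * x₁ = t • (x₁ * y₂))
    (h32 : y₃ * x₂ = t' • (x₂ * y₃)) (h23 : y₂ * x₃ = t' • (x₃ * y₂))
    (h13 : y₁ * x₃ = (1 : ℂ) • (x₃ * y₁)) (h31 : y₃ * x₁ = (1 : ℂ) • (x₁ * y₃))
    (h22 : y₂ * x₂ = (-1 : ℂ) • (x₂ * y₂)) :
    qcomm (-1) (qcomm t' (x₁ + y₁) (qcomm t (x₂ + y₂) (x₃ + y₃))) (x₂ + y₂) = 0 := by
  have h12' := swap_assoc h12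
  have h21' := swap_assoc h21
  have h32' := swap_assoc h32
  have h23' := swap_assoc h23
  have h13' := swap_assoc h13
  have h31' := swap_assoc h31
  have h22' := swap_assoc h22
  have hx2' : ∀ z, x₂ * (x₂ * z) = 0 := fun z => by rw [← mul_assoc, hx2, zero_mul]
  have hy2' : ∀ z, y₂ * (y₂ * z) = 0 := fun z => by rw [← mul_assoc, hy2, zero_mul]
  have hx3' : ∀ z, x₃ * (x₁ * z) = x₁ * (x₃ * z) := fun z => by rw [← mul_assoc, hx3, mul_assoc]
  have hy3' : ∀ z, y₃ * (y₁ * z) = y₁ * (y₃ * z) := fun z => by rw [← mul_assoc, hy3, mul_assoc]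
  unfold qcomm at *
  simp only [mul_add, add_mul, mul_sub, sub_mul, mul_assoc, h12, h12', h21, h21', h32, h32',
    h23, h23', h13, h13', h31, h31', h22, h22', hx2, hx2', hy2, hy2', hx3, hx3', hy3,
    mul_smul_comm, smul_smul, smul_mul_assoc, smul_add, smul_sub, mul_zero, smul_zero] at hx hy ⊢
  linear_combination (norm := skip) hx + hy
  match_scalars <;> grind

theorem quartic_add' {t t' : ℂ} (ht : t * t' = 1)
    {x₁ x₂ x₃ y₁ y₂ y₃ : B}
    (hx : qcomm (-1) (qcomm t (qcomm t' x₃ x₂) x₁) x₂ = 0)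
    (hy : qcomm (-1) (qcomm t (qcomm t' y₃ y₂) y₁) y₂ = 0)
    (hx2 : x₂ * x₂ = 0) (hy2 : y₂ * y₂ = 0) (hx3 : x₃ * x₁ = x₁ * x₃) (hy3 : y₃ * y₁ = y₁ * y₃)
    (h12 : y₁ * x₂ = t' • (x₂ * y₁)) (h21 : y₂ * x₁ = t' • (x₁ * y₂))
    (h32 : y₃ * x₂ = t • (x₂ * y₃)) (h23 : y₂ * x₃ = t • (x₃ * y₂))
    (h13 : y₁ * x₃ = (1 : ℂ) • (x₃ * y₁)) (h31 : y₃ * x₁ = (1 : ℂ) • (x₁ * y₃))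
    (h22 : y₂ * x₂ = (-1 : ℂ) • (x₂ * y₂)) :
    qcomm (-1) (qcomm t (qcomm t' (x₃ + y₃) (x₂ + y₂)) (x₁ + y₁)) (x₂ + y₂) = 0 := by
  have h12' := swap_assoc h12
  have h21' := swap_assoc h21
  have h32' := swap_assoc h32
  have h23' := swap_assoc h23
  have h13' := swap_assoc h13
  have h31' := swap_assoc h31
  have h22' := swap_assoc h22
  have hx2' : ∀ z, x₂ * (x₂ * z) = 0 := fun z => by rw [← mul_assoc, hx2, zero_mul]
  have hy2' : ∀ z, y₂ * (y₂ * z) = 0 := fun z => by rw [← mul_assoc, hy2, zero_mul]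
  have hx3' : ∀ z, x₃ * (x₁ * z) = x₁ * (x₃ * z) := fun z => by rw [← mul_assoc, hx3, mul_assoc]
  have hy3' : ∀ z, y₃ * (y₁ * z) = y₁ * (y₃ * z) := fun z => by rw [← mul_assoc, hy3, mul_assoc]
  unfold qcomm at *
  simp only [mul_add, add_mul, mul_sub, sub_mul, mul_assoc, h12, h12', h21, h21', h32, h32',
    h23, h23', h13, h13', h31, h31', h22, h22', hx2, hx2', hy2, hy2', hx3, hx3', hy3,
    mul_smul_comm, smul_smul, smul_mul_assoc, smul_add, smul_sub, mul_zero, smul_zero] at hx hy ⊢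
  linear_combination (norm := skip) hx + hy
  match_scalars <;> grind
end

section Weights
variable {m n : ℕ} {q : ℝ}

/-- The scalar `q^{(α_a, α_b)}` by which `K_a K_{a+1}⁻¹` commutes past `E_b`. -/
noncomputable def cw (q : ℝ) (a b : Fin (m + n - 1)) : ℂ :=
  wt q (lo a) b * (wt q (hi a) b)⁻¹

theorem lo_inj {a b : Fin (m + n - 1)} : lo a = lo b ↔ a = b := by
  simp [lo, Fin.ext_iff]

theorem hi_inj {a b : Fin (m + n - 1)} : hi a = hi b ↔ a = b := by
  simp [hi, Fin.ext_iff]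

theorem lo_ne_hi (a : Fin (m + n - 1)) : lo a ≠ hi a := by
  simp [lo, hi, Fin.ext_iff]

theorem hi_eq_lo {a b : Fin (m + n - 1)} (h : (a : ℕ) + 1 = b) : hi a = lo b := by
  simp [lo, hi, h]

theorem qa_ne [hq : Fact (0 < q)] (a : Fin (m + n)) : qa q a ≠ 0 := by
  have : (q : ℂ) ≠ 0 := by exact_mod_cast hq.out.ne'
  unfold qa; split_ifs <;> simp [this]

theorem wt_ne [Fact (0 < q)] (a : Fin (m + n)) (b : Fin (m + n - 1)) : wt q a b ≠ 0 := by
  have := qa_ne (q := q) a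
  unfold wt; split_ifs <;> simp [this]

theorem cw_ne [Fact (0 < q)] (a b : Fin (m + n - 1)) : cw q a b ≠ 0 :=
  mul_ne_zero (wt_ne _ _) (inv_ne_zero (wt_ne _ _))

theorem qa_hi {a : Fin (m + n - 1)} (h : odd a = 0) : qa q (hi a) = qa q (lo a) := by
  unfold odd at h
  unfold qa lo hi
  split_ifs at h with h'
  · simp at h
  · have : ((a : ℕ) + 1 < m) ↔ ((a : ℕ) < m) := by omega
    simp [this]

theorem qa_lo_odd {a : Fin (m + n - 1)} (h : odd a = 1) : qa q (lo a) = q := by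
  unfold odd at h
  unfold qa lo
  split_ifs at h with h'
  · simp; intro; omega
  · simp at h

theorem qa_hi_odd {a : Fin (m + n - 1)} (h : odd a = 1) : qa q (hi a) = (q : ℂ)⁻¹ := by
  unfold odd at h
  unfold qa hi
  split_ifs at h with h'
  · simp; intro; omega
  · simp at h

theorem cw_self (a : Fin (m + n - 1)) : cw q a a = qa q (lo a) * qa q (hi a) := by
  simp [cw, wt, (lo_ne_hi a).symm]

theorem cw_succ {a b : Fin (m + n - 1)} (h : (a : ℕ) + 1 = b) : cw q a b = (qa q (hi a))⁻¹ := by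
  have h1 : lo a ≠ lo b := by simp [lo, Fin.ext_iff]; omega
  have h2 : lo a ≠ hi b := by simp [lo, hi, Fin.ext_iff]; omega
  have h3 : hi a = lo b := hi_eq_lo h
  simp [cw, wt, h1, h2, h3]

theorem cw_pred {a b : Fin (m + n - 1)} (h : (a : ℕ) + 1 = b) : cw q b a = (qa q (hi a))⁻¹ := by
  have h1 : lo b ≠ lo a := by simp [lo, Fin.ext_iff]; omega
  have h2 : hi b ≠ lo a := by simp [lo, hi, Fin.ext_iff]; omega
  have h3 : hi b ≠ hi a := by simp [hi, Fin.ext_iff]; omega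
  have h4 : hi a = lo b := hi_eq_lo h
  simp [cw, wt, h1, h2, h3, h4, lo_ne_hi, (lo_ne_hi b).symm]

theorem cw_far {a b : Fin (m + n - 1)} (h : (a : ℕ) + 2 ≤ b) : cw q a b = 1 := by
  have h1 : lo a ≠ lo b := by simp [lo, Fin.ext_iff]; omega
  have h2 : lo a ≠ hi b := by simp [lo, hi, Fin.ext_iff]; omega
  have h3 : hi a ≠ lo b := by simp [lo, hi, Fin.ext_iff]; omega
  have h4 : hi a ≠ hi b := by simp [hi, Fin.ext_iff]; omega
  simp [cw, wt, h1, h2, h3, h4]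

theorem cw_far' {a b : Fin (m + n - 1)} (h : (a : ℕ) + 2 ≤ b) : cw q b a = 1 := by
  have h1 : lo b ≠ lo a := by simp [lo, Fin.ext_iff]; omega
  have h2 : lo b ≠ hi a := by simp [lo, hi, Fin.ext_iff]; omega
  have h3 : hi b ≠ lo a := by simp [lo, hi, Fin.ext_iff]; omega
  have h4 : hi b ≠ hi a := by simp [hi, Fin.ext_iff]; omega
  simp [cw, wt, h1, h2, h3, h4]

theorem cw_comm (a b : Fin (m + n - 1)) : cw q a b = cw q b a := by
  rcases lt_trichotomy (a : ℕ) b with h | h | h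
  · rcases Nat.lt_or_ge ((a : ℕ) + 1) b with h' | h'
    · rw [cw_far (by omega), cw_far' (by omega)]
    · rw [cw_succ (by omega), cw_pred (by omega)]
  · rw [Fin.ext h]
  · rcases Nat.lt_or_ge ((b : ℕ) + 1) a with h' | h'
    · rw [cw_far' (a := b) (b := a) (by omega), cw_far (a := b) (b := a) (by omega)]
    · rw [cw_pred (a := b) (b := a) (by omega), cw_succ (a := b) (b := a) (by omega)]

theorem odd_far {a b : Fin (m + n - 1)} (h : (a : ℕ) ≠ b) : odd a * odd b = 0 := by
  unfold odd
  split_ifs <;> first | omega | simp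

theorem qsum (q : ℝ) (a : Fin (m + n)) :
    (q : ℂ) + (q : ℂ)⁻¹ = qa q a + (qa q a)⁻¹ := by
  unfold qa; split_ifs
  · rfl
  · rw [inv_inv, add_comm]

@[simp] theorem sgn_zero : sgn 0 = 1 := by simp [sgn]

@[simp] theorem sgn_one : sgn 1 = -1 := by simp [sgn]

theorem sgn_mul_self (i : ZMod 2) : sgn i * sgn i = 1 := by
  unfold sgn; split_ifs <;> norm_num

theorem zmod2 (i : ZMod 2) : i = 0 ∨ i = 1 := by
  revert i; decide

theorem sgn_add (i j : ZMod 2) : sgn (i + j) = sgn i * sgn j := by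
  rcases zmod2 i with rfl | rfl <;> rcases zmod2 j with rfl | rfl <;>
    simp [show (1 : ZMod 2) + 1 = 0 from rfl]

/-- The parity of a generator. -/
def gpar : Gen m n → ZMod 2
  | .K _ => 0
  | .Kinv _ => 0
  | .E b => odd b
  | .F b => odd b

end Weights

section Derived
variable {m n : ℕ} {q : ℝ} {B : Type*} [Ring B] [Algebra ℂ B] {g : Gen m n → B}

/-- `K_b K_{b+1}⁻¹`. -/
def kap (g : Gen m n → B) (b : Fin (m + n - 1)) : B := g (.K (lo b)) * g (.Kinv (hi b))

/-- `K_b⁻¹ K_{b+1}`. -/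
def kapInv (g : Gen m n → B) (b : Fin (m + n - 1)) : B := g (.Kinv (lo b)) * g (.K (hi b))

namespace IsRel

theorem ke (h : IsRel q g) (a b) : g (.K a) * g (.E b) = wt q a b • (g (.E b) * g (.K a)) := by
  rw [← smul_mul_assoc, ← h.k_e a b, mul_assoc _ _ (g (.K a)), h.ki_k, mul_one]

theorem kf (h : IsRel q g) (a b) :
    g (.K a) * g (.F b) = (wt q a b)⁻¹ • (g (.F b) * g (.K a)) := by
  rw [← smul_mul_assoc, ← h.k_f a b, mul_assoc _ _ (g (.K a)), h.ki_k, mul_one]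

theorem inv_swap (h : IsRel q g) {a : Fin (m + n)} {x : B} {c : ℂ} (hc : c ≠ 0)
    (hx : g (.K a) * x = c • (x * g (.K a))) :
    g (.Kinv a) * x = c⁻¹ • (x * g (.Kinv a)) := by
  have h1 : g (.Kinv a) * (g (.K a) * x) * g (.Kinv a) = x * g (.Kinv a) := by
    rw [← mul_assoc, h.ki_k, one_mul]
  rw [hx, mul_smul_comm, smul_mul_assoc, mul_assoc, mul_assoc, h.k_ki, mul_one] at h1
  rw [← h1, smul_smul, inv_mul_cancel₀ hc, one_smul]

theorem kie [Fact (0 < q)] (h : IsRel q g) (a b) :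
    g (.Kinv a) * g (.E b) = (wt q a b)⁻¹ • (g (.E b) * g (.Kinv a)) :=
  h.inv_swap (wt_ne _ _) (h.ke a b)

theorem kif [Fact (0 < q)] (h : IsRel q g) (a b) :
    g (.Kinv a) * g (.F b) = wt q a b • (g (.F b) * g (.Kinv a)) := by
  simpa using h.inv_swap (inv_ne_zero (wt_ne _ _)) (h.kf a b)

theorem kik (h : IsRel q g) (a b) : g (.Kinv a) * g (.K b) = g (.K b) * g (.Kinv a) := by
  simpa using h.inv_swap (c := 1) one_ne_zero (by simpa using h.k_comm a b)

theorem kiki (h : IsRel q g) (a b) :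
    g (.Kinv a) * g (.Kinv b) = g (.Kinv b) * g (.Kinv a) := by
  simpa using h.inv_swap (c := 1) one_ne_zero (by simpa using (h.kik b a).symm)

theorem kap_e [Fact (0 < q)] (h : IsRel q g) (a b) :
    kap g a * g (.E b) = cw q a b • (g (.E b) * kap g a) := by
  unfold kap cw
  rw [mul_assoc, h.kie, mul_smul_comm, ← mul_assoc, h.ke, smul_mul_assoc, smul_smul, mul_assoc,
    mul_comm]

theorem kap_f [Fact (0 < q)] (h : IsRel q g) (a b) :
    kap g a * g (.F b) = (cw q a b)⁻¹ • (g (.F b) * kap g a) := by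
  unfold kap cw
  rw [mul_assoc, h.kif, mul_smul_comm, ← mul_assoc, h.kf, smul_mul_assoc, smul_smul, mul_assoc,
    mul_comm, mul_inv, inv_inv]

theorem kapInv_e [Fact (0 < q)] (h : IsRel q g) (a b) :
    kapInv g a * g (.E b) = (cw q a b)⁻¹ • (g (.E b) * kapInv g a) := by
  unfold kapInv cw
  rw [mul_assoc, h.ke, mul_smul_comm, ← mul_assoc, h.kie, smul_mul_assoc, smul_smul, mul_assoc,
    mul_comm, mul_inv, inv_inv]

theorem kapInv_f [Fact (0 < q)] (h : IsRel q g) (a b) :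
    kapInv g a * g (.F b) = cw q a b • (g (.F b) * kapInv g a) := by
  unfold kapInv cw
  rw [mul_assoc, h.kf, mul_smul_comm, ← mul_assoc, h.kif, smul_mul_assoc, smul_smul, mul_assoc,
    mul_comm]

theorem kap_kap (h : IsRel q g) (a b) : kap g a * kap g b = kap g b * kap g a := by
  have h1 : Commute (g (.K (lo a))) (g (.K (lo b))) := h.k_comm _ _
  have h2 : Commute (g (.Kinv (hi a))) (g (.K (lo b))) := h.kik _ _
  have h3 : Commute (g (.K (lo a))) (g (.Kinv (hi b))) := (h.kik _ _).symm
  have h4 : Commute (g (.Kinv (hi a))) (g (.Kinv (hi b))) := h.kiki _ _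
  exact (h1.mul_right h3).mul_left (h2.mul_right h4)

theorem kapInv_kapInv (h : IsRel q g) (a b) :
    kapInv g a * kapInv g b = kapInv g b * kapInv g a := by
  have h1 : Commute (g (.Kinv (lo a))) (g (.Kinv (lo b))) := h.kiki _ _
  have h2 : Commute (g (.K (hi a))) (g (.Kinv (lo b))) := (h.kik _ _).symm
  have h3 : Commute (g (.Kinv (lo a))) (g (.K (hi b))) := h.kik _ _
  have h4 : Commute (g (.K (hi a))) (g (.K (hi b))) := h.k_comm _ _
  exact (h1.mul_right h3).mul_left (h2.mul_right h4)

end IsRel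

theorem comm_assoc {x y : B} (h : y * x = x * y) (z : B) : y * (x * z) = x * (y * z) := by
  rw [← mul_assoc, h, mul_assoc]

theorem serre_mul (q : ℝ) {x₁ x₂ k₁ k₂ : B} (h11 : k₁ * x₁ = x₁ * k₁) (h12 : k₁ * x₂ = x₂ * k₁)
    (h21 : k₂ * x₁ = x₁ * k₂) (hk : k₂ * k₁ = k₁ * k₂) :
    serre q (x₁ * k₁) (x₂ * k₂) = serre q x₁ x₂ * (k₁ * k₁ * k₂) := by
  have h11' := comm_assoc h11
  have h12' := comm_assoc h12
  have h21' := comm_assoc h21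
  have hk' := comm_assoc hk
  simp only [serre, add_mul, sub_mul, mul_assoc, h11, h11', h12, h12', h21, h21', hk, hk',
    smul_mul_assoc]

theorem quartic_mul (r s : ℂ) {x₁ x₂ x₃ k₁ k₂ k₃ : B}
    (h12 : k₁ * x₂ = x₂ * k₁) (h13 : k₁ * x₃ = x₃ * k₁)
    (h21 : k₂ * x₁ = x₁ * k₂) (h22 : k₂ * x₂ = x₂ * k₂) (h23 : k₂ * x₃ = x₃ * k₂)
    (h31 : k₃ * x₁ = x₁ * k₃) (h32 : k₃ * x₂ = x₂ * k₃)
    (hk12 : k₂ * k₁ = k₁ * k₂) (hk13 : k₃ * k₁ = k₁ * k₃) (hk23 : k₃ * k₂ = k₂ * k₃) :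
    qcomm (-1) (qcomm r (x₁ * k₁) (qcomm s (x₂ * k₂) (x₃ * k₃))) (x₂ * k₂) =
      qcomm (-1) (qcomm r x₁ (qcomm s x₂ x₃)) x₂ * (k₁ * k₂ * k₂ * k₃) ∧
    qcomm (-1) (qcomm r (qcomm s (x₃ * k₃) (x₂ * k₂)) (x₁ * k₁)) (x₂ * k₂) =
      qcomm (-1) (qcomm r (qcomm s x₃ x₂) x₁) x₂ * (k₁ * k₂ * k₂ * k₃) := by
  have h12' := comm_assoc h12
  have h13' := comm_assoc h13
  have h21' := comm_assoc h21
  have h22' := comm_assoc h22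
  have h23' := comm_assoc h23
  have h31' := comm_assoc h31
  have h32' := comm_assoc h32
  have hk12' := comm_assoc hk12
  have hk13' := comm_assoc hk13
  have hk23' := comm_assoc hk23
  constructor <;>
  simp only [qcomm, mul_sub, sub_mul, mul_assoc, h12, h12', h13, h13', h21, h21', h22, h22', h23,
    h23', h31, h31', h32, h32', hk12, hk12', hk13, hk13', hk23, hk23', smul_mul_assoc,
    mul_smul_comm]

end Derived

section Comul
variable {m n : ℕ} {q : ℝ} {B : Type*} [Ring B] [Algebra ℂ B]

/-- The images of the generators under the coproduct, for two families of elements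
playing the roles of `u ↦ u ⊗ 1` and `u ↦ 1 ⊗ u`. -/
def comulGen (x y : Gen m n → B) : Gen m n → B
  | .K a => x (.K a) * y (.K a)
  | .Kinv a => x (.Kinv a) * y (.Kinv a)
  | .E b => x (.E b) * kap y b + y (.E b)
  | .F b => x (.F b) + kapInv x b * y (.F b)

variable {x y : Gen m n → B}

theorem cross_kap (hc : ∀ u v, y v * x u = sgn (gpar u * gpar v) • (x u * y v)) (b u) :
    kap y b * x u = x u * kap y b := by
  have h1 : Commute (y (.K (lo b))) (x u) := by
    simpa [gpar, commute_iff_eq] using hc u (.K (lo b))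
  have h2 : Commute (y (.Kinv (hi b))) (x u) := by
    simpa [gpar, commute_iff_eq] using hc u (.Kinv (hi b))
  exact h1.mul_left h2

theorem cross_kapInv (hc : ∀ u v, y v * x u = sgn (gpar u * gpar v) • (x u * y v)) (b v) :
    kapInv x b * y v = y v * kapInv x b := by
  have h1 : Commute (x (.Kinv (lo b))) (y v) := by
    simpa [gpar, commute_iff_eq] using (hc (.Kinv (lo b)) v).symm
  have h2 : Commute (x (.K (hi b))) (y v) := by
    simpa [gpar, commute_iff_eq] using (hc (.K (hi b)) v).symm
  exact h1.mul_left h2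

theorem cross_E [Fact (0 < q)] (hy : IsRel q y)
    (hc : ∀ u v, y v * x u = sgn (gpar u * gpar v) • (x u * y v)) (a b) :
    y (.E b) * (x (.E a) * kap y a) =
      (sgn (odd a * odd b) * (cw q a b)⁻¹) • (x (.E a) * kap y a * y (.E b)) := by
  rw [mul_assoc, hy.kap_e, mul_smul_comm, smul_smul, mul_assoc, inv_mul_cancel₀ (cw_ne a b),
    mul_one, ← mul_assoc, hc]
  simp only [gpar, smul_mul_assoc, mul_assoc]

theorem cross_F [Fact (0 < q)] (hx : IsRel q x)
    (hc : ∀ u v, y v * x u = sgn (gpar u * gpar v) • (x u * y v)) (a b) :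
    kapInv x b * y (.F b) * x (.F a) =
      (sgn (odd a * odd b) * cw q b a) • (x (.F a) * (kapInv x b * y (.F b))) := by
  rw [mul_assoc, hc, mul_smul_comm, ← mul_assoc, hx.kapInv_f, smul_mul_assoc, smul_smul, mul_assoc]
  rfl

theorem kapInv_kap_cross (hc : ∀ u v, y v * x u = sgn (gpar u * gpar v) • (x u * y v)) (a b) :
    kapInv x b * kap y a = kap y a * kapInv x b := by
  have h1 : Commute (kapInv x b) (y (.K (lo a))) := cross_kapInv hc _ _
  have h2 : Commute (kapInv x b) (y (.Kinv (hi a))) := cross_kapInv hc _ _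
  exact h1.mul_right h2

theorem IsRel.comul [Fact (0 < q)] (hx : IsRel q x) (hy : IsRel q y)
    (hc : ∀ u v, y v * x u = sgn (gpar u * gpar v) • (x u * y v)) :
    IsRel q (comulGen x y) := by
  have hK : ∀ a u, y (.K a) * x u = x u * y (.K a) := fun a u => by
    simpa [gpar] using hc u (.K a)
  have hKi : ∀ a u, y (.Kinv a) * x u = x u * y (.Kinv a) := fun a u => by
    simpa [gpar] using hc u (.Kinv a)
  have hK' : ∀ a v, x (.K a) * y v = y v * x (.K a) := fun a v => by
    simpa [gpar] using (hc (.K a) v).symm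
  have hKi' : ∀ a v, x (.Kinv a) * y v = y v * x (.Kinv a) := fun a v => by
    simpa [gpar] using (hc (.Kinv a) v).symm
  -- conjugation by `K`
  have conj : ∀ (a : Fin (m + n)) (u v : B) (c d : ℂ), x (.K a) * u * x (.Kinv a) = c • u → y (.K a) * v * y (.Kinv a) = d • v →
      y (.K a) * u = u * y (.K a) → x (.Kinv a) * v = v * x (.Kinv a) →
      x (.K a) * y (.K a) * (u * v) * (x (.Kinv a) * y (.Kinv a)) = (c * d) • (u * v) := by
    intro a u v c d h1 h2 h3 h4
    calc x (.K a) * y (.K a) * (u * v) * (x (.Kinv a) * y (.Kinv a))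
        = x (.K a) * (y (.K a) * u) * (v * x (.Kinv a)) * y (.Kinv a) := by
          simp only [mul_assoc]
      _ = x (.K a) * u * (y (.K a) * x (.Kinv a)) * (v * y (.Kinv a)) := by
          rw [h3, ← h4]; simp only [mul_assoc]
      _ = (x (.K a) * u * x (.Kinv a)) * (y (.K a) * v * y (.Kinv a)) := by
          rw [hK]; simp only [mul_assoc]
      _ = _ := by rw [h1, h2, smul_mul_smul_comm]
  have conj1 : ∀ {z : Gen m n → B} (_ : IsRel q z) (a : Fin (m + n)) (u : B), z (.K a) * u = u * z (.K a) →
      z (.K a) * u * z (.Kinv a) = (1 : ℂ) • u := by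
    intro z hz a u h
    rw [h, mul_assoc, hz.k_ki, mul_one, one_smul]
  constructor
  · intro a
    change x (.K a) * y (.K a) * (x (.Kinv a) * y (.Kinv a)) = 1
    rw [mul_assoc, ← mul_assoc (y (.K a)), hK, mul_assoc, hy.k_ki, mul_one, hx.k_ki]
  · intro a
    change x (.Kinv a) * y (.Kinv a) * (x (.K a) * y (.K a)) = 1
    rw [mul_assoc, ← mul_assoc (y (.Kinv a)), hKi, mul_assoc, hy.ki_k, mul_one, hx.ki_k]
  · intro a b
    have h1 : Commute (x (.K a)) (x (.K b)) := hx.k_comm a b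
    have h2 : Commute (y (.K a)) (x (.K b)) := hK _ _
    have h3 : Commute (x (.K a)) (y (.K b)) := (hK _ _).symm
    have h4 : Commute (y (.K a)) (y (.K b)) := hy.k_comm a b
    exact (h1.mul_right h3).mul_left (h2.mul_right h4)
  · intro a b
    change x (.K a) * y (.K a) * (x (.E b) * kap y b + y (.E b)) * (x (.Kinv a) * y (.Kinv a)) =
      wt q a b • (x (.E b) * kap y b + y (.E b))
    have hkk : y (.K a) * kap y b = kap y b * y (.K a) :=
      ((show Commute (y (.K a)) (y (.K (lo b))) from hy.k_comm _ _).mul_right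
        (show Commute (y (.K a)) (y (.Kinv (hi b))) from (hy.kik _ _).symm))
    have hxk : x (.Kinv a) * kap y b = kap y b * x (.Kinv a) := (cross_kap hc b (.Kinv a)).symm
    have e1 := conj a (x (.E b)) (kap y b) _ _ (hx.k_e a b) (conj1 hy a _ hkk) (hK _ _) hxk
    have e2 := conj a 1 (y (.E b)) 1 _ (by simpa using hx.k_ki a) (hy.k_e a b) (by simp) (hKi' _ _)
    rw [one_mul, one_mul] at e2
    rw [mul_add, add_mul, e1, e2, smul_add, mul_one]
  · intro a b
    change x (.K a) * y (.K a) * (x (.F b) + kapInv x b * y (.F b)) * (x (.Kinv a) * y (.Kinv a)) =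
      (wt q a b)⁻¹ • (x (.F b) + kapInv x b * y (.F b))
    have hkk : x (.K a) * kapInv x b = kapInv x b * x (.K a) :=
      ((show Commute (x (.K a)) (x (.Kinv (lo b))) from (hx.kik _ _).symm).mul_right
        (show Commute (x (.K a)) (x (.K (hi b))) from hx.k_comm _ _))
    have hyk : y (.K a) * kapInv x b = kapInv x b * y (.K a) := (cross_kapInv hc b (.K a)).symm
    have e1 := conj a (kapInv x b) (y (.F b)) _ _ (conj1 hx a _ hkk) (hy.k_f a b) hyk (hKi' _ _)
    have e2 := conj a (x (.F b)) 1 _ 1 (hx.k_f a b) (by simpa using hy.k_ki a) (hK _ _) (by simp)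
    rw [mul_one, mul_one] at e2
    rw [mul_add, add_mul, e1, e2, smul_add, one_mul]
  · intro a b
    have h1 : x (.E a) * kap y a * x (.F b) = x (.E a) * x (.F b) * kap y a := by
      rw [mul_assoc, cross_kap hc, mul_assoc]
    have h2 : y (.E a) * x (.F b) = sgn (odd a * odd b) • (x (.F b) * y (.E a)) := by
      rw [hc, mul_comm]; simp only [gpar]
    have h3 : kapInv x b * y (.F b) * (x (.E a) * kap y a) =
        sgn (odd a * odd b) • (x (.E a) * kap y a * (kapInv x b * y (.F b))) := by
      have hs : y (.F b) * x (.E a) = sgn (odd a * odd b) • (x (.E a) * y (.F b)) := hc _ _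
      have h5 : y (.F b) * kap y a = cw q a b • (kap y a * y (.F b)) := by
        rw [hy.kap_f, smul_smul, mul_inv_cancel₀ (cw_ne a b), one_smul]
      calc kapInv x b * y (.F b) * (x (.E a) * kap y a)
          = kapInv x b * (y (.F b) * x (.E a)) * kap y a := by simp only [mul_assoc]
        _ = sgn (odd a * odd b) • ((kapInv x b * x (.E a)) * (y (.F b) * kap y a)) := by
            rw [hs]; simp only [mul_assoc, mul_smul_comm, smul_mul_assoc]
        _ = sgn (odd a * odd b) • (x (.E a) * (kapInv x b * kap y a) * y (.F b)) := by
            rw [hx.kapInv_e, h5, smul_mul_smul_comm, cw_comm b a, inv_mul_cancel₀ (cw_ne a b),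
              one_smul]
            simp only [mul_assoc]
        _ = _ := by rw [kapInv_kap_cross hc]; simp only [mul_assoc]
    have h4 : y (.E a) * (kapInv x b * y (.F b)) = kapInv x b * (y (.E a) * y (.F b)) := by
      rw [← mul_assoc, ← cross_kapInv hc, mul_assoc]
    have key : qcomm (sgn (odd a * odd b)) (comulGen x y (.E a)) (comulGen x y (.F b)) =
        qcomm (sgn (odd a * odd b)) (x (.E a)) (x (.F b)) * kap y a +
          kapInv x b * qcomm (sgn (odd a * odd b)) (y (.E a)) (y (.F b)) := by
      simp only [comulGen, qcomm, mul_add, add_mul, h1, h2, h3, h4, mul_sub, sub_mul, smul_add,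
        smul_smul, sgn_mul_self, one_smul, mul_smul_comm, smul_mul_assoc, mul_assoc]
      abel
    rw [key, hx.e_f, hy.e_f]
    by_cases hab : a = b
    · subst hab
      simp only [if_true]
      rw [smul_mul_assoc, mul_smul_comm, ← smul_add]
      congr 1
      change (kap x a - kapInv x a) * kap y a + kapInv x a * (kap y a - kapInv y a) =
        x (.K (lo a)) * y (.K (lo a)) * (x (.Kinv (hi a)) * y (.Kinv (hi a))) -
          x (.Kinv (lo a)) * y (.Kinv (lo a)) * (x (.K (hi a)) * y (.K (hi a)))
      have e1 : x (.K (lo a)) * y (.K (lo a)) * (x (.Kinv (hi a)) * y (.Kinv (hi a))) =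
          kap x a * kap y a := by
        rw [mul_assoc, ← mul_assoc (y _), hK]; simp only [kap, mul_assoc]
      have e2 : x (.Kinv (lo a)) * y (.Kinv (lo a)) * (x (.K (hi a)) * y (.K (hi a))) =
          kapInv x a * kapInv y a := by
        rw [mul_assoc, ← mul_assoc (y _), hKi]; simp only [kapInv, mul_assoc]
      rw [e1, e2]
      noncomm_ring
    · simp [hab]
  · intro b hb
    have h1 := cross_E hy hc b b
    rw [cw_self, qa_lo_odd hb, qa_hi_odd hb, hb, mul_inv_cancel₀ (by
      have : Fact (0 < q) := inferInstance
      exact_mod_cast this.out.ne')] at h1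
    simp only [mul_one, sgn_one, inv_one] at h1
    have h2 : x (.E b) * kap y b * (x (.E b) * kap y b) = 0 := by
      rw [mul_assoc, ← mul_assoc (kap y b), cross_kap hc, mul_assoc, ← mul_assoc, hx.e_sq b hb,
        zero_mul]
    simp [comulGen, mul_add, add_mul, h1, h2, hy.e_sq b hb]
  · intro b hb
    have h1 := cross_F hx hc b b
    rw [cw_self, qa_lo_odd hb, qa_hi_odd hb, hb, mul_inv_cancel₀ (by
      have : Fact (0 < q) := inferInstance
      exact_mod_cast this.out.ne')] at h1
    simp only [mul_one, sgn_one] at h1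
    have h2 : kapInv x b * y (.F b) * (kapInv x b * y (.F b)) = 0 := by
      rw [mul_assoc, ← mul_assoc (y _), ← cross_kapInv hc, mul_assoc, hy.f_sq b hb, mul_zero,
        mul_zero]
    simp [comulGen, mul_add, add_mul, h1, h2, hx.f_sq b hb]
  · intro a b hab
    have h1 := cross_E hy hc a b
    have h2 := cross_E hy hc b a
    rw [cw_far hab, odd_far (by omega)] at h1
    rw [cw_far' hab, odd_far (by omega)] at h2
    simp only [sgn_zero, inv_one, mul_one, one_smul] at h1 h2
    have h3 : x (.E a) * kap y a * (x (.E b) * kap y b) =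
        x (.E b) * kap y b * (x (.E a) * kap y a) := by
      have : ∀ c d, x (.E c) * kap y c * (x (.E d) * kap y d) =
          x (.E c) * x (.E d) * (kap y c * kap y d) := fun c d => by
        rw [mul_assoc, ← mul_assoc (kap y c), cross_kap hc]; simp only [mul_assoc]
      rw [this, this, hx.e_comm a b hab, hy.kap_kap]
    simp only [comulGen, mul_add, add_mul, h1, h2, h3, hy.e_comm a b hab]
    abel
  · intro a b hab
    have h1 := cross_F hx hc a b
    have h2 := cross_F hx hc b a
    rw [cw_far' hab, odd_far (by omega)] at h1
    rw [cw_far hab, odd_far (by omega)] at h2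
    simp only [sgn_zero, mul_one, one_smul] at h1 h2
    have h3 : kapInv x a * y (.F a) * (kapInv x b * y (.F b)) =
        kapInv x b * y (.F b) * (kapInv x a * y (.F a)) := by
      have : ∀ c d, kapInv x c * y (.F c) * (kapInv x d * y (.F d)) =
          (kapInv x c * kapInv x d) * (y (.F c) * y (.F d)) := fun c d => by
        rw [mul_assoc, ← mul_assoc (y _), ← cross_kapInv hc]; simp only [mul_assoc]
      rw [this, this, hy.f_comm a b hab, hx.kapInv_kapInv]
    simp only [comulGen, mul_add, add_mul, h1, h2, h3, hx.f_comm a b hab]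
    abel
  · intro a b ha hab
    have hq0 := qa_ne (q := q) (lo a)
    have hsg : odd a * odd b = 0 := by rw [ha, zero_mul]
    have hsg' : odd b * odd a = 0 := by rw [ha, mul_zero]
    have hcab : cw q a b = (qa q (lo a))⁻¹ ∧ cw q b a = (qa q (lo a))⁻¹ := by
      rcases hab with h | h
      · rw [cw_succ h, cw_pred h, qa_hi ha]; exact ⟨rfl, rfl⟩
      · rw [cw_succ h, cw_pred h, hi_eq_lo h]; exact ⟨rfl, rfl⟩
    refine serre_add (t := qa q (lo a)) (t' := (qa q (lo a))⁻¹) (mul_inv_cancel₀ hq0)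
      (qsum q _) ?_ (hy.e_serre a b ha hab) ?_ ?_ ?_
    · rw [serre_mul q (cross_kap hc a _) (cross_kap hc a _) (cross_kap hc b _) (hy.kap_kap b a),
        hx.e_serre a b ha hab, zero_mul]
    · rw [cross_E hy hc, cw_self, qa_hi ha, ha]; simp
    · rw [cross_E hy hc, hcab.2, hsg']; simp
    · rw [cross_E hy hc, hcab.1, hsg]; simp
  · intro a b ha hab
    have hq0 := qa_ne (q := q) (lo a)
    have hsg : odd a * odd b = 0 := by rw [ha, zero_mul]
    have hsg' : odd b * odd a = 0 := by rw [ha, mul_zero]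
    have hcab : cw q a b = (qa q (lo a))⁻¹ ∧ cw q b a = (qa q (lo a))⁻¹ := by
      rcases hab with h | h
      · rw [cw_succ h, cw_pred h, qa_hi ha]; exact ⟨rfl, rfl⟩
      · rw [cw_succ h, cw_pred h, hi_eq_lo h]; exact ⟨rfl, rfl⟩
    refine serre_add (t := (qa q (lo a))⁻¹) (t' := qa q (lo a)) (inv_mul_cancel₀ hq0)
      (by rw [add_comm (qa q (lo a))⁻¹]; exact qsum q _) (hx.f_serre a b ha hab) ?_ ?_ ?_ ?_
    · rw [cross_kapInv hc, cross_kapInv hc,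
        serre_mul q (cross_kapInv hc a _) (cross_kapInv hc a _) (cross_kapInv hc b _)
        (hx.kapInv_kapInv b a), hy.f_serre a b ha hab, zero_mul]
    · rw [cross_F hx hc, cw_self, qa_hi ha, ha]; simp
    · rw [cross_F hx hc, hcab.1, hsg']; simp
    · rw [cross_F hx hc, hcab.2, hsg]; simp
  · intro a b c hb hab hbc
    have hq0 : (q : ℂ) ≠ 0 := by
      have : Fact (0 < q) := inferInstance
      exact_mod_cast this.out.ne'
    have u1 : qa q (hi a) = q := by rw [hi_eq_lo hab, qa_lo_odd hb]
    have u2 : qa q (hi b) = (q : ℂ)⁻¹ := qa_hi_odd hb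
    have hE := hx.e_quartic a b c hb hab hbc
    have hE' := hy.e_quartic a b c hb hab hbc
    have oac : odd a * odd c = 0 := odd_far (by omega)
    have oca : odd c * odd a = 0 := odd_far (by omega)
    have oab : odd a * odd b = 0 := odd_far (by omega)
    have oba : odd b * odd a = 0 := odd_far (by omega)
    have obc : odd b * odd c = 0 := odd_far (by omega)
    have ocb : odd c * odd b = 0 := odd_far (by omega)
    rw [u1, u2, inv_inv] at hE hE' ⊢
    have K := fun i u => cross_kap hc i u
    have e_comm := hy.e_comm a c (by omega)
    have e_comm' := hx.e_comm a c (by omega)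
    refine quartic_add (t := (q : ℂ)) (t' := (q : ℂ)⁻¹) (mul_inv_cancel₀ hq0) ?_ hE'
      ?_ (hy.e_sq b hb) ?_ e_comm.symm ?_ ?_ ?_ ?_ ?_ ?_ ?_
    · rw [(quartic_mul _ _ (K _ _) (K _ _) (K _ _) (K _ _) (K _ _) (K _ _) (K _ _)
        (hy.kap_kap _ _) (hy.kap_kap _ _) (hy.kap_kap _ _)).1, hE, zero_mul]
    · rw [mul_assoc, ← mul_assoc (kap y b), K, mul_assoc, ← mul_assoc, hx.e_sq b hb,
        zero_mul]
    · have : ∀ c d, x (.E c) * kap y c * (x (.E d) * kap y d) =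
          x (.E c) * x (.E d) * (kap y c * kap y d) := fun c d => by
        rw [mul_assoc, ← mul_assoc (kap y c), cross_kap hc]; simp only [mul_assoc]
      rw [this, this, e_comm', hy.kap_kap]
    · rw [cross_E hy hc, cw_pred hab, u1, oba]; simp
    · rw [cross_E hy hc, cw_succ hab, u1, oab]; simp
    · rw [cross_E hy hc, cw_succ hbc, u2, obc]; simp
    · rw [cross_E hy hc, cw_pred hbc, u2, ocb]; simp
    · rw [cross_E hy hc, cw_far' (by omega), oca]; simp
    · rw [cross_E hy hc, cw_far (by omega), oac]; simp
    · rw [cross_E hy hc, cw_self, hb, u2, qa_lo_odd hb, mul_inv_cancel₀ hq0]; simp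
  · intro a b c hb hab hbc
    have hq0 : (q : ℂ) ≠ 0 := by
      have : Fact (0 < q) := inferInstance
      exact_mod_cast this.out.ne'
    have u1 : qa q (hi a) = q := by rw [hi_eq_lo hab, qa_lo_odd hb]
    have u2 : qa q (hi b) = (q : ℂ)⁻¹ := qa_hi_odd hb
    have hE := hx.f_quartic a b c hb hab hbc
    have hE' := hy.f_quartic a b c hb hab hbc
    have oac : odd a * odd c = 0 := odd_far (by omega)
    have oca : odd c * odd a = 0 := odd_far (by omega)
    have oab : odd a * odd b = 0 := odd_far (by omega)
    have oba : odd b * odd a = 0 := odd_far (by omega)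
    have obc : odd b * odd c = 0 := odd_far (by omega)
    have ocb : odd c * odd b = 0 := odd_far (by omega)
    rw [u1, u2] at hE hE' ⊢
    have K := fun i u => cross_kapInv hc i u
    have e_comm := hy.f_comm a c (by omega)
    have e_comm' := hx.f_comm a c (by omega)
    refine quartic_add' (t := (q : ℂ)) (t' := (q : ℂ)⁻¹) (mul_inv_cancel₀ hq0) hE ?_
      (hx.f_sq b hb) ?_ e_comm'.symm ?_ ?_ ?_ ?_ ?_ ?_ ?_ ?_
    · rw [K, K, K, (quartic_mul _ _ (K _ _) (K _ _) (K _ _) (K _ _) (K _ _) (K _ _) (K _ _)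
        (hx.kapInv_kapInv _ _) (hx.kapInv_kapInv _ _) (hx.kapInv_kapInv _ _)).2, hE', zero_mul]
    · rw [mul_assoc, ← mul_assoc (y _), ← K, mul_assoc, hy.f_sq b hb, mul_zero, mul_zero]
    · have : ∀ c d, kapInv x c * y (.F c) * (kapInv x d * y (.F d)) =
          (kapInv x c * kapInv x d) * (y (.F c) * y (.F d)) := fun c d => by
        rw [mul_assoc, ← mul_assoc (y _), ← cross_kapInv hc]; simp only [mul_assoc]
      rw [this, this, e_comm, hx.kapInv_kapInv]
    · rw [cross_F hx hc, cw_succ hab, u1, oba]; simp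
    · rw [cross_F hx hc, cw_pred hab, u1, oab]; simp
    · rw [cross_F hx hc, cw_pred hbc, u2, obc]; simp
    · rw [cross_F hx hc, cw_succ hbc, u2, ocb]; simp
    · rw [cross_F hx hc, cw_far (by omega), oca]; simp
    · rw [cross_F hx hc, cw_far' (by omega), oac]; simp
    · rw [cross_F hx hc, cw_self, hb, u2, qa_lo_odd hb, mul_inv_cancel₀ hq0]; simp

end Comul

section Anti
variable {m n : ℕ} {q : ℝ} {B : Type*} [Ring B] [Algebra ℂ B]

/-- The quartic relation, rewritten modulo `y² = 0` and `x z = z x`. -/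
def canon (c : ℂ) (x y z : B) : B :=
  x * y * z * y + z * y * x * y + y * x * y * z + y * z * y * x - c • (y * x * z * y)

theorem canon_e {t t' : ℂ} (ht : t * t' = 1) {x y z : B} (hy : y * y = 0) (hz : z * x = x * z) :
    qcomm (-1) (qcomm t' x (qcomm t y z)) y = canon (t + t') x y z := by
  have hy' : ∀ w, y * (y * w) = 0 := fun w => by rw [← mul_assoc, hy, zero_mul]
  have hz' := comm_assoc hz
  simp only [canon, qcomm, mul_sub, sub_mul, mul_assoc, hz, hz', hy, hy', mul_smul_comm,
    smul_mul_assoc, smul_sub, smul_smul, mul_zero, smul_zero]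
  match_scalars <;> grind

theorem canon_f {t t' : ℂ} (ht : t * t' = 1) {x y z : B} (hy : y * y = 0) (hz : z * x = x * z) :
    qcomm (-1) (qcomm t (qcomm t' z y) x) y = canon (t + t') x y z := by
  have hy' : ∀ w, y * (y * w) = 0 := fun w => by rw [← mul_assoc, hy, zero_mul]
  have hz' := comm_assoc hz
  simp only [canon, qcomm, mul_sub, sub_mul, mul_assoc, hz, hz', hy, hy', mul_smul_comm,
    smul_mul_assoc, smul_sub, smul_smul, mul_zero, smul_zero]
  match_scalars <;> grind

theorem serre_qmul (q : ℝ) {x₁ x₂ k₁ k₂ : B} {α β : ℂ} (h11 : k₁ * x₁ = α • (x₁ * k₁))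
    (h12 : k₁ * x₂ = β • (x₂ * k₁)) (h21 : k₂ * x₁ = β • (x₁ * k₂)) (hk : k₂ * k₁ = k₁ * k₂) :
    serre q (x₁ * k₁) (x₂ * k₂) = (α * β * β) • (serre q x₁ x₂ * (k₁ * k₁ * k₂)) := by
  have h11' := swap_assoc h11
  have h12' := swap_assoc h12
  have h21' := swap_assoc h21
  have hk' := comm_assoc hk
  simp only [serre, add_mul, sub_mul, mul_assoc, h11, h11', h12, h12', h21, h21', hk, hk',
    smul_mul_assoc, mul_smul_comm, smul_smul]
  match_scalars <;> ring

theorem canon_qmul (c : ℂ) {x₁ x₂ x₃ k₁ k₂ k₃ : B} {u v w z : ℂ}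
    (h12 : k₁ * x₂ = u • (x₂ * k₁)) (h13 : k₁ * x₃ = v • (x₃ * k₁))
    (h21 : k₂ * x₁ = u • (x₁ * k₂)) (h22 : k₂ * x₂ = z • (x₂ * k₂)) (h23 : k₂ * x₃ = w • (x₃ * k₂))
    (h31 : k₃ * x₁ = v • (x₁ * k₃)) (h32 : k₃ * x₂ = w • (x₂ * k₃))
    (hk12 : k₂ * k₁ = k₁ * k₂) (hk13 : k₃ * k₁ = k₁ * k₃) (hk23 : k₃ * k₂ = k₂ * k₃) :
    canon c (x₁ * k₁) (x₂ * k₂) (x₃ * k₃) =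
      (u * u * v * w * w * z) • (canon c x₁ x₂ x₃ * (k₁ * k₂ * k₂ * k₃)) := by
  have h12' := swap_assoc h12
  have h13' := swap_assoc h13
  have h21' := swap_assoc h21
  have h22' := swap_assoc h22
  have h23' := swap_assoc h23
  have h31' := swap_assoc h31
  have h32' := swap_assoc h32
  have hk12' := comm_assoc hk12
  have hk13' := comm_assoc hk13
  have hk23' := comm_assoc hk23
  simp only [canon, add_mul, sub_mul, mul_assoc, h12, h12', h13, h13', h21, h21', h22, h22', h23,
    h23', h31, h31', h32, h32', hk12, hk12', hk13, hk13', hk23, hk23', smul_mul_assoc,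
    mul_smul_comm, smul_smul]
  match_scalars <;> ring

theorem qcomm_smul (r a b : ℂ) (x y : B) : qcomm r (a • x) (b • y) = (a * b) • qcomm r x y := by
  simp only [qcomm, smul_mul_smul_comm, smul_sub, smul_smul]
  match_scalars <;> ring

theorem serre_smul (q : ℝ) (a b : ℂ) (x y : B) :
    serre q (a • x) (b • y) = (a * a * b) • serre q x y := by
  simp only [serre, smul_mul_smul_comm, smul_sub, smul_add, smul_smul]
  match_scalars <;> ring

theorem canon_smul (c a b d : ℂ) (x y z : B) :
    canon c (a • x) (b • y) (d • z) = (a * b * b * d) • canon c x y z := by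
  simp only [canon, smul_mul_smul_comm, smul_sub, smul_add, smul_smul]
  match_scalars <;> ring

theorem serre_op (q : ℝ) (x y : B) :
    serre q (MulOpposite.op x) (MulOpposite.op y) = MulOpposite.op (serre q x y) := by
  simp only [serre, ← MulOpposite.op_mul, ← MulOpposite.op_smul, ← MulOpposite.op_sub,
    ← MulOpposite.op_add, mul_assoc]
  congr 1; abel

theorem canon_op (c : ℂ) {x y z : B} (h : z * x = x * z) :
    canon c (MulOpposite.op x) (MulOpposite.op y) (MulOpposite.op z) =
      MulOpposite.op (canon c x y z) := by
  have h' := comm_assoc h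
  simp only [canon, ← MulOpposite.op_mul, ← MulOpposite.op_smul, ← MulOpposite.op_sub,
    ← MulOpposite.op_add, mul_assoc, h, h']
  congr 1; abel

variable {g : Gen m n → B}

theorem odd_nbr {a b : Fin (m + n - 1)} (h : odd b = 1) (hab : (a : ℕ) + 1 = b) :
    qa q (hi a) = q := by rw [hi_eq_lo hab, qa_lo_odd h]

theorem IsRel.canon_e [hq : Fact (0 < q)] (h : IsRel q g) (a b c : Fin (m + n - 1))
    (hb : odd b = 1) (hab : (a : ℕ) + 1 = b) (hbc : (b : ℕ) + 1 = c) :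
    canon ((q : ℂ) + (q : ℂ)⁻¹) (g (.E a)) (g (.E b)) (g (.E c)) = 0 := by
  have hq0 : (q : ℂ) ≠ 0 := by exact_mod_cast hq.out.ne'
  rw [← QuantumGL.canon_e (mul_inv_cancel₀ hq0) (h.e_sq b hb) (h.e_comm a c (by omega)).symm,
    ← h.e_quartic a b c hb hab hbc, odd_nbr hb hab, qa_hi_odd hb, inv_inv]

theorem IsRel.canon_f [hq : Fact (0 < q)] (h : IsRel q g) (a b c : Fin (m + n - 1))
    (hb : odd b = 1) (hab : (a : ℕ) + 1 = b) (hbc : (b : ℕ) + 1 = c) :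
    canon ((q : ℂ) + (q : ℂ)⁻¹) (g (.F a)) (g (.F b)) (g (.F c)) = 0 := by
  have hq0 : (q : ℂ) ≠ 0 := by exact_mod_cast hq.out.ne'
  rw [← QuantumGL.canon_f (mul_inv_cancel₀ hq0) (h.f_sq b hb) (h.f_comm a c (by omega)).symm,
    ← h.f_quartic a b c hb hab hbc, odd_nbr hb hab, qa_hi_odd hb]

theorem IsRel.kap_kapInv (h : IsRel q g) (a) : kap g a * kapInv g a = 1 := by
  unfold kap kapInv
  rw [mul_assoc, ← mul_assoc (g (.Kinv (hi a))), h.kiki, mul_assoc, h.ki_k, mul_one, h.k_ki]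

theorem IsRel.kapInv_kap (h : IsRel q g) (a) : kapInv g a * kap g a = 1 := by
  unfold kap kapInv
  rw [mul_assoc, ← mul_assoc (g (.K (hi a))), h.k_comm, mul_assoc, h.k_ki, mul_one, h.ki_k]

theorem IsRel.kap_kapInv' (h : IsRel q g) (a b) : kap g a * kapInv g b = kapInv g b * kap g a := by
  have h1 : Commute (g (.K (lo a))) (g (.Kinv (lo b))) := (h.kik _ _).symm
  have h2 : Commute (g (.Kinv (hi a))) (g (.Kinv (lo b))) := h.kiki _ _
  have h3 : Commute (g (.K (lo a))) (g (.K (hi b))) := h.k_comm _ _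
  have h4 : Commute (g (.Kinv (hi a))) (g (.K (hi b))) := h.kik _ _
  exact (h1.mul_right h3).mul_left (h2.mul_right h4)

/-- Twisting a family by signs on the odd generators. -/
def signGen (g : Gen m n → B) (u : Gen m n) : B := sgn (gpar u) • g u

theorem IsRel.sign [hq : Fact (0 < q)] (h : IsRel q g) : IsRel q (signGen g) := by
  have hq0 : (q : ℂ) ≠ 0 := by exact_mod_cast hq.out.ne'
  have e_sq : ∀ b, odd b = 1 → signGen g (.E b) * signGen g (.E b) = 0 := fun b hb => by
    simp [signGen, h.e_sq b hb]
  have f_sq : ∀ b, odd b = 1 → signGen g (.F b) * signGen g (.F b) = 0 := fun b hb => by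
    simp [signGen, h.f_sq b hb]
  have e_comm : ∀ a b : Fin (m + n - 1), (a : ℕ) + 2 ≤ b →
      signGen g (.E a) * signGen g (.E b) = signGen g (.E b) * signGen g (.E a) :=
    fun a b hab => by
      simp only [signGen, smul_mul_smul_comm, h.e_comm a b hab]; rw [mul_comm]
  have f_comm : ∀ a b : Fin (m + n - 1), (a : ℕ) + 2 ≤ b →
      signGen g (.F a) * signGen g (.F b) = signGen g (.F b) * signGen g (.F a) :=
    fun a b hab => by
      simp only [signGen, smul_mul_smul_comm, h.f_comm a b hab]; rw [mul_comm]
  refine ⟨?_, ?_, ?_, ?_, ?_, ?_, e_sq, f_sq, e_comm, f_comm, ?_, ?_, ?_, ?_⟩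
  · intro a; simp [signGen, gpar, h.k_ki]
  · intro a; simp [signGen, gpar, h.ki_k]
  · intro a b; simp [signGen, gpar, h.k_comm a b]
  · intro a b
    simp only [signGen, gpar, sgn_zero, one_smul, mul_smul_comm, smul_mul_assoc, h.k_e a b]
    rw [smul_comm]
  · intro a b
    simp only [signGen, gpar, sgn_zero, one_smul, mul_smul_comm, smul_mul_assoc, h.k_f a b]
    rw [smul_comm]
  · intro a b
    simp only [signGen, qcomm_smul]
    rw [h.e_f]
    by_cases hab : a = b
    · subst hab
      simp [gpar, sgn_mul_self]
    · simp [hab]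
  · intro a b h1 h2
    simp only [signGen, serre_smul, h.e_serre a b h1 h2, smul_zero]
  · intro a b h1 h2
    simp only [signGen, serre_smul, h.f_serre a b h1 h2, smul_zero]
  · intro a b c hb hab hbc
    rw [odd_nbr hb hab, qa_hi_odd hb, inv_inv, QuantumGL.canon_e (mul_inv_cancel₀ hq0)
      (e_sq b hb) (e_comm a c (by omega)).symm]
    simp only [signGen, canon_smul, h.canon_e a b c hb hab hbc, smul_zero]
  · intro a b c hb hab hbc
    rw [odd_nbr hb hab, qa_hi_odd hb, QuantumGL.canon_f (mul_inv_cancel₀ hq0)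
      (f_sq b hb) (f_comm a c (by omega)).symm]
    simp only [signGen, canon_smul, h.canon_f a b c hb hab hbc, smul_zero]

/-- A family in the opposite algebra of the shape of the antipode, with free scalars. -/
def antiGen (d e : Fin (m + n - 1) → ℂ) (g : Gen m n → B) : Gen m n → Bᵐᵒᵖ
  | .K a => .op (g (.Kinv a))
  | .Kinv a => .op (g (.K a))
  | .E b => .op (d b • (g (.E b) * kapInv g b))
  | .F b => .op (e b • (g (.F b) * kap g b))

theorem IsRel.anti [hq : Fact (0 < q)] (h : IsRel q g) {d e : Fin (m + n - 1) → ℂ}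
    (hde : ∀ b, d b * e b * cw q b b = sgn (odd b)) : IsRel q (antiGen d e g) := by
  have hq0 : (q : ℂ) ≠ 0 := by exact_mod_cast hq.out.ne'
  have hkE : ∀ a b, kapInv g a * g (.E b) = (cw q a b)⁻¹ • (g (.E b) * kapInv g a) := h.kapInv_e
  have hkF : ∀ a b, kap g a * g (.F b) = (cw q a b)⁻¹ • (g (.F b) * kap g a) := h.kap_f
  have mulE : ∀ a b, g (.E a) * kapInv g a * (g (.E b) * kapInv g b) =
      (cw q a b)⁻¹ • (g (.E a) * g (.E b) * (kapInv g a * kapInv g b)) := fun a b => by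
    rw [mul_assoc, ← mul_assoc (kapInv g a), hkE]
    simp only [smul_mul_assoc, mul_smul_comm, mul_assoc]
  have mulF : ∀ a b, g (.F a) * kap g a * (g (.F b) * kap g b) =
      (cw q a b)⁻¹ • (g (.F a) * g (.F b) * (kap g a * kap g b)) := fun a b => by
    rw [mul_assoc, ← mul_assoc (kap g a), hkF]
    simp only [smul_mul_assoc, mul_smul_comm, mul_assoc]
  have commE : ∀ a b : Fin (m + n - 1), (a : ℕ) + 2 ≤ b →
      g (.E a) * kapInv g a * (g (.E b) * kapInv g b) =
        g (.E b) * kapInv g b * (g (.E a) * kapInv g a) := fun a b hab => by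
    rw [mulE, mulE, cw_comm b a, h.e_comm a b hab, h.kapInv_kapInv]
  have commF : ∀ a b : Fin (m + n - 1), (a : ℕ) + 2 ≤ b →
      g (.F a) * kap g a * (g (.F b) * kap g b) =
        g (.F b) * kap g b * (g (.F a) * kap g a) := fun a b hab => by
    rw [mulF, mulF, cw_comm b a, h.f_comm a b hab, h.kap_kap]
  have e_sq : ∀ b, odd b = 1 → antiGen d e g (.E b) * antiGen d e g (.E b) = 0 := fun b hb => by
    simp only [antiGen, ← MulOpposite.op_mul, smul_mul_smul_comm, mulE, h.e_sq b hb, zero_mul,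
      smul_zero, MulOpposite.op_zero]
  have f_sq : ∀ b, odd b = 1 → antiGen d e g (.F b) * antiGen d e g (.F b) = 0 := fun b hb => by
    simp only [antiGen, ← MulOpposite.op_mul, smul_mul_smul_comm, mulF, h.f_sq b hb, zero_mul,
      smul_zero, MulOpposite.op_zero]
  have e_comm : ∀ a b : Fin (m + n - 1), (a : ℕ) + 2 ≤ b →
      antiGen d e g (.E a) * antiGen d e g (.E b) = antiGen d e g (.E b) * antiGen d e g (.E a) :=
    fun a b hab => by
      simp only [antiGen, ← MulOpposite.op_mul, smul_mul_smul_comm, commE a b hab]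
      rw [mul_comm]
  have f_comm : ∀ a b : Fin (m + n - 1), (a : ℕ) + 2 ≤ b →
      antiGen d e g (.F a) * antiGen d e g (.F b) = antiGen d e g (.F b) * antiGen d e g (.F a) :=
    fun a b hab => by
      simp only [antiGen, ← MulOpposite.op_mul, smul_mul_smul_comm, commF a b hab]
      rw [mul_comm]
  refine ⟨?_, ?_, ?_, ?_, ?_, ?_, e_sq, f_sq, e_comm, f_comm, ?_, ?_, ?_, ?_⟩
  · intro a; simp only [antiGen, ← MulOpposite.op_mul, h.k_ki, MulOpposite.op_one]
  · intro a; simp only [antiGen, ← MulOpposite.op_mul, h.ki_k, MulOpposite.op_one]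
  · intro a b; simp only [antiGen, ← MulOpposite.op_mul, h.kiki b a]
  · intro a b
    simp only [antiGen, ← MulOpposite.op_mul, ← MulOpposite.op_smul]
    congr 1
    have hc : kapInv g b * g (.Kinv a) = g (.Kinv a) * kapInv g b :=
      ((show Commute (g (.Kinv (lo b))) (g (.Kinv a)) from h.kiki _ _).mul_left
        (show Commute (g (.K (hi b))) (g (.Kinv a)) from (h.kik _ _).symm))
    rw [smul_mul_assoc, mul_smul_comm, mul_assoc (g (.E b)), hc, ← mul_assoc, ← mul_assoc, h.k_e,
      smul_mul_assoc, smul_comm]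
  · intro a b
    simp only [antiGen, ← MulOpposite.op_mul, ← MulOpposite.op_smul]
    congr 1
    have hc : kap g b * g (.Kinv a) = g (.Kinv a) * kap g b :=
      ((show Commute (g (.K (lo b))) (g (.Kinv a)) from (h.kik _ _).symm).mul_left
        (show Commute (g (.Kinv (hi b))) (g (.Kinv a)) from h.kiki _ _))
    rw [smul_mul_assoc, mul_smul_comm, mul_assoc (g (.F b)), hc, ← mul_assoc, ← mul_assoc, h.k_f,
      smul_mul_assoc, smul_comm]
  · intro a b
    have h1 : g (.F b) * kap g b * (g (.E a) * kapInv g a) =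
        cw q b a • (g (.F b) * g (.E a) * (kap g b * kapInv g a)) := by
      rw [mul_assoc, ← mul_assoc (kap g b), h.kap_e]
      simp only [smul_mul_assoc, mul_smul_comm, mul_assoc]
    have h2 : g (.E a) * kapInv g a * (g (.F b) * kap g b) =
        cw q b a • (g (.E a) * g (.F b) * (kap g b * kapInv g a)) := by
      rw [mul_assoc, ← mul_assoc (kapInv g a), h.kapInv_f, cw_comm a b, h.kap_kapInv']
      simp only [smul_mul_assoc, mul_smul_comm, mul_assoc]
    have key : qcomm (sgn (odd a * odd b)) (antiGen d e g (.E a)) (antiGen d e g (.F b)) =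
        .op ((-(sgn (odd a * odd b)) * (d a * e b * cw q b a)) •
          (qcomm (sgn (odd a * odd b)) (g (.E a)) (g (.F b)) * (kap g b * kapInv g a))) := by
      simp only [qcomm, antiGen, ← MulOpposite.op_mul, ← MulOpposite.op_smul,
        ← MulOpposite.op_sub, smul_mul_smul_comm, h1, h2]
      congr 1
      rw [sub_mul, smul_mul_assoc]
      have hs := sgn_mul_self (odd a * odd b)
      match_scalars <;> grind
    rw [key, h.e_f]
    by_cases hab : a = b
    · subst hab
      have ho : odd a * odd a = odd a := by
        rcases zmod2 (odd a) with h | h <;> simp [h]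
      rw [if_pos rfl, if_pos rfl, hde, ho, neg_mul, sgn_mul_self, h.kap_kapInv, mul_one]
      simp only [antiGen, ← MulOpposite.op_mul, ← MulOpposite.op_smul, ← MulOpposite.op_sub]
      congr 1
      rw [h.kik (hi a) (lo a), h.kik (lo a) (hi a)]
      rw [neg_smul, one_smul, ← smul_neg, neg_sub]
    · simp [hab]
  · intro a b h1 h2
    simp only [antiGen, serre_op, serre_smul]
    rw [serre_qmul q (hkE a a) (hkE a b) (by rw [cw_comm a b]; exact hkE b a)
      (h.kapInv_kapInv b a), h.e_serre a b h1 h2]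
    simp
  · intro a b h1 h2
    simp only [antiGen, serre_op, serre_smul]
    rw [serre_qmul q (hkF a a) (hkF a b) (by rw [cw_comm a b]; exact hkF b a)
      (h.kap_kap b a), h.f_serre a b h1 h2]
    simp
  · intro a b c hb hab hbc
    rw [odd_nbr hb hab, qa_hi_odd hb, inv_inv, QuantumGL.canon_e (mul_inv_cancel₀ hq0)
      (e_sq b hb) (e_comm a c (by omega)).symm]
    simp only [antiGen]
    rw [canon_op _ (by simp only [smul_mul_smul_comm, commE a c (by omega)]; rw [mul_comm]),
      canon_smul, canon_qmul _ (hkE a b) (hkE a c) (by rw [cw_comm a b]; exact hkE b a) (hkE b b)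
        (hkE b c) (by rw [cw_comm a c]; exact hkE c a) (by rw [cw_comm b c]; exact hkE c b)
        (h.kapInv_kapInv _ _) (h.kapInv_kapInv _ _) (h.kapInv_kapInv _ _),
      h.canon_e a b c hb hab hbc]
    simp
  · intro a b c hb hab hbc
    rw [odd_nbr hb hab, qa_hi_odd hb, QuantumGL.canon_f (mul_inv_cancel₀ hq0)
      (f_sq b hb) (f_comm a c (by omega)).symm]
    simp only [antiGen]
    rw [canon_op _ (by simp only [smul_mul_smul_comm, commF a c (by omega)]; rw [mul_comm]),
      canon_smul, canon_qmul _ (hkF a b) (hkF a c) (by rw [cw_comm a b]; exact hkF b a) (hkF b b)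
        (hkF b c) (by rw [cw_comm a c]; exact hkF c a) (by rw [cw_comm b c]; exact hkF c b)
        (h.kap_kap _ _) (h.kap_kap _ _) (h.kap_kap _ _),
      h.canon_f a b c hb hab hbc]
    simp

end Anti

section Grading
variable {m n : ℕ} {q : ℝ} [Fact (0 < q)]

/-- The parity automorphism of `U_q(gl(m|n))`: it fixes the even generators and negates
the odd ones. -/
noncomputable def parity (m n : ℕ) (q : ℝ) [Fact (0 < q)] : Uq m n q →ₐ[ℂ] Uq m n q :=
  isRel_gen.sign.lift

theorem parity_gen (u : Gen m n) : parity m n q (gen q u) = sgn (gpar u) • gen q u :=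
  IsRel.lift_gen _ _

theorem parity_parity (x : Uq m n q) : parity m n q (parity m n q x) = x := by
  have : (parity m n q).comp (parity m n q) = AlgHom.id ℂ _ := by
    apply Uq.hom_ext
    intro u
    simp [parity_gen, smul_smul, sgn_mul_self]
  exact DFunLike.congr_fun this x

/-- The homogeneous component of degree `i` of an element of `U_q(gl(m|n))`. -/
noncomputable def part (i : ZMod 2) : Uq m n q →ₗ[ℂ] Uq m n q :=
  (1 / 2 : ℂ) • (LinearMap.id + sgn i • (parity m n q).toLinearMap)

theorem part_apply (i : ZMod 2) (x : Uq m n q) :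
    part i x = (1 / 2 : ℂ) • (x + sgn i • parity m n q x) := rfl

theorem part_add_part (x : Uq m n q) : part 0 x + part 1 x = x := by
  simp only [part_apply, sgn_zero, sgn_one]
  module

/-- The homogeneous elements of degree `i` of `U_q(gl(m|n))`. -/
def homog (m n : ℕ) (q : ℝ) [Fact (0 < q)] (i : ZMod 2) : Submodule ℂ (Uq m n q) where
  carrier := {x | parity m n q x = sgn i • x}
  zero_mem' := by simp
  add_mem' := fun {x y} hx hy => by
    simp only [Set.mem_ofPred_eq] at *
    rw [map_add, hx, hy, smul_add]
  smul_mem' := fun c x hx => by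
    simp only [Set.mem_ofPred_eq] at *
    rw [map_smul, hx, smul_comm]

theorem mem_homog {i : ZMod 2} {x : Uq m n q} :
    x ∈ homog m n q i ↔ parity m n q x = sgn i • x := Iff.rfl

theorem part_mem (i : ZMod 2) (x : Uq m n q) : part i x ∈ homog m n q i := by
  rw [mem_homog, part_apply, map_smul, map_add, map_smul, parity_parity]
  have := sgn_mul_self i
  match_scalars <;> grind

theorem part_of_mem {i : ZMod 2} {x : Uq m n q} (hx : x ∈ homog m n q i) (j : ZMod 2) :
    part j x = if j = i then x else 0 := by
  rw [part_apply, mem_homog.1 hx, smul_smul]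
  rcases zmod2 i with rfl | rfl <;> rcases zmod2 j with rfl | rfl <;> simp <;> module

theorem gen_mem (u : Gen m n) : gen q u ∈ homog m n q (gpar u) := parity_gen u

theorem part_gen (u : Gen m n) (j : ZMod 2) :
    part j (gen q u) = if j = gpar u then gen q u else 0 := part_of_mem (gen_mem u) j

instance : SetLike.GradedMonoid (homog m n q) where
  one_mem := by simp [mem_homog]
  mul_mem i j x y hx hy := by
    rw [mem_homog] at *
    rw [map_mul, hx, hy, smul_mul_smul_comm, sgn_add]

noncomputable instance : DirectSum.Decomposition (homog m n q) :=
  .ofLinearMap (R := ℂ) _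
    (∑ i : ZMod 2, DirectSum.lof ℂ (ZMod 2) (fun i => homog m n q i) i ∘ₗ
      (part i).codRestrict (homog m n q i) (part_mem i))
    (by
      ext x
      simp only [LinearMap.comp_apply, LinearMap.sum_apply, map_sum, DirectSum.coeLinearMap_lof,
        LinearMap.codRestrict_apply, LinearMap.id_apply]
      exact (Fin.sum_univ_two (fun i : ZMod 2 => part i x)).trans (part_add_part x))
    (by
      ext i x : 2
      simp only [LinearMap.comp_apply, LinearMap.sum_apply, DirectSum.coeLinearMap_lof,
        LinearMap.id_apply]
      rw [Finset.sum_eq_single i]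
      · congr 1
        ext
        simp [part_of_mem x.2]
      · intro j _ hj
        rw [show (part j).codRestrict (homog m n q j) (part_mem j) (x : Uq m n q) = 0 by
          ext; simp [part_of_mem x.2, hj], map_zero]
      · simp)

noncomputable instance : GradedAlgebra (homog m n q) where

end Grading

section Coproduct
variable {m n : ℕ} {q : ℝ} [Fact (0 < q)]

/-- The two copies of `U_q(gl(m|n))` in its graded tensor square supercommute. -/
theorem cross_rel (u v : Gen m n) :
    GradedTensorProduct.includeRight (R := ℂ) (homog m n q) (homog m n q) (gen q v) *
      GradedTensorProduct.includeLeft (R := ℂ) (homog m n q) (homog m n q) (gen q u) =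
    sgn (gpar u * gpar v) •
      (GradedTensorProduct.includeLeft (R := ℂ) (homog m n q) (homog m n q) (gen q u) *
        GradedTensorProduct.includeRight (R := ℂ) (homog m n q) (homog m n q) (gen q v)) := by
  have h := GradedTensorProduct.tmul_coe_mul_coe_tmul (R := ℂ) (homog m n q) (homog m n q)
    1 (⟨_, gen_mem v⟩ : homog m n q (gpar v)) (⟨_, gen_mem u⟩ : homog m n q (gpar u)) 1
  have h' := GradedTensorProduct.tmul_one_mul_one_tmul (R := ℂ) (homog m n q) (homog m n q)
    (gen q u) (gen q v)
  erw [h, h']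
  simp only [one_mul, mul_one]
  rcases zmod2 (gpar u) with hu | hu <;> rcases zmod2 (gpar v) with hv | hv <;>
    simp [hu, hv]

end Coproduct

section Hopf
variable {m n : ℕ} {q : ℝ}

theorem isRel_counit : IsRel q (fun u : Gen m n => match u with
    | .K _ => (1 : ℂ) | .Kinv _ => 1 | .E _ => 0 | .F _ => 0) := by
  constructor <;> simp [qcomm, serre]

/-- The counit: `K_a ↦ 1`, `E_b ↦ 0`, `F_b ↦ 0`. -/
noncomputable def counit (m n : ℕ) (q : ℝ) : Uq m n q →ₐ[ℂ] ℂ :=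
  isRel_counit.lift

theorem lift_kap {B : Type*} [Ring B] [Algebra ℂ B] (f : Uq m n q →ₐ[ℂ] B) (b) :
    f (kap (gen q) b) = f (gen q (.K (lo b))) * f (gen q (.Kinv (hi b))) := map_mul _ _ _

theorem lift_kapInv {B : Type*} [Ring B] [Algebra ℂ B] (f : Uq m n q →ₐ[ℂ] B) (b) :
    f (kapInv (gen q) b) = f (gen q (.Kinv (lo b))) * f (gen q (.K (hi b))) := map_mul _ _ _

variable [Fact (0 < q)]

/-- The coproduct, with values in the graded tensor square, determined by
`K_a ↦ K_a ⊗ K_a`, `E_b ↦ E_b ⊗ K_b K_{b+1}⁻¹ + 1 ⊗ E_b`, `F_b ↦ F_b ⊗ 1 + K_b⁻¹ K_{b+1} ⊗ F_b`. -/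
noncomputable def comul (m n : ℕ) (q : ℝ) [Fact (0 < q)] :
    Uq m n q →ₐ[ℂ] (homog m n q) ᵍ⊗[ℂ] (homog m n q) :=
  (IsRel.comul (isRel_gen.map (GradedTensorProduct.includeLeft (homog m n q) (homog m n q)))
    (isRel_gen.map (GradedTensorProduct.includeRight (homog m n q) (homog m n q))) cross_rel).lift

/-- The scalar `1` on even and `i` on odd simple roots. -/
noncomputable def tw (b : Fin (m + n - 1)) : ℂ := if odd b = 0 then 1 else Complex.I

theorem tw_mul_self (b : Fin (m + n - 1)) : tw b * tw b = sgn (odd b) := by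
  unfold tw
  rcases zmod2 (odd b) with h | h <;> simp [h]

/-- Images of the generators under `x ↦ i^{[x]} S(x)`, an ordinary anti-homomorphism. -/
noncomputable def antipodeGen (q : ℝ) : Gen m n → (Uq m n q)ᵐᵒᵖ
  | .K a => .op (gen q (.Kinv a))
  | .Kinv a => .op (gen q (.K a))
  | .E b => .op (-tw b • (gen q (.E b) * kapInv (gen q) b))
  | .F b => .op (-tw b • (kap (gen q) b * gen q (.F b)))

/-- Images of the generators under `x ↦ i^{[x]} S⁻¹(x)`, an ordinary anti-homomorphism. -/
noncomputable def antipodeInvGen (q : ℝ) : Gen m n → (Uq m n q)ᵐᵒᵖ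
  | .K a => .op (gen q (.Kinv a))
  | .Kinv a => .op (gen q (.K a))
  | .E b => .op (-tw b • (kapInv (gen q) b * gen q (.E b)))
  | .F b => .op (-tw b • (gen q (.F b) * kap (gen q) b))

theorem isRel_antipodeGen : IsRel q (antipodeGen (m := m) (n := n) q) := by
  have h := (isRel_gen (m := m) (n := n) (q := q)).anti (d := fun b => -tw b)
    (e := fun b => -tw b * (cw q b b)⁻¹) (fun b => by
      have := cw_ne (q := q) b b
      rw [← tw_mul_self]; field_simp)
  convert! h using 1
  funext u
  cases u <;> simp [antipodeGen, antiGen, isRel_gen.kap_f, smul_smul]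

theorem isRel_antipodeInvGen : IsRel q (antipodeInvGen (m := m) (n := n) q) := by
  have h := (isRel_gen (m := m) (n := n) (q := q)).anti (d := fun b => -tw b * (cw q b b)⁻¹)
    (e := fun b => -tw b) (fun b => by
      have := cw_ne (q := q) b b
      rw [← tw_mul_self]; field_simp)
  convert! h using 1
  funext u
  cases u <;> simp [antipodeInvGen, antiGen, isRel_gen.kapInv_e, smul_smul]

/-- The super algebra anti-homomorphism `x ↦ (-i)^{[x]} f(x)` obtained from an ordinary
anti-homomorphism `f`. -/
noncomputable def superOp (f : Uq m n q →ₐ[ℂ] (Uq m n q)ᵐᵒᵖ) : Uq m n q →ₗ[ℂ] Uq m n q :=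
  (MulOpposite.opLinearEquiv ℂ).symm.toLinearMap ∘ₗ f.toLinearMap ∘ₗ
    (part 0 - Complex.I • part 1)

/-- The antipode `S` of `U_q(gl(m|n))`: the super anti-homomorphism with `K_a ↦ K_a⁻¹`,
`E_b ↦ -E_b K_b⁻¹ K_{b+1}`, `F_b ↦ -K_b K_{b+1}⁻¹ F_b`. -/
noncomputable def antipode (m n : ℕ) (q : ℝ) [Fact (0 < q)] : Uq m n q →ₗ[ℂ] Uq m n q :=
  superOp isRel_antipodeGen.lift

/-- The inverse of the antipode: the super anti-homomorphism with `K_a ↦ K_a⁻¹`,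
`E_b ↦ -K_b⁻¹ K_{b+1} E_b`, `F_b ↦ -F_b K_b K_{b+1}⁻¹`. -/
noncomputable def antipodeInv (m n : ℕ) (q : ℝ) [Fact (0 < q)] : Uq m n q →ₗ[ℂ] Uq m n q :=
  superOp isRel_antipodeInvGen.lift

theorem superOp_of_mem (f : Uq m n q →ₐ[ℂ] (Uq m n q)ᵐᵒᵖ) {i : ZMod 2} {x : Uq m n q}
    (hx : x ∈ homog m n q i) :
    superOp f x = (if i = 0 then 1 else -Complex.I) • (f x).unop := by
  rcases zmod2 i with rfl | rfl <;> simp [superOp, part_of_mem hx]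

theorem antipode_mul {i j : ZMod 2} {x y : Uq m n q} (hx : x ∈ homog m n q i)
    (hy : y ∈ homog m n q j) :
    antipode m n q (x * y) = sgn (i * j) • (antipode m n q y * antipode m n q x) := by
  unfold antipode
  rw [superOp_of_mem _ (SetLike.mul_mem_graded hx hy), superOp_of_mem _ hx,
    superOp_of_mem _ hy, smul_mul_smul_comm, map_mul, MulOpposite.unop_mul, smul_smul]
  congr 1
  rcases zmod2 i with rfl | rfl <;> rcases zmod2 j with rfl | rfl <;>
    simp [show (1 : ZMod 2) + 1 = 0 from rfl]

theorem antipode_E (b : Fin (m + n - 1)) :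
    antipode m n q (gen q (.E b)) = -(gen q (.E b) * kapInv (gen q) b) := by
  unfold antipode
  rw [superOp_of_mem _ (gen_mem _), IsRel.lift_gen]
  rcases zmod2 (odd b) with h | h <;> simp [gpar, antipodeGen, tw, h, smul_smul]

theorem antipode_F (b : Fin (m + n - 1)) :
    antipode m n q (gen q (.F b)) = -(kap (gen q) b * gen q (.F b)) := by
  unfold antipode
  rw [superOp_of_mem _ (gen_mem _), IsRel.lift_gen]
  rcases zmod2 (odd b) with h | h <;> simp [gpar, antipodeGen, tw, h, smul_smul]

theorem antipode_K (a : Fin (m + n)) : antipode m n q (gen q (.K a)) = gen q (.Kinv a) := by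
  unfold antipode
  rw [superOp_of_mem _ (gen_mem _), IsRel.lift_gen]
  simp [gpar, antipodeGen]

theorem part_parity (f : Uq m n q →ₐ[ℂ] (Uq m n q)ᵐᵒᵖ)
    (hf : ∀ u, parity m n q (f (gen q u)).unop = sgn (gpar u) • (f (gen q u)).unop)
    (x : Uq m n q) : parity m n q (f x).unop = (f (parity m n q x)).unop := by
  have : (AlgHom.op (parity m n q)).comp f = f.comp (parity m n q) := by
    apply Uq.hom_ext
    intro u
    apply MulOpposite.unop_injective
    simp [parity_gen, hf]
  simpa using congrArg MulOpposite.unop (DFunLike.congr_fun this x)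

theorem parity_kap (b : Fin (m + n - 1)) : parity m n q (kap (gen q) b) = kap (gen q) b := by
  simp [kap, parity_gen, gpar]

theorem parity_kapInv (b : Fin (m + n - 1)) :
    parity m n q (kapInv (gen q) b) = kapInv (gen q) b := by
  simp [kapInv, parity_gen, gpar]

theorem superOp_superOp (f g : Uq m n q →ₐ[ℂ] (Uq m n q)ᵐᵒᵖ)
    (hf : ∀ u, parity m n q (f (gen q u)).unop = sgn (gpar u) • (f (gen q u)).unop)
    (hgf : ∀ u, (g (f (gen q u)).unop).unop = sgn (gpar u) • gen q u) (x : Uq m n q) :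
    superOp g (superOp f x) = x := by
  have key : ∀ x, (g (f x).unop).unop = parity m n q x := by
    intro x
    have : ((AlgEquiv.opOp ℂ (Uq m n q)).symm : _ →ₐ[ℂ] Uq m n q).comp
        ((AlgHom.op g).comp f) = parity m n q := by
      apply Uq.hom_ext
      intro u
      rw [parity_gen, ← hgf]
      rfl
    exact DFunLike.congr_fun this x
  have hom : ∀ i, ∀ x ∈ homog m n q i, superOp g (superOp f x) = x := by
    intro i x hx
    have h2 : (f x).unop ∈ homog m n q i := by
      rw [mem_homog, part_parity f hf, mem_homog.1 hx]; simp
    rw [superOp_of_mem f hx, map_smul, superOp_of_mem g h2, key, mem_homog.1 hx, smul_smul,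
      smul_smul]
    rcases zmod2 i with rfl | rfl <;> simp
  rw [← part_add_part x, map_add, map_add, hom 0 _ (part_mem 0 x), hom 1 _ (part_mem 1 x)]

theorem antipodeInv_antipode (x : Uq m n q) :
    antipodeInv m n q (antipode m n q x) = x := by
  refine superOp_superOp _ _ ?_ ?_ x
  · intro u
    rw [IsRel.lift_gen]
    cases u <;> simp [antipodeGen, parity_gen, gpar, parity_kap, parity_kapInv, smul_smul, mul_comm]
  · intro u
    rw [IsRel.lift_gen]
    have h := isRel_gen (m := m) (n := n) (q := q)
    cases u with
    | K a => simp [antipodeGen, IsRel.lift_gen, antipodeInvGen, gpar]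
    | Kinv a => simp [antipodeGen, IsRel.lift_gen, antipodeInvGen, gpar]
    | E b =>
      simp [antipodeGen, IsRel.lift_gen, antipodeInvGen, gpar, lift_kapInv, smul_smul,
        tw_mul_self]
      rw [show gen q (.Kinv (hi b)) * gen q (.K (lo b)) = kap (gen q) b from h.kik _ _, ← mul_assoc, h.kap_kapInv, one_mul]
    | F b =>
      simp [antipodeGen, IsRel.lift_gen, antipodeInvGen, gpar, lift_kap, smul_smul,
        tw_mul_self]
      rw [show gen q (.K (hi b)) * gen q (.Kinv (lo b)) = kapInv (gen q) b from (h.kik _ _).symm, mul_assoc, h.kap_kapInv, mul_one]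

theorem antipode_antipodeInv (x : Uq m n q) :
    antipode m n q (antipodeInv m n q x) = x := by
  refine superOp_superOp _ _ ?_ ?_ x
  · intro u
    rw [IsRel.lift_gen]
    cases u <;> simp [antipodeInvGen, parity_gen, gpar, parity_kap, parity_kapInv, smul_smul, mul_comm]
  · intro u
    rw [IsRel.lift_gen]
    have h := isRel_gen (m := m) (n := n) (q := q)
    cases u with
    | K a => simp [antipodeGen, IsRel.lift_gen, antipodeInvGen, gpar]
    | Kinv a => simp [antipodeGen, IsRel.lift_gen, antipodeInvGen, gpar]
    | E b =>
      simp [antipodeGen, IsRel.lift_gen, antipodeInvGen, gpar, lift_kapInv, smul_smul,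
        tw_mul_self]
      rw [show gen q (.Kinv (hi b)) * gen q (.K (lo b)) = kap (gen q) b from h.kik _ _, mul_assoc, h.kapInv_kap, mul_one]
    | F b =>
      simp [antipodeGen, IsRel.lift_gen, antipodeInvGen, gpar, lift_kap, smul_smul,
        tw_mul_self]
      rw [show gen q (.K (hi b)) * gen q (.Kinv (lo b)) = kapInv (gen q) b from (h.kik _ _).symm, ← mul_assoc, h.kapInv_kap, one_mul]

end Hopf

section VectorRep
variable {m n : ℕ} {q : ℝ}

/-- The images of the generators in the vector representation. -/
noncomputable def vecGen (q : ℝ) : Gen m n → Matrix (Fin (m + n)) (Fin (m + n)) ℂ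
  | .K a => Matrix.diagonal fun c => if c = a then qa q a else 1
  | .Kinv a => Matrix.diagonal fun c => if c = a then (qa q a)⁻¹ else 1
  | .E b => Matrix.single (lo b) (hi b) 1
  | .F b => Matrix.single (hi b) (lo b) 1

theorem single_single {N : ℕ} (i j k l : Fin N) :
    Matrix.single i j (1 : ℂ) * Matrix.single k l 1 = if j = k then Matrix.single i l 1 else 0 := by
  split_ifs with h
  · subst h; simp
  · exact Matrix.single_mul_single_of_ne _ _ _ _ h _

theorem diag_single_diag {N : ℕ} (d e : Fin N → ℂ) (i j : Fin N) :
    Matrix.diagonal d * Matrix.single i j (1 : ℂ) * Matrix.diagonal e =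
      (d i * e j) • Matrix.single i j 1 := by
  ext a b
  simp only [Matrix.mul_diagonal, Matrix.diagonal_mul, Matrix.smul_apply, Matrix.single_apply,
    smul_eq_mul]
  split_ifs with h
  · obtain ⟨rfl, rfl⟩ := h; ring
  · ring

theorem isRel_vecGen [hq : Fact (0 < q)] [hq1 : Fact (q ≠ 1)] :
    IsRel q (vecGen (m := m) (n := n) q) := by
  have E2 : ∀ a b : Fin (m + n - 1), (a : ℕ) + 1 ≠ b → hi a ≠ lo b := fun a b h => by
    simpa [hi, lo, Fin.ext_iff] using h
  have L2 : ∀ a b : Fin (m + n - 1), (b : ℕ) + 1 ≠ a → lo a ≠ hi b := fun a b h => by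
    simpa [hi, lo, Fin.ext_iff] using h.symm
  have Eself : ∀ a : Fin (m + n - 1), hi a ≠ lo a := fun a => E2 a a (by omega)
  have qd : ∀ a : Fin (m + n), qa q a - (qa q a)⁻¹ ≠ 0 := fun a => by
    have h0 : qa q a ≠ 0 := qa_ne a
    intro h
    have h1 : qa q a * qa q a = 1 := by
      field_simp at h
      linear_combination h
    have h2 : q * q = 1 := by
      have hqc : (q : ℂ) ≠ 0 := by exact_mod_cast hq.out.ne'
      have : (q : ℂ) * q = 1 := by
        unfold qa at h1
        split_ifs at h1
        · exact h1
        · field_simp at h1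
          linear_combination -h1
      exact_mod_cast this
    have hp := hq.out
    exact hq1.out (by nlinarith)
  constructor
  · intro a
    rw [vecGen, vecGen, Matrix.diagonal_mul_diagonal, ← Matrix.diagonal_one]
    congr 1; funext c
    split_ifs
    · exact mul_inv_cancel₀ (qa_ne a)
    · simp
  · intro a
    rw [vecGen, vecGen, Matrix.diagonal_mul_diagonal, ← Matrix.diagonal_one]
    congr 1; funext c
    split_ifs
    · exact inv_mul_cancel₀ (qa_ne a)
    · simp
  · intro a b
    simp only [vecGen, Matrix.diagonal_mul_diagonal, mul_comm]
  · intro a b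
    simp only [vecGen, diag_single_diag]
    congr 1
    unfold wt
    have := lo_ne_hi b
    by_cases h1 : a = lo b
    · subst h1; simp [this.symm]
    · by_cases h2 : a = hi b
      · subst h2; simp [this, h1]
      · simp [h1, h2, Ne.symm h1, Ne.symm h2, eq_comm]
  · intro a b
    simp only [vecGen, diag_single_diag]
    congr 1
    unfold wt
    have := lo_ne_hi b
    by_cases h1 : a = lo b
    · subst h1; simp [this.symm]
    · by_cases h2 : a = hi b
      · subst h2; simp [this, h1]
      · simp [h1, h2, Ne.symm h1, Ne.symm h2, eq_comm]
  · intro a b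
    by_cases hab : a = b
    · subst hab
      have ho : odd a * odd a = odd a := by
        rcases zmod2 (odd a) with h | h <;> simp [h]
      have h1 := lo_ne_hi a
      have h2 := qd (lo a)
      have h3 : qa q (lo a) ≠ 0 := qa_ne _
      simp only [vecGen, qcomm, single_single, if_true, ho, Matrix.diagonal_mul_diagonal]
      ext i j
      by_cases hij : i = j
      · subst hij
        simp only [Matrix.sub_apply, Matrix.smul_apply, Matrix.single_apply,
          Matrix.diagonal_apply_eq, smul_eq_mul, and_self]
        by_cases hl : i = lo a
        · subst hl
          have h4 := inv_mul_cancel₀ h2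
          simp [h1, h1.symm]
          linear_combination -h4
        · by_cases hh : i = hi a
          · subst hh
            rcases zmod2 (odd a) with h | h
            · have := qa_hi (q := q) h
              have h4 := inv_mul_cancel₀ h2
              simp [h1, h1.symm, h, this]
              linear_combination h4
            · have e1 := qa_hi_odd (q := q) h
              have e2 := qa_lo_odd (q := q) h
              rw [e2] at h2
              have h4 := inv_mul_cancel₀ h2
              simp [h1, h1.symm, h, e1, e2]
              linear_combination -h4
          · simp [hl, hh, Ne.symm hl, Ne.symm hh]
      · have : ∀ k, ¬ (k = i ∧ k = j) := fun k hk => hij (hk.1.symm.trans hk.2)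
        simp [Matrix.single_apply, Matrix.diagonal_apply_ne _ hij, this]
    · have h1 : hi a ≠ hi b := fun h => hab (hi_inj.1 h)
      have h2 : lo b ≠ lo a := fun h => hab (lo_inj.1 h.symm)
      simp [vecGen, qcomm, single_single, hab, h1, h2]
  · intro b _; simp [vecGen, single_single, Eself]
  · intro b _; simp [vecGen, single_single, lo_ne_hi]
  · intro a b h
    simp [vecGen, single_single, E2 a b (by omega), E2 b a (by omega)]
  · intro a b h
    simp [vecGen, single_single, L2 a b (by omega), L2 b a (by omega)]
  · intro a b _ h
    simp only [vecGen, serre, single_single, if_neg (Eself a), zero_mul]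
    rcases h with h | h
    · simp [E2 b a (by omega), mul_assoc, single_single, Eself, apply_ite]
    · simp [E2 a b (by omega), mul_assoc, single_single, Eself, apply_ite]
  · intro a b _ h
    simp only [vecGen, serre, single_single, if_neg (lo_ne_hi a), zero_mul]
    rcases h with h | h
    · simp [L2 a b (by omega), mul_assoc, single_single, lo_ne_hi, apply_ite]
    · simp [L2 b a (by omega), mul_assoc, single_single, lo_ne_hi, apply_ite]
  · intro a b c _ h1 h2
    have h3 : lo c ≠ lo a := fun h => by have := lo_inj.1 h; omega
    simp [vecGen, qcomm, mul_sub, sub_mul, single_single, Eself, E2 b a (by omega),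
      E2 c b (by omega), E2 c a (by omega), hi_eq_lo h1, hi_eq_lo h2, h3]
  · intro a b c _ h1 h2
    have h3 : hi a ≠ hi c := fun h => by have := hi_inj.1 h; omega
    simp [vecGen, qcomm, mul_sub, sub_mul, single_single, lo_ne_hi, L2 a b (by omega),
      L2 b c (by omega), L2 a c (by omega), ← hi_eq_lo h1, ← hi_eq_lo h2, h3]

/-- The vector representation `π` of `U_q(gl(m|n))`. -/
noncomputable def vec (m n : ℕ) (q : ℝ) [Fact (0 < q)] [Fact (q ≠ 1)] :
    Uq m n q →ₐ[ℂ] Matrix (Fin (m + n)) (Fin (m + n)) ℂ :=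
  isRel_vecGen.lift

end VectorRep

section Functionals
variable {m n : ℕ} {q : ℝ}

/-- The right translation `(x ∘ f)(y) = f(y x)`. -/
noncomputable def circ (m n : ℕ) (q : ℝ) :
    Uq m n q →ₐ[ℂ] Module.End ℂ (Module.Dual ℂ (Uq m n q)) :=
  AlgHom.ofLinearMap
    { toFun := fun x =>
        { toFun := fun f => f ∘ₗ LinearMap.mulRight ℂ x
          map_add' := fun f g => LinearMap.add_comp _ _ _
          map_smul' := fun c f => LinearMap.smul_comp _ _ _ }
      map_add' := fun x y => by ext f z; simp [mul_add]
      map_smul' := fun c x => by ext f z; simp }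
    (by ext f z; simp) (fun x y => by ext f z; simp [mul_assoc])

theorem circ_apply (x y : Uq m n q) (f : Module.Dual ℂ (Uq m n q)) :
    circ m n q x f y = f (y * x) := rfl

variable [Fact (0 < q)]

/-- The functional `x ↦ ∑ f(x₁) g(x₂)`, with no sign. -/
noncomputable def splitMul (f g : Module.Dual ℂ (Uq m n q)) : Module.Dual ℂ (Uq m n q) :=
  LinearMap.mul' ℂ ℂ ∘ₗ TensorProduct.map f g ∘ₗ
    (GradedTensorProduct.of ℂ (homog m n q) (homog m n q)).symm.toLinearMap ∘ₗ
      (comul m n q).toLinearMap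

/-- The product of functionals, `(f g)(x) = ∑ (-1)^{[g][x₁]} f(x₁) g(x₂)`, obtained by splitting
`g` into its even and odd parts. -/
noncomputable def conv (f g : Module.Dual ℂ (Uq m n q)) : Module.Dual ℂ (Uq m n q) :=
  splitMul f (g ∘ₗ part 0) + splitMul (f ∘ₗ (parity m n q).toLinearMap) (g ∘ₗ part 1)

/-- The smallest space of functionals containing the unit `ε` and all `f a b` and closed under the
product: the algebra generated by the `f a b`. -/
noncomputable def genAlg (f : Fin (m + n) → Fin (m + n) → Module.Dual ℂ (Uq m n q)) :
    Submodule ℂ (Module.Dual ℂ (Uq m n q)) :=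
  sInf {G | (counit m n q).toLinearMap ∈ G ∧ (∀ a b, f a b ∈ G) ∧
    ∀ g ∈ G, ∀ h ∈ G, conv g h ∈ G}

/-- The ordered monomial `z_1^{L_1} z_2^{L_2} ⋯ z_{m+n}^{L_{m+n}}`. -/
noncomputable def monomial (z : Fin (m + n) → Module.Dual ℂ (Uq m n q)) (L : Fin (m + n) → ℕ) :
    Module.Dual ℂ (Uq m n q) :=
  ((List.finRange (m + n)).flatMap fun a => List.replicate (L a) (z a)).foldr conv
    (counit m n q).toLinearMap

/-- The map underlying the left translation `(x · f)(y) = (-1)^{[x][y]} f(S⁻¹(x) y)`. -/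
noncomputable def dotLin (m n : ℕ) (q : ℝ) [Fact (0 < q)] :
    Uq m n q →ₗ[ℂ] Module.End ℂ (Module.Dual ℂ (Uq m n q)) where
  toFun x :=
    { toFun := fun f => f ∘ₗ (LinearMap.mulLeft ℂ (antipodeInv m n q (part 0 x)) +
        LinearMap.mulLeft ℂ (antipodeInv m n q (part 1 x)) ∘ₗ (parity m n q).toLinearMap)
      map_add' := fun f g => LinearMap.add_comp _ _ _
      map_smul' := fun c f => LinearMap.smul_comp _ _ _ }
  map_add' x y := by
    ext f z
    simp [add_mul]
    abel
  map_smul' c x := by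
    ext f z
    simp [mul_add]

theorem dotLin_apply {i j : ZMod 2} {x y : Uq m n q} (hx : x ∈ homog m n q i)
    (hy : y ∈ homog m n q j) (f : Module.Dual ℂ (Uq m n q)) :
    dotLin m n q x f y = sgn (i * j) * f (antipodeInv m n q x * y) := by
  rcases zmod2 i with rfl | rfl <;> rcases zmod2 j with rfl | rfl <;>
    simp [dotLin, part_of_mem hx, mem_homog.1 hy]

theorem antipodeInv_mem {i : ZMod 2} {x : Uq m n q} (hx : x ∈ homog m n q i) :
    antipodeInv m n q x ∈ homog m n q i := by
  have h2 : (isRel_antipodeInvGen.lift x).unop ∈ homog m n q i := by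
    rw [mem_homog, part_parity, mem_homog.1 hx]
    · simp
    · intro u
      rw [IsRel.lift_gen]
      cases u <;> simp [antipodeInvGen, parity_gen, gpar, parity_kap, parity_kapInv, smul_smul,
        mul_comm]
  unfold antipodeInv
  rw [superOp_of_mem _ hx]
  exact Submodule.smul_mem _ _ h2

theorem antipodeInv_mul {i j : ZMod 2} {x y : Uq m n q} (hx : x ∈ homog m n q i)
    (hy : y ∈ homog m n q j) :
    antipodeInv m n q (x * y) = sgn (i * j) • (antipodeInv m n q y * antipodeInv m n q x) := by
  unfold antipodeInv
  rw [superOp_of_mem _ (SetLike.mul_mem_graded hx hy), superOp_of_mem _ hx,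
    superOp_of_mem _ hy, smul_mul_smul_comm, map_mul, MulOpposite.unop_mul, smul_smul]
  congr 1
  rcases zmod2 i with rfl | rfl <;> rcases zmod2 j with rfl | rfl <;>
    simp [show (1 : ZMod 2) + 1 = 0 from rfl]

theorem dotLin_mul (x y : Uq m n q) : dotLin m n q (x * y) = dotLin m n q x * dotLin m n q y := by
  have hom : ∀ i j k, ∀ x ∈ homog m n q i, ∀ y ∈ homog m n q j, ∀ z ∈ homog m n q k, ∀ f,
      dotLin m n q (x * y) f z = dotLin m n q x (dotLin m n q y f) z := by
    intro i j k x hx y hy z hz f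
    rw [dotLin_apply (SetLike.mul_mem_graded hx hy) hz, dotLin_apply hx hz,
      dotLin_apply hy (SetLike.mul_mem_graded (antipodeInv_mem hx) hz), antipodeInv_mul hx hy,
      smul_mul_assoc, map_smul, mul_assoc, smul_eq_mul]
    have h1 : (1 : ZMod 2) + 1 = 0 := rfl
    rcases zmod2 i with rfl | rfl <;> rcases zmod2 j with rfl | rfl <;>
      rcases zmod2 k with rfl | rfl <;> simp [h1]
  ext f z
  rw [← part_add_part x, ← part_add_part y, ← part_add_part z]
  simp only [add_mul, mul_add, map_add, LinearMap.add_apply, Module.End.mul_apply]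
  simp only [hom _ _ _ _ (part_mem _ x) _ (part_mem _ y) _ (part_mem _ z)]

theorem antipodeInv_one : antipodeInv m n q 1 = 1 := by
  unfold antipodeInv
  rw [superOp_of_mem _ (SetLike.GradedOne.one_mem : (1 : Uq m n q) ∈ homog m n q 0)]
  simp

/-- The left translation `(x · f)(y) = (-1)^{[x][y]} f(S⁻¹(x) y)`. -/
noncomputable def dot (m n : ℕ) (q : ℝ) [Fact (0 < q)] :
    Uq m n q →ₐ[ℂ] Module.End ℂ (Module.Dual ℂ (Uq m n q)) :=
  AlgHom.ofLinearMap (dotLin m n q)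
    (by
      have h1 : (1 : Uq m n q) ∈ homog m n q 0 := SetLike.GradedOne.one_mem
      ext f z
      simp [dotLin, part_of_mem h1, antipodeInv_one])
    dotLin_mul

/-- Functionals with values in a one-dimensional space, as `V ⊗ (dual of U_q)` with `V = ℂ`. -/
abbrev VDual (m n : ℕ) (q : ℝ) : Type := ℂ ⊗[ℂ] Module.Dual ℂ (Uq m n q)

/-- `id_V ⊗ (x ∘)`. -/
noncomputable def circV (m n : ℕ) (q : ℝ) : Uq m n q →ₐ[ℂ] Module.End ℂ (VDual m n q) :=
  (Module.End.lTensorAlgHom ℂ _ ℂ).comp (circ m n q)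

/-- `id_V ⊗ (x ·)`; the spanning vector of `V` is even, so there is no sign. -/
noncomputable def dotV (m n : ℕ) (q : ℝ) [Fact (0 < q)] :
    Uq m n q →ₐ[ℂ] Module.End ℂ (VDual m n q) :=
  (Module.End.lTensorAlgHom ℂ _ ℂ).comp (dot m n q)

/-- The action of the parity automorphism on `V ⊗ (dual of U_q)`; an element is homogeneous of
degree `j` when it is an eigenvector of eigenvalue `(-1)^j`. -/
noncomputable def parityV (m n : ℕ) (q : ℝ) [Fact (0 < q)] : Module.End ℂ (VDual m n q) :=
  (Module.Dual.transpose (parity m n q).toLinearMap).lTensor ℂ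

end Functionals

section MatrixElements
variable {m n : ℕ} (q : ℝ) [Fact (0 < q)] [Fact (q ≠ 1)]

/-- The matrix element `t_{ab}(x) = π(x)_{ab}` of the vector representation. -/
noncomputable def tEl (a b : Fin (m + n)) : Module.Dual ℂ (Uq m n q) :=
  (Matrix.entryLinearMap ℂ ℂ a b) ∘ₗ (vec m n q).toLinearMap

/-- The matrix element `t̄_{ab}(x) = (-1)^{[x][b]} π(S(x))_{ba}` of the dual of the vector
representation, relative to the dual basis. -/
noncomputable def tBarEl (a b : Fin (m + n)) : Module.Dual ℂ (Uq m n q) :=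
  tEl q b a ∘ₗ antipode m n q ∘ₗ (part 0 + sgn (par b) • part 1)

/-- The last index. -/
def lastIdx {m n : ℕ} (hn : 0 < n) : Fin (m + n) := ⟨m + n - 1, by omega⟩

/-- `Z^L`, for `z_a = t_{a,m+n}`. -/
noncomputable def zMon (hn : 0 < n) (L : Fin (m + n) → ℕ) : Module.Dual ℂ (Uq m n q) :=
  monomial (fun a => tEl q a (lastIdx hn)) L

/-- `Z̄^L`, for `z̄_a = t̄_{a,m+n}`. -/
noncomputable def zBarMon (hn : 0 < n) (L : Fin (m + n) → ℕ) : Module.Dual ℂ (Uq m n q) :=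
  monomial (fun a => tBarEl q a (lastIdx hn)) L

/-- The multi-indices `L ∈ {0,1}^m × ℕ^n` with `|L| = k`. -/
def MultiIndex (m n k : ℕ) : Type :=
  {L : Fin (m + n) → ℕ // (∀ a : Fin (m + n), (a : ℕ) < m → L a ≤ 1) ∧ ∑ a, L a = k}

/-- Matrix elements of the action of `U_q(gl(m|n))` on the `k`-th tensor power of the vector
representation, given by `x (v ⊗ w) = ∑ (-1)^{[x₂][v]} x₁ v ⊗ x₂ w`. -/
noncomputable def tensorCoeff : (k : ℕ) → (Fin k → Fin (m + n)) → (Fin k → Fin (m + n)) →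
    Module.Dual ℂ (Uq m n q)
  | 0, _, _ => (counit m n q).toLinearMap
  | k + 1, a, b => splitMul (tEl q (a 0) (b 0))
      (tensorCoeff k (fun i => a i.succ) (fun i => b i.succ) ∘ₗ
        (part 0 + sgn (par (b 0)) • part 1))

/-- The action of `U_q(gl(m|n))` on the `k`-th tensor power of the vector representation, in the
coordinates given by the basis `v_{a_1} ⊗ ⋯ ⊗ v_{a_k}`. -/
noncomputable def tensorAct (k : ℕ) (x : Uq m n q) (c : (Fin k → Fin (m + n)) → ℂ) :
    (Fin k → Fin (m + n)) → ℂ :=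
  fun a => ∑ b, tensorCoeff q k a b x * c b

/-- The skew supersymmetric tensors of rank `k`, by their coordinates `c`. -/
def skewTensors (m n k : ℕ) (q : ℝ) : Submodule ℂ ((Fin k → Fin (m + n)) → ℂ) where
  carrier := {c | ∀ (a : Fin k → Fin (m + n)) (i j : Fin k), (i : ℕ) + 1 = j →
    (a i = a j → par (a i) = 0 → c a = 0) ∧
    (a i < a j → c (a ∘ Equiv.swap i j) = -sgn (par (a i) * par (a j)) * (q : ℂ)⁻¹ * c a)}
  zero_mem' := fun a i j _ => by simp
  add_mem' := fun {c d} hc hd a i j h =>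
    ⟨fun h1 h2 => by simp [(hc a i j h).1 h1 h2, (hd a i j h).1 h1 h2], fun h1 => by
      simp only [Pi.add_apply, (hc a i j h).2 h1, (hd a i j h).2 h1]; ring⟩
  smul_mem' := fun r c hc a i j h =>
    ⟨fun h1 h2 => by simp [(hc a i j h).1 h1 h2], fun h1 => by
      simp only [Pi.smul_apply, (hc a i j h).2 h1, smul_eq_mul]; ring⟩

end MatrixElements

section Parabolic
variable {m n : ℕ} (q : ℝ)

/-- The generators of a parabolic subalgebra: all `K_a^{±1}`, the `E_b` with `b ∈ A` and the
`F_b` with `b ∈ B`. -/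
def parabolicGen (A B : Set (Fin (m + n - 1))) : Gen m n → Prop
  | .K _ => True
  | .Kinv _ => True
  | .E b => b ∈ A
  | .F b => b ∈ B

/-- The subalgebra of `U_q(gl(m|n))` generated by all `K_a^{±1}`, the `E_b` with `b ∈ A` and the
`F_b` with `b ∈ B`. -/
noncomputable def parabolic (A B : Set (Fin (m + n - 1))) : Subalgebra ℂ (Uq m n q) :=
  Algebra.adjoin ℂ (gen q '' {u | parabolicGen A B u})

theorem gen_mem_parabolic {A B : Set (Fin (m + n - 1))} {u : Gen m n} (hu : parabolicGen A B u) :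
    gen q u ∈ parabolic q A B :=
  Algebra.subset_adjoin ⟨u, hu, rfl⟩

/-- The set `Θ` of all simple root indices except the last one. -/
def theta (m n : ℕ) : Set (Fin (m + n - 1)) := {c | (c : ℕ) + 2 ≠ m + n}

/-- `U_q(p_+)`. -/
noncomputable def pPlus (m n : ℕ) (q : ℝ) : Subalgebra ℂ (Uq m n q) :=
  parabolic q Set.univ (theta m n)

/-- `U_q(p_-)`. -/
noncomputable def pMinus (m n : ℕ) (q : ℝ) : Subalgebra ℂ (Uq m n q) :=
  parabolic q (theta m n) Set.univ

variable {q} [Fact (0 < q)]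

theorem parity_mem_parabolic {A B : Set (Fin (m + n - 1))} {x : Uq m n q}
    (hx : x ∈ parabolic q A B) : parity m n q x ∈ parabolic q A B := by
  have : parabolic q A B ≤ (parabolic q A B).comap (parity m n q) := by
    refine Algebra.adjoin_le ?_
    rintro _ ⟨u, hu, rfl⟩
    simp only [SetLike.mem_coe, Subalgebra.mem_comap, parity_gen]
    exact Subalgebra.smul_mem _ (gen_mem_parabolic q hu) _
  exact this hx

theorem part_mem_parabolic {A B : Set (Fin (m + n - 1))} {x : Uq m n q}
    (hx : x ∈ parabolic q A B) (i : ZMod 2) : part i x ∈ parabolic q A B := by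
  rw [part_apply]
  exact Subalgebra.smul_mem _ (Subalgebra.add_mem _ hx
    (Subalgebra.smul_mem _ (parity_mem_parabolic hx) _)) _

theorem antipode_mem_parabolic {A B : Set (Fin (m + n - 1))} {x : Uq m n q}
    (hx : x ∈ parabolic q A B) : antipode m n q x ∈ parabolic q A B := by
  have kap_mem : ∀ b, kap (gen q) b ∈ parabolic q A B := fun b =>
    Subalgebra.mul_mem _ (gen_mem_parabolic q (u := .K (lo b)) trivial)
      (gen_mem_parabolic q (u := .Kinv (hi b)) trivial)
  have kapInv_mem : ∀ b, kapInv (gen q) b ∈ parabolic q A B := fun b =>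
    Subalgebra.mul_mem _ (gen_mem_parabolic q (u := .Kinv (lo b)) trivial)
      (gen_mem_parabolic q (u := .K (hi b)) trivial)
  have key : parabolic q A B ≤ (parabolic q A B).op.comap
      (isRel_antipodeGen (m := m) (n := n) (q := q)).lift := by
    refine Algebra.adjoin_le ?_
    rintro _ ⟨u, hu, rfl⟩
    rw [Set.mem_ofPred_eq] at hu
    simp only [SetLike.mem_coe, Subalgebra.mem_comap, IsRel.lift_gen, Subalgebra.mem_op]
    cases u with
    | K a => exact gen_mem_parabolic q (u := .Kinv a) trivial
    | Kinv a => exact gen_mem_parabolic q (u := .K a) trivial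
    | E b =>
      exact Subalgebra.smul_mem (parabolic q A B)
        (Subalgebra.mul_mem _ (gen_mem_parabolic q (u := .E b) hu) (kapInv_mem b)) (-tw b)
    | F b =>
      exact Subalgebra.smul_mem (parabolic q A B)
        (Subalgebra.mul_mem _ (kap_mem b) (gen_mem_parabolic q (u := .F b) hu)) (-tw b)
  exact key (Subalgebra.sub_mem _ (part_mem_parabolic hx 0)
    (Subalgebra.smul_mem _ (part_mem_parabolic hx 1) Complex.I))

/-- The antipode, restricted to a parabolic subalgebra. -/
noncomputable def antipodeP (A B : Set (Fin (m + n - 1))) (p : parabolic q A B) :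
    parabolic q A B :=
  ⟨antipode m n q p, antipode_mem_parabolic p.2⟩

/-- The one-dimensional representation of `U_q(p_+)` on `V_+ = ℂ v`: all `E_b` and all `F_c`
with `c ∈ Θ` act by zero, `K_{m+n}` acts by `q^{-k}` and the other `K_a` act by `1`. -/
structure IsPlusChar (hn : 0 < n) (k : ℕ) (φ : pPlus m n q →ₐ[ℂ] ℂ) : Prop where
  e : ∀ b, φ ⟨gen q (.E b), gen_mem_parabolic q (Set.mem_univ b)⟩ = 0
  f : ∀ c (hc : c ∈ theta m n), φ ⟨gen q (.F c), gen_mem_parabolic q hc⟩ = 0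
  k_one : ∀ a, a ≠ lastIdx hn → φ ⟨gen q (.K a), gen_mem_parabolic q trivial⟩ = 1
  k_last : φ ⟨gen q (.K (lastIdx hn)), gen_mem_parabolic q trivial⟩ = ((q : ℂ) ^ k)⁻¹

/-- The one-dimensional representation of `U_q(p_-)` on `V_- = ℂ w`: all `F_b` and all `E_c`
with `c ∈ Θ` act by zero, `K_{m+n}` acts by `q^k` and the other `K_a` act by `1`. -/
structure IsMinusChar (hn : 0 < n) (k : ℕ) (ψ : pMinus m n q →ₐ[ℂ] ℂ) : Prop where
  e : ∀ c (hc : c ∈ theta m n), ψ ⟨gen q (.E c), gen_mem_parabolic q hc⟩ = 0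
  f : ∀ b, ψ ⟨gen q (.F b), gen_mem_parabolic q (Set.mem_univ b)⟩ = 0
  k_one : ∀ a, a ≠ lastIdx hn → ψ ⟨gen q (.K a), gen_mem_parabolic q trivial⟩ = 1
  k_last : ψ ⟨gen q (.K (lastIdx hn)), gen_mem_parabolic q trivial⟩ = (q : ℂ) ^ k

/-- The subspace `V ⊗ G` of `V ⊗ (dual of U_q)`. -/
noncomputable def vTensor (G : Submodule ℂ (Module.Dual ℂ (Uq m n q))) :
    Submodule ℂ (VDual m n q) :=
  LinearMap.range (G.subtype.lTensor ℂ)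

/-- The elements `ζ` of `V ⊗ G` with `p ∘ ζ = φ(S(p)) ζ` for all `p` in the parabolic
subalgebra. -/
noncomputable def induced {A B : Set (Fin (m + n - 1))} (φ : parabolic q A B →ₐ[ℂ] ℂ)
    (G : Submodule ℂ (Module.Dual ℂ (Uq m n q))) : Submodule ℂ (VDual m n q) where
  carrier := {ζ | ζ ∈ vTensor G ∧
    ∀ p : parabolic q A B, circV m n q p ζ = φ (antipodeP A B p) • ζ}
  zero_mem' := ⟨Submodule.zero_mem _, fun p => by simp⟩
  add_mem' := fun {x y} hx hy =>
    ⟨Submodule.add_mem _ hx.1 hy.1, fun p => by rw [map_add, hx.2 p, hy.2 p, smul_add]⟩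
  smul_mem' := fun c x hx =>
    ⟨Submodule.smul_mem _ c hx.1, fun p => by rw [map_smul, hx.2 p, smul_comm]⟩

end Parabolic

section Main
variable {m n : ℕ} {q : ℝ}

/-- `W` is an irreducible submodule, for the given action of `U_q(gl(m|n))`, with highest weight
`∑ λ_a ε_a`: it contains a nonzero vector killed by all `E_b` on which each `K_a` acts
by `q_a^{λ_a}`. -/
structure IsIrrepOfHighestWeight {M : Type*} [AddCommGroup M] [Module ℂ M]
    (act : Uq m n q →ₐ[ℂ] Module.End ℂ M) (W : Submodule ℂ M) (wgt : Fin (m + n) → ℤ) :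
    Prop where
  stable : ∀ x, ∀ w ∈ W, act x w ∈ W
  ne_bot : W ≠ ⊥
  irreducible : ∀ U ≤ W, (∀ x, ∀ w ∈ U, act x w ∈ U) → U = ⊥ ∨ U = W
  highest : ∃ w ∈ W, w ≠ 0 ∧ (∀ b, act (gen q (.E b)) w = 0) ∧
    ∀ a, act (gen q (.K a)) w = (qa q a) ^ (wgt a) • w

/-- The weight `∑_{i ≤ k} ε_i` if `k ≤ m`, and `∑_{i ≤ m} ε_i + (k - m) ε_{m+1}` if `k > m`. -/
def skewWeight (m n k : ℕ) (a : Fin (m + n)) : ℤ :=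
  if k ≤ m then (if (a : ℕ) < k then 1 else 0)
  else if (a : ℕ) < m then 1 else if (a : ℕ) = m then (k : ℤ) - m else 0

/-- The weight `-k ε_{m+n}`. -/
def dualWeight (k : ℕ) (hn : 0 < n) (a : Fin (m + n)) : ℤ := if a = lastIdx hn then -k else 0

end Main

end QuantumGL

open QuantumGL

/-!
The proof identifies both induced modules with the space `Λ` of skew supersymmetric tensors in the
`k`-th tensor power of the vector representation, and reduces every assertion to linear algebra on
`Λ`. Tensors are functions of words of length `k` in the letters `1, …, N`, the pairing `⟨u, c⟩` of
two tensors is the bilinear dot product, and `v = v_N ⊗ ⋯ ⊗ v_N`.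

*Matrix elements.* Products in `U_q^*` of matrix elements of graded representations are, up to
sign, matrix elements of tensor products (`GRep.conv_coef`), so the subalgebra generated by the
`t_{ab}` is spanned by the matrix elements of all tensor powers, and likewise for the `t̄_{ab}` and
the dual; the dual of a tensor power is the tensor power of the dual with words read backwards
(`GRep.dual_pow`). In particular the monomials `Z^L` are matrix elements in the column `N ⋯ N`.

*The module `Λ`.* It is stable under the action (`skew_stable`); by induction on the number of
factors this is a statement about two adjacent letters. A tensor in `Λ` is determined by one
coordinate for each content of words, the others following by the exchange factors, and this
coordinate vanishes if an even letter is repeated; so the tensors `skewVec q L` form a basis. They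
are real and have disjoint supports, so the dot product is nondegenerate on `Λ` and there is an
orthogonal projection onto `Λ` (`skewProj`).

*Irreducibility.* The operators of `U_q` on a tensor power are closed under transposition
(`exists_transpose`). A nonzero submodule of `Λ` contains a weight vector killed by all `F_j`. Such
a vector is a multiple of `v`, since a contribution of `F_j` to a suitably chosen word cannot cancel
(`eq_last_of_lowest`); here `q > 0` is used. Hence every nonzero submodule contains `v`, and so does
its orthogonal complement in `Λ` if that is nonzero, which is impossible as `⟨v, v⟩ = 1`
(`skew_irreducible`).

*The induced modules.* Put `Φ(u)(y) = ⟨v, S(y) u⟩` and `Ψ(u)(y) = ⟨u, y v⟩` (`phiMap`, `psiMap`).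
Both are injective on `Λ` by irreducibility, and unchanged when `u` is projected to `Λ`. Since `v` is
an eigenvector of `U_q(p_-)` and, as a covector, of `U_q(p_+)`, their values lie in the induced
modules. Conversely, the equations for the `K_a` alone force an element of an induced module to be a
combination of matrix elements of the `k`-th tensor power in the column `N ⋯ N`
(`mem_span_column`), because `q` is not a root of unity; and these are the values of `Φ` and `Ψ` on
basis tensors. As the projection of a basis tensor to `Λ` is zero or a multiple of some
`skewVec q L`, the monomials are the images of the basis of `Λ` up to nonzero scalars.

*Actions and duality.* `Φ` intertwines the tensor action with the action by left translations
(`dot_phiMap`), and `Ψ` carries it to the transpose of `S⁻¹`, up to signs (`dot_psiMap`). The square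
of the antipode is conjugation by a diagonal operator `D` on tensor powers
(`antipode_antipode_apply`), so the pairing `⟨u, D⁻¹ P u'⟩`, with `P` the parity, identifies the
module induced from `V_-` with the dual of the one induced from `V_+` (`skewPairing_adjoint`).
-/

open scoped TensorProduct
set_option linter.unusedSimpArgs false
set_option linter.unusedSectionVars false
set_option linter.style.longLine false
open QuantumGL

namespace QuantumGL

open scoped Kronecker

noncomputable section

/-! ### Generation by the Chevalley generators -/

theorem sgn_add_self (i : ZMod 2) : sgn (i + i) = 1 := by rw [sgn_add, sgn_mul_self]

theorem sgn_ne_zero (i : ZMod 2) : sgn i ≠ 0 := left_ne_zero_of_mul_eq_one (sgn_mul_self i)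

section Induction
variable {m n : ℕ} {q : ℝ}

theorem Uq.mk_surjective : Function.Surjective (Uq.mk m n q) :=
  RingQuot.mkAlgHom_surjective ℂ (Rel m n q)

theorem adjoin_gen : Algebra.adjoin ℂ (Set.range (gen (m := m) (n := n) q)) = ⊤ := by
  have h : Set.range (gen (m := m) (n := n) q) = Uq.mk m n q '' Set.range (FreeAlgebra.ι ℂ) := by
    rw [← Set.range_comp]; rfl
  rw [h, ← AlgHom.map_adjoin, FreeAlgebra.adjoin_range_ι, Algebra.map_top,
    AlgHom.range_eq_top]
  exact Uq.mk_surjective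

/-- A subalgebra of `U_q(gl(m|n))` that contains the generators is everything. -/
theorem Uq.mem_of_gen (A : Subalgebra ℂ (Uq m n q)) (h : ∀ u, gen q u ∈ A) (x : Uq m n q) :
    x ∈ A := by
  have : (⊤ : Subalgebra ℂ (Uq m n q)) ≤ A := by
    rw [← adjoin_gen]; exact Algebra.adjoin_le (by rintro _ ⟨u, rfl⟩; exact h u)
  exact this trivial

/-- Homogeneous elements span, so a linear statement may be checked on products of a generator
with a homogeneous element. -/
theorem Uq.induction_homog [Fact (0 < q)] {P : Uq m n q → Prop}
    (add : ∀ x y, P x → P y → P (x + y)) (smul : ∀ (c : ℂ) x, P x → P (c • x)) (one : P 1)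
    (mul : ∀ u i x, x ∈ homog m n q i → P x → P (gen q u * x)) (x : Uq m n q) : P x := by
  let S : Submodule ℂ (Uq m n q) := Submodule.span ℂ {x | P x ∧ ∃ i, x ∈ homog m n q i}
  have hS : ∀ u, ∀ y ∈ S, gen q u * y ∈ S := by
    intro u y hy
    induction hy using Submodule.span_induction with
    | mem y hy =>
      obtain ⟨h1, i, h2⟩ := hy
      exact Submodule.subset_span ⟨mul u i y h2 h1, _, SetLike.mul_mem_graded (gen_mem u) h2⟩
    | zero => simp
    | add a b _ _ ha hb => rw [mul_add]; exact Submodule.add_mem _ ha hb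
    | smul c a _ ha => rw [mul_smul_comm]; exact Submodule.smul_mem _ c ha
  have h1 : (1 : Uq m n q) ∈ S := Submodule.subset_span ⟨one, 0, SetLike.GradedOne.one_mem⟩
  let A : Subalgebra ℂ (Uq m n q) :=
    { carrier := {x | ∀ y ∈ S, x * y ∈ S}
      mul_mem' := fun {a b} ha hb y hy => by rw [mul_assoc]; exact ha _ (hb _ hy)
      add_mem' := fun {a b} ha hb y hy => by rw [add_mul]; exact Submodule.add_mem _ (ha _ hy) (hb _ hy)
      algebraMap_mem' := fun r y hy => by
        rw [Algebra.algebraMap_eq_smul_one, smul_mul_assoc, one_mul]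
        exact Submodule.smul_mem _ _ hy }
  have hx : x ∈ S := by simpa using Uq.mem_of_gen A hS x 1 h1
  induction hx using Submodule.span_induction with
  | mem y hy => exact hy.1
  | zero => simpa using smul 0 1 one
  | add a b _ _ ha hb => exact add a b ha hb
  | smul c a _ ha => exact smul c a ha

end Induction

/-! ### Graded matrix representations and their tensor products -/

/-- Conjugation of matrices by a diagonal matrix with entries `± 1`. -/
def signConj {ι : Type} [Fintype ι] [DecidableEq ι] (s : ι → ℂ) (hs : ∀ a, s a * s a = 1) :
    Matrix ι ι ℂ →ₐ[ℂ] Matrix ι ι ℂ :=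
  AlgHom.ofLinearMap
    { toFun := fun M => Matrix.of fun a b => s a * M a b * s b
      map_add' := fun M N => by ext a b; simp; ring
      map_smul' := fun c M => by ext a b; simp; ring }
    (by
      ext a b
      by_cases h : a = b
      · subst h; simp [hs]
      · simp [h])
    (fun M N => by
      ext a b
      simp only [LinearMap.coe_mk, AddHom.coe_mk, Matrix.of_apply, Matrix.mul_apply,
        Finset.mul_sum, Finset.sum_mul]
      refine Finset.sum_congr rfl fun c _ => ?_
      linear_combination (-(s a * M a c * N c b * s b)) * hs c)

theorem signConj_apply {ι : Type} [Fintype ι] [DecidableEq ι] (s : ι → ℂ) (hs : ∀ a, s a * s a = 1)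
    (M : Matrix ι ι ℂ) (a b : ι) : signConj s hs M a b = s a * M a b * s b := rfl

/-- A finite-dimensional `ℤ/2`-graded representation of `U_q(gl(m|n))` in matrix form: the basis
vector with index `a` has parity `p a`. -/
structure GRep (m n : ℕ) (q : ℝ) [Fact (0 < q)] (ι : Type) [Fintype ι] [DecidableEq ι] where
  p : ι → ZMod 2
  ρ : Uq m n q →ₐ[ℂ] Matrix ι ι ℂ
  parity_apply : ∀ x a b, ρ (parity m n q x) a b = sgn (p a + p b) * ρ x a b

namespace GRep
variable {m n : ℕ} {q : ℝ} [Fact (0 < q)] {ι κ μ : Type} [Fintype ι] [DecidableEq ι]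
  [Fintype κ] [DecidableEq κ] [Fintype μ] [DecidableEq μ]

/-- A representation is graded once the images of the generators have the right parity. -/
def ofGen (p : ι → ZMod 2) (ρ : Uq m n q →ₐ[ℂ] Matrix ι ι ℂ)
    (h : ∀ u a b, sgn (gpar u) * ρ (gen q u) a b = sgn (p a + p b) * ρ (gen q u) a b) :
    GRep m n q ι where
  p := p
  ρ := ρ
  parity_apply := fun x a b => by
    have : ρ.comp (parity m n q) = (signConj (fun a => sgn (p a)) fun a => sgn_mul_self _).comp ρ := by
      apply Uq.hom_ext
      intro u
      ext a b
      simp only [AlgHom.comp_apply, parity_gen, map_smul, Matrix.smul_apply, smul_eq_mul, h,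
        signConj_apply, sgn_add]
      ring
    have h2 := congrFun (congrFun (DFunLike.congr_fun this x) a) b
    simp only [AlgHom.comp_apply, signConj_apply] at h2
    rw [h2, sgn_add]; ring

variable (R : GRep m n q ι) (R' : GRep m n q κ) (R'' : GRep m n q μ)

theorem apply_of_mem {i : ZMod 2} {x : Uq m n q} (hx : x ∈ homog m n q i) (a b : ι) :
    sgn i * R.ρ x a b = sgn (R.p a + R.p b) * R.ρ x a b := by
  rw [← R.parity_apply, mem_homog.1 hx, map_smul, Matrix.smul_apply, smul_eq_mul]

theorem apply_eq_zero {i : ZMod 2} {x : Uq m n q} (hx : x ∈ homog m n q i) {a b : ι}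
    (h : R.p a + R.p b ≠ i) : R.ρ x a b = 0 := by
  have := R.apply_of_mem hx a b
  rcases zmod2 i with rfl | rfl <;> rcases zmod2 (R.p a + R.p b) with h' | h' <;>
    simp [h'] at h this <;> grind

theorem apply_part (i : ZMod 2) (x : Uq m n q) (a b : ι) :
    R.ρ (part i x) a b = if R.p a + R.p b = i then R.ρ x a b else 0 := by
  split_ifs with h
  · rw [part_apply]
    simp only [map_smul, map_add, Matrix.smul_apply, Matrix.add_apply, R.parity_apply, h, smul_eq_mul]
    linear_combination (1 / 2 * R.ρ x a b) * sgn_mul_self i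
  · exact R.apply_eq_zero (part_mem i x) h

/-- The matrix element `x ↦ ρ(x)_{ab}`. -/
def coef (a b : ι) : Module.Dual ℂ (Uq m n q) := Matrix.entryLinearMap ℂ ℂ a b ∘ₗ R.ρ.toLinearMap

@[simp] theorem coef_apply (a b : ι) (x : Uq m n q) : R.coef a b x = R.ρ x a b := rfl

theorem coef_part (i : ZMod 2) (a b : ι) :
    R.coef a b ∘ₗ part i = if R.p a + R.p b = i then R.coef a b else 0 := by
  ext x
  simp only [LinearMap.comp_apply, coef_apply, apply_part]
  split_ifs <;> simp

theorem coef_parity (a b : ι) :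
    R.coef a b ∘ₗ (parity m n q).toLinearMap = sgn (R.p a + R.p b) • R.coef a b := by
  ext x; simp [R.parity_apply]

/-- The first tensor factor acting on a graded tensor product. -/
def tensLeft : Uq m n q →ₐ[ℂ] Matrix (ι × κ) (ι × κ) ℂ :=
  AlgHom.ofLinearMap
    { toFun := fun x => R.ρ x ⊗ₖ (1 : Matrix κ κ ℂ)
      map_add' := fun x y => by rw [map_add, Matrix.add_kronecker]
      map_smul' := fun c x => by rw [map_smul, Matrix.smul_kronecker]; rfl }
    (by simp)
    (fun x y => by
      simp only [LinearMap.coe_mk, AddHom.coe_mk, map_mul]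
      rw [← Matrix.mul_kronecker_mul, one_mul])

/-- The second tensor factor acting on a graded tensor product: an odd element picks up the
parity of the first factor. -/
def tensRight : Uq m n q →ₐ[ℂ] Matrix (ι × κ) (ι × κ) ℂ :=
  (signConj (fun a => sgn (R.p a.1 * R'.p a.2)) fun a => sgn_mul_self _).comp
    (AlgHom.ofLinearMap
      { toFun := fun x => (1 : Matrix ι ι ℂ) ⊗ₖ R'.ρ x
        map_add' := fun x y => by rw [map_add, Matrix.kronecker_add]
        map_smul' := fun c x => by rw [map_smul, Matrix.kronecker_smul]; rfl }
      (by simp)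
      (fun x y => by
        simp only [LinearMap.coe_mk, AddHom.coe_mk, map_mul]
        rw [← Matrix.mul_kronecker_mul, one_mul]))

theorem tensLeft_apply (x : Uq m n q) (a b : ι × κ) :
    tensLeft (κ := κ) R x a b = if a.2 = b.2 then R.ρ x a.1 b.1 else 0 := by
  change R.ρ x a.1 b.1 * (1 : Matrix κ κ ℂ) a.2 b.2 = _
  rw [Matrix.one_apply]; split_ifs <;> simp

theorem tensRight_apply (x : Uq m n q) (a b : ι × κ) :
    tensRight R R' x a b =
      if a.1 = b.1 then sgn (R.p b.1 * (R'.p a.2 + R'.p b.2)) * R'.ρ x a.2 b.2 else 0 := by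
  change sgn (R.p a.1 * R'.p a.2) * ((1 : Matrix ι ι ℂ) a.1 b.1 * R'.ρ x a.2 b.2) *
    sgn (R.p b.1 * R'.p b.2) = _
  rw [Matrix.one_apply]
  split_ifs with h
  · rw [h, mul_add, sgn_add]; ring
  · simp

theorem tensLeft_mul_tensRight (x y : Uq m n q) (a b : ι × κ) :
    (tensLeft (κ := κ) R x * tensRight R R' y) a b =
      sgn (R.p b.1 * (R'.p a.2 + R'.p b.2)) * (R.ρ x a.1 b.1 * R'.ρ y a.2 b.2) := by
  rw [Matrix.mul_apply, Finset.sum_eq_single (b.1, a.2)]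
  · rw [tensLeft_apply, tensRight_apply]; simp; ring
  · rintro ⟨c, d⟩ _ h
    rw [tensLeft_apply, tensRight_apply]
    by_cases h1 : a.2 = d
    · have h2 : c ≠ b.1 := fun h2 => h (by rw [h1, h2])
      simp [h2]
    · simp [h1]
  · simp

theorem tensRight_mul_tensLeft (x y : Uq m n q) (a b : ι × κ) :
    (tensRight R R' y * tensLeft (κ := κ) R x) a b =
      sgn (R.p a.1 * (R'.p a.2 + R'.p b.2)) * (R.ρ x a.1 b.1 * R'.ρ y a.2 b.2) := by
  rw [Matrix.mul_apply, Finset.sum_eq_single (a.1, b.2)]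
  · rw [tensLeft_apply, tensRight_apply]; simp; ring
  · rintro ⟨c, d⟩ _ h
    rw [tensLeft_apply, tensRight_apply]
    by_cases h1 : a.1 = c
    · have h2 : d ≠ b.2 := fun h2 => h (by rw [h1, h2])
      simp [h2]
    · simp [h1]
  · simp

/-- The action of the graded tensor square of `U_q(gl(m|n))` on a graded tensor product. -/
def tensSquare : (homog m n q) ᵍ⊗[ℂ] (homog m n q) →ₐ[ℂ] Matrix (ι × κ) (ι × κ) ℂ :=
  GradedTensorProduct.lift (homog m n q) (homog m n q) (tensLeft (κ := κ) R) (tensRight R R')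
    (by
      intro i j x y
      have key : tensLeft (κ := κ) R x.1 * tensRight R R' y.1 =
          sgn (j * i) • (tensRight R R' y.1 * tensLeft (κ := κ) R x.1) := by
        ext a b
        rw [Matrix.smul_apply, tensLeft_mul_tensRight, tensRight_mul_tensLeft, smul_eq_mul]
        by_cases h1 : R.p a.1 + R.p b.1 = i
        · by_cases h2 : R'.p a.2 + R'.p b.2 = j
          · have hs : sgn (R.p b.1 * j) = sgn (j * i) * sgn (R.p a.1 * j) := by
              rw [← sgn_add, ← h1]
              congr 1
              have : ∀ u v w : ZMod 2, v * w = w * (u + v) + u * w := by decide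
              exact this _ _ _
            rw [h2, hs, mul_assoc]
          · rw [R'.apply_eq_zero y.2 h2]; simp
        · rw [R.apply_eq_zero x.2 h1]; simp
      rw [key]
      rcases zmod2 i with rfl | rfl <;> rcases zmod2 j with rfl | rfl <;> simp)

/-- The algebra homomorphism underlying the tensor product of graded representations. -/
def tensHom : Uq m n q →ₐ[ℂ] Matrix (ι × κ) (ι × κ) ℂ := (tensSquare R R').comp (comul m n q)

theorem tensHom_eq_splitMul (x : Uq m n q) (a b : ι × κ) :
    tensHom R R' x a b =
      sgn (R.p b.1 * (R'.p a.2 + R'.p b.2)) * splitMul (R.coef a.1 b.1) (R'.coef a.2 b.2) x := by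
  have : ∀ z : Uq m n q ⊗[ℂ] Uq m n q,
      LinearMap.mul' ℂ _ (TensorProduct.map (tensLeft (κ := κ) R).toLinearMap
        (tensRight R R').toLinearMap z) a b =
      sgn (R.p b.1 * (R'.p a.2 + R'.p b.2)) *
        LinearMap.mul' ℂ ℂ (TensorProduct.map (R.coef a.1 b.1) (R'.coef a.2 b.2) z) := by
    intro z
    induction z with
    | zero => simp
    | tmul x y =>
      simp only [TensorProduct.map_tmul, LinearMap.mul'_apply, AlgHom.toLinearMap_apply,
        tensLeft_mul_tensRight, coef_apply]
    | add x y hx hy => simp only [map_add, Matrix.add_apply, hx, hy, mul_add]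
  exact this _

theorem tensSquare_includeLeft (x : Uq m n q) :
    tensSquare R R' (GradedTensorProduct.includeLeft (R := ℂ) (homog m n q) (homog m n q) x) =
      tensLeft R x := by
  change tensLeft R x * tensRight R R' 1 = _
  rw [map_one, mul_one]

theorem tensSquare_includeRight (x : Uq m n q) :
    tensSquare R R' (GradedTensorProduct.includeRight (R := ℂ) (homog m n q) (homog m n q) x) =
      tensRight R R' x := by
  change tensLeft R 1 * tensRight R R' x = _
  rw [map_one, one_mul]

theorem tensHom_gen (u : Gen m n) :
    tensHom R R' (gen q u) = comulGen (fun u => tensLeft (κ := κ) R (gen q u))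
      (fun u => tensRight R R' (gen q u)) u := by
  unfold tensHom comul
  rw [AlgHom.comp_apply, IsRel.lift_gen]
  cases u <;> simp only [comulGen, kap, kapInv, map_add, map_mul, tensSquare_includeLeft,
    tensSquare_includeRight]

theorem kap_mem (j : Fin (m + n - 1)) : kap (gen q) j ∈ homog m n q 0 := by
  rw [mem_homog, parity_kap]; simp

theorem kapInv_mem (j : Fin (m + n - 1)) : kapInv (gen q) j ∈ homog m n q 0 := by
  rw [mem_homog, parity_kapInv]; simp

theorem even_apply {y : Uq m n q} (hy : y ∈ homog m n q 0) (s : ZMod 2) (a b : κ) :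
    sgn (s * (R'.p a + R'.p b)) * R'.ρ y a b = R'.ρ y a b := by
  by_cases h : R'.p a + R'.p b = 0
  · simp [h]
  · simp [R'.apply_eq_zero hy h]

theorem odd_apply (u : Gen m n) (s : ZMod 2) (a b : κ) :
    sgn (s * (R'.p a + R'.p b)) * R'.ρ (gen q u) a b = sgn (gpar u * s) * R'.ρ (gen q u) a b := by
  by_cases h : R'.p a + R'.p b = gpar u
  · rw [h, mul_comm s]
  · simp [R'.apply_eq_zero (gen_mem u) h]

theorem tensHom_K (c : Fin (m + n)) (a b : ι × κ) :
    tensHom R R' (gen q (.K c)) a b = R.ρ (gen q (.K c)) a.1 b.1 * R'.ρ (gen q (.K c)) a.2 b.2 := by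
  rw [tensHom_gen, comulGen, tensLeft_mul_tensRight, mul_left_comm,
    even_apply _ (gen_mem (.K c))]

theorem tensHom_Kinv (c : Fin (m + n)) (a b : ι × κ) :
    tensHom R R' (gen q (.Kinv c)) a b =
      R.ρ (gen q (.Kinv c)) a.1 b.1 * R'.ρ (gen q (.Kinv c)) a.2 b.2 := by
  rw [tensHom_gen, comulGen, tensLeft_mul_tensRight, mul_left_comm,
    even_apply _ (gen_mem (.Kinv c))]

theorem tensHom_E (j : Fin (m + n - 1)) (a b : ι × κ) :
    tensHom R R' (gen q (.E j)) a b =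
      R.ρ (gen q (.E j)) a.1 b.1 * R'.ρ (kap (gen q) j) a.2 b.2 +
      if a.1 = b.1 then sgn (odd j * R.p b.1) * R'.ρ (gen q (.E j)) a.2 b.2 else 0 := by
  have h : kap (fun u => tensRight R R' (gen q u)) j = tensRight R R' (kap (gen q) j) :=
    (map_mul _ _ _).symm
  rw [tensHom_gen, comulGen, h, Matrix.add_apply, tensLeft_mul_tensRight, mul_left_comm,
    even_apply _ (kap_mem j), tensRight_apply, odd_apply]
  rfl

theorem tensHom_F (j : Fin (m + n - 1)) (a b : ι × κ) :
    tensHom R R' (gen q (.F j)) a b =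
      (if a.2 = b.2 then R.ρ (gen q (.F j)) a.1 b.1 else 0) +
      sgn (odd j * R.p b.1) * (R.ρ (kapInv (gen q) j) a.1 b.1 * R'.ρ (gen q (.F j)) a.2 b.2) := by
  have h : kapInv (fun u => tensLeft (κ := κ) R (gen q u)) j = tensLeft R (kapInv (gen q) j) :=
    (map_mul _ _ _).symm
  rw [tensHom_gen, comulGen, h, Matrix.add_apply, tensLeft_mul_tensRight, mul_left_comm,
    odd_apply, tensLeft_apply]
  simp only [gpar]; ring

theorem tensHom_K_eq (c : Fin (m + n)) :
    tensHom R R' (gen q (.K c)) = R.ρ (gen q (.K c)) ⊗ₖ R'.ρ (gen q (.K c)) := by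
  ext a b; exact tensHom_K R R' c a b

theorem tensHom_Kinv_eq (c : Fin (m + n)) :
    tensHom R R' (gen q (.Kinv c)) = R.ρ (gen q (.Kinv c)) ⊗ₖ R'.ρ (gen q (.Kinv c)) := by
  ext a b; exact tensHom_Kinv R R' c a b

theorem tensHom_kap (j : Fin (m + n - 1)) (a b : ι × κ) :
    tensHom R R' (kap (gen q) j) a b =
      R.ρ (kap (gen q) j) a.1 b.1 * R'.ρ (kap (gen q) j) a.2 b.2 := by
  rw [lift_kap, tensHom_K_eq, tensHom_Kinv_eq, ← Matrix.mul_kronecker_mul, ← map_mul, ← map_mul]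
  rfl

theorem tensHom_kapInv (j : Fin (m + n - 1)) (a b : ι × κ) :
    tensHom R R' (kapInv (gen q) j) a b =
      R.ρ (kapInv (gen q) j) a.1 b.1 * R'.ρ (kapInv (gen q) j) a.2 b.2 := by
  rw [lift_kapInv, tensHom_K_eq, tensHom_Kinv_eq, ← Matrix.mul_kronecker_mul, ← map_mul, ← map_mul]
  rfl

/-- The tensor product of graded representations, with the action
`x (v ⊗ w) = ∑ (-1)^{[x₂][v]} x₁ v ⊗ x₂ w`. -/
def tens : GRep m n q (ι × κ) :=
  ofGen (fun a => R.p a.1 + R'.p a.2) (tensHom R R') (by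
    intro u a b
    have h1 : ∀ u, sgn (gpar u) * R.ρ (gen q u) a.1 b.1 =
        sgn (R.p a.1 + R.p b.1) * R.ρ (gen q u) a.1 b.1 := fun u => R.apply_of_mem (gen_mem u) _ _
    have h2 : ∀ u, sgn (gpar u) * R'.ρ (gen q u) a.2 b.2 =
        sgn (R'.p a.2 + R'.p b.2) * R'.ρ (gen q u) a.2 b.2 :=
      fun u => R'.apply_of_mem (gen_mem u) _ _
    have h3 := fun j => R'.apply_of_mem (kap_mem j) a.2 b.2
    have h4 := fun j => R.apply_of_mem (kapInv_mem j) a.1 b.1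
    rw [show R.p a.1 + R'.p a.2 + (R.p b.1 + R'.p b.2) =
      (R.p a.1 + R.p b.1) + (R'.p a.2 + R'.p b.2) by ring, sgn_add]
    simp only [sgn_zero, one_mul] at h3 h4
    cases u with
    | K c =>
      have h1 := h1 (.K c)
      have h2 := h2 (.K c)
      simp only [gpar, sgn_zero, one_mul] at h1 h2 ⊢
      rw [tensHom_K, mul_mul_mul_comm, ← h1, ← h2]
    | Kinv c =>
      have h1 := h1 (.Kinv c)
      have h2 := h2 (.Kinv c)
      simp only [gpar, sgn_zero, one_mul] at h1 h2 ⊢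
      rw [tensHom_Kinv, mul_mul_mul_comm, ← h1, ← h2]
    | E j =>
      rw [tensHom_E, mul_add, mul_add, mul_mul_mul_comm, ← h1, ← h3, mul_assoc]
      congr 1
      split_ifs with h
      · rw [h, sgn_add_self, one_mul, mul_left_comm, h2, mul_left_comm]
      · simp
    | F j =>
      rw [tensHom_F, mul_add, mul_add]
      congr 1
      · split_ifs with h
        · rw [h, sgn_add_self, mul_one, h1]
        · simp
      · rw [mul_left_comm, mul_left_comm (sgn (gpar (.F j))), h2]
        conv_lhs => rw [h4]
        ring)

end GRep

/-! ### Convolution of matrix elements and tensor powers -/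

namespace GRep
variable {m n : ℕ} {q : ℝ} [Fact (0 < q)] {ι κ μ : Type} [Fintype ι] [DecidableEq ι]
  [Fintype κ] [DecidableEq κ] [Fintype μ] [DecidableEq μ]
variable (R : GRep m n q ι) (R' : GRep m n q κ) (R'' : GRep m n q μ)

theorem tens_apply (x : Uq m n q) (a b : ι × κ) : (tens R R').ρ x a b = tensHom R R' x a b := rfl

theorem tens_coef (a b : ι × κ) : (tens R R').coef a b =
    sgn (R.p b.1 * (R'.p a.2 + R'.p b.2)) • splitMul (R.coef a.1 b.1) (R'.coef a.2 b.2) := by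
  ext x; exact tensHom_eq_splitMul R R' x a b

/-- The product of matrix elements is a matrix element of the tensor product, up to a sign. -/
theorem conv_coef (a b : ι) (c d : κ) : conv (R.coef a b) (R'.coef c d) =
    sgn (R.p a * (R'.p c + R'.p d)) • (tens R R').coef (a, c) (b, d) := by
  have h0 : ∀ f, splitMul (m := m) (n := n) (q := q) f 0 = 0 := fun f => by
    ext x; simp [splitMul]
  have h1 : ∀ (c : ℂ) f g, splitMul (m := m) (n := n) (q := q) (c • f) g = c • splitMul f g :=
    fun c f g => by ext x; simp [splitMul, TensorProduct.map_smul_left]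
  rw [tens_coef, smul_smul, ← sgn_add]
  unfold conv
  rw [coef_part, coef_part, coef_parity]
  rcases zmod2 (R'.p c + R'.p d) with h | h
  · simp [h, h0]
  · simp [h, h0, h1]

theorem conv_add_left (f f' g : Module.Dual ℂ (Uq m n q)) :
    conv (f + f') g = conv f g + conv f' g := by
  unfold conv splitMul
  simp only [LinearMap.add_comp, TensorProduct.map_add_left, LinearMap.comp_add]
  abel

theorem conv_smul_left (c : ℂ) (f g : Module.Dual ℂ (Uq m n q)) :
    conv (c • f) g = c • conv f g := by
  unfold conv splitMul
  simp only [LinearMap.smul_comp, TensorProduct.map_smul_left, LinearMap.comp_smul, smul_add]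

theorem conv_add_right (f g g' : Module.Dual ℂ (Uq m n q)) :
    conv f (g + g') = conv f g + conv f g' := by
  unfold conv splitMul
  simp only [LinearMap.add_comp, TensorProduct.map_add_right, LinearMap.comp_add]
  abel

theorem conv_smul_right (c : ℂ) (f g : Module.Dual ℂ (Uq m n q)) :
    conv f (c • g) = c • conv f g := by
  unfold conv splitMul
  simp only [LinearMap.smul_comp, TensorProduct.map_smul_right, LinearMap.comp_smul, smul_add]

/-- Coassociativity, seen on matrix elements. -/
theorem tens_assoc (x : Uq m n q) (a b : ι) (c d : κ) (e f : μ) :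
    (tens (tens R R') R'').ρ x ((a, c), e) ((b, d), f) =
      (tens R (tens R' R'')).ρ x (a, (c, e)) (b, (d, f)) := by
  have h : ((Matrix.reindexAlgEquiv ℂ ℂ (Equiv.prodAssoc ι κ μ)) : _ →ₐ[ℂ] _).comp
      (tens (tens R R') R'').ρ = (tens R (tens R' R'')).ρ := by
    apply Uq.hom_ext
    intro u
    ext ⟨a, c, e⟩ ⟨b, d, f⟩
    change (tens (tens R R') R'').ρ (gen q u) ((a, c), e) ((b, d), f) = _
    simp only [tens_apply]
    cases u with
    | K i => simp only [tensHom_K, tens_apply, mul_assoc]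
    | Kinv i => simp only [tensHom_Kinv, tens_apply, mul_assoc]
    | E j =>
      simp only [tensHom_E, tens_apply, tensHom_kap]
      have : (tens R R').p (b, d) = R.p b + R'.p d := rfl
      simp only [this, mul_add, sgn_add, Prod.mk.injEq]
      by_cases h1 : a = b <;> by_cases h2 : c = d <;> simp [h1, h2] <;> ring
    | F j =>
      simp only [tensHom_F, tens_apply, tensHom_kapInv]
      have : (tens R R').p (b, d) = R.p b + R'.p d := rfl
      simp only [this, mul_add, sgn_add, Prod.mk.injEq]
      by_cases h1 : c = d <;> by_cases h2 : e = f <;> simp [h1, h2] <;> ring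
  exact congrFun (congrFun (DFunLike.congr_fun h x) (a, c, e)) (b, d, f)

theorem conv_assoc (a b : ι) (c d : κ) (e f : μ) :
    conv (conv (R.coef a b) (R'.coef c d)) (R''.coef e f) =
      conv (R.coef a b) (conv (R'.coef c d) (R''.coef e f)) := by
  rw [conv_coef, conv_smul_left, conv_coef, conv_coef, conv_smul_right, conv_coef]
  have : (tens (tens R R') R'').coef ((a, c), e) ((b, d), f) =
      (tens R (tens R' R'')).coef (a, (c, e)) (b, (d, f)) := by
    ext x; exact tens_assoc R R' R'' x a b c d e f
  rw [this, smul_smul, smul_smul, ← sgn_add, ← sgn_add]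
  congr 2
  change _ + (R.p a + R'.p c) * _ = _ + R.p a * (R'.p c + R''.p e + (R'.p d + R''.p f))
  ring

/-- Transport of a graded representation along a bijection of index sets. -/
def reindex (e : ι ≃ κ) : GRep m n q κ where
  p a := R.p (e.symm a)
  ρ := (Matrix.reindexAlgEquiv ℂ ℂ e : Matrix ι ι ℂ →ₐ[ℂ] Matrix κ κ ℂ).comp R.ρ
  parity_apply x _ _ := R.parity_apply x _ _

/-- The trivial representation, with basis indexed by the empty word. -/
def triv (ι : Type) [Fintype ι] [DecidableEq ι] : GRep m n q (Fin 0 → ι) where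
  p _ := 0
  ρ := (Algebra.ofId ℂ _).comp (counit m n q)
  parity_apply x a b := by
    have : (counit m n q).comp (parity m n q) = counit m n q := by
      apply Uq.hom_ext
      intro u
      rw [AlgHom.comp_apply, parity_gen, map_smul, counit, IsRel.lift_gen]
      cases u <;> simp [gpar]
    have h := DFunLike.congr_fun this x
    rw [AlgHom.comp_apply] at h
    simp [h]

theorem triv_apply (x : Uq m n q) (a b : Fin 0 → ι) :
    (triv ι).ρ x a b = counit m n q x := by
  change algebraMap ℂ (Matrix (Fin 0 → ι) (Fin 0 → ι) ℂ) (counit m n q x) a b = _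
  rw [Subsingleton.elim a b, Matrix.algebraMap_matrix_apply]; simp

/-- The tensor powers of a graded representation, with basis indexed by words. -/
def pow : (k : ℕ) → GRep m n q (Fin k → ι)
  | 0 => triv ι
  | k + 1 => (tens R (pow k)).reindex (Fin.consEquiv fun _ => ι)

theorem pow_zero_apply (x : Uq m n q) (a b : Fin 0 → ι) :
    (R.pow 0).ρ x a b = counit m n q x := triv_apply x a b

theorem pow_cons {k : ℕ} (x : Uq m n q) (i j : ι) (a b : Fin k → ι) :
    (R.pow (k + 1)).ρ x (Fin.cons i a) (Fin.cons j b) = (tens R (R.pow k)).ρ x (i, a) (j, b) := rfl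

theorem pow_p_cons {k : ℕ} (i : ι) (a : Fin k → ι) :
    (R.pow (k + 1)).p (Fin.cons i a) = R.p i + (R.pow k).p a := rfl

theorem pow_p {k : ℕ} (a : Fin k → ι) : (R.pow k).p a = ∑ i, R.p (a i) := by
  induction k with
  | zero => rfl
  | succ k ih =>
    rw [← Fin.cons_self_tail a, pow_p_cons, Fin.sum_univ_succ, ih]
    simp

theorem tens_congr_right {κ' : Type} [Fintype κ'] [DecidableEq κ'] (S : GRep m n q κ') {c d : κ}
    {c' d' : κ'} (hc : R'.p c = S.p c') (hd : R'.p d = S.p d') (h : ∀ x, R'.ρ x c d = S.ρ x c' d')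
    (a b : ι) (x : Uq m n q) :
    (tens R R').ρ x (a, c) (b, d) = (tens R S).ρ x (a, c') (b, d') := by
  have h1 : R'.coef c d = S.coef c' d' := by ext x; exact h x
  have := tens_coef R R' (a, c) (b, d)
  simp only [hc, hd, h1] at this
  exact DFunLike.congr_fun (this.trans (tens_coef R S (a, c') (b, d')).symm) x

theorem tens_congr_left {ι' : Type} [Fintype ι'] [DecidableEq ι'] (S : GRep m n q ι') {a b : ι}
    {a' b' : ι'} (hb : R.p b = S.p b') (h : ∀ x, R.ρ x a b = S.ρ x a' b')
    (c d : κ) (x : Uq m n q) :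
    (tens R R').ρ x (a, c) (b, d) = (tens S R').ρ x (a', c) (b', d) := by
  have h1 : R.coef a b = S.coef a' b' := by ext x; exact h x
  have := tens_coef R R' (a, c) (b, d)
  simp only [hb, h1] at this
  exact DFunLike.congr_fun (this.trans (tens_coef S R' (a', c) (b', d)).symm) x

theorem tens_triv_left (x : Uq m n q) (a b : Fin 0 → κ) (c d : ι) :
    (tens (triv κ) R).ρ x (a, c) (b, d) = R.ρ x c d := by
  have h : (tens (triv κ) R).ρ = ((Matrix.reindexAlgEquiv ℂ ℂ
      (Equiv.uniqueProd ι (Fin 0 → κ)).symm) : _ →ₐ[ℂ] _).comp R.ρ := by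
    apply Uq.hom_ext
    intro u
    ext ⟨a, c⟩ ⟨b, d⟩
    change _ = R.ρ (gen q u) c d
    have hab : a = b := Subsingleton.elim _ _
    have hp : (triv κ : GRep m n q _).p b = 0 := rfl
    have hc : ∀ u, counit m n q (gen q u) = match u with
      | .K _ => (1 : ℂ) | .Kinv _ => 1 | .E _ => 0 | .F _ => 0 := fun u => IsRel.lift_gen _ u
    cases u <;> simp [tens_apply, tensHom_K, tensHom_Kinv, tensHom_E, tensHom_F, triv_apply, hab,
      hp, hc, kapInv]
  exact congrFun (congrFun (DFunLike.congr_fun h x) (a, c)) (b, d)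

theorem tens_triv_right (x : Uq m n q) (a b : Fin 0 → κ) (c d : ι) :
    (tens R (triv κ)).ρ x (c, a) (d, b) = R.ρ x c d := by
  have h : (tens R (triv κ)).ρ = ((Matrix.reindexAlgEquiv ℂ ℂ
      (Equiv.prodUnique ι (Fin 0 → κ)).symm) : _ →ₐ[ℂ] _).comp R.ρ := by
    apply Uq.hom_ext
    intro u
    ext ⟨c, a⟩ ⟨d, b⟩
    change _ = R.ρ (gen q u) c d
    have hab : a = b := Subsingleton.elim _ _
    have hc : ∀ u, counit m n q (gen q u) = match u with
      | .K _ => (1 : ℂ) | .Kinv _ => 1 | .E _ => 0 | .F _ => 0 := fun u => IsRel.lift_gen _ u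
    cases u <;> simp [tens_apply, tensHom_K, tensHom_Kinv, tensHom_E, tensHom_F, triv_apply, hab,
      hc, kap]
  exact congrFun (congrFun (DFunLike.congr_fun h x) (c, a)) (d, b)

theorem pow_snoc {k : ℕ} (x : Uq m n q) (a b : Fin k → ι) (i j : ι) :
    (R.pow (k + 1)).ρ x (Fin.snoc a i : Fin (k + 1) → ι) (Fin.snoc b j : Fin (k + 1) → ι) =
      (tens (R.pow k) R).ρ x (a, i) (b, j) := by
  induction k generalizing x with
  | zero =>
    have h : ∀ (a : Fin 0 → ι) i, (Fin.snoc a i : Fin 1 → ι) = Fin.cons i a := fun a i => by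
      funext l; fin_cases l; rfl
    rw [h, h, pow_cons]
    exact (tens_triv_right R x a b i j).trans (tens_triv_left R x a b i j).symm
  | succ k ih =>
    rw [← Fin.cons_self_tail a, ← Fin.cons_self_tail b, ← Fin.cons_snoc_eq_snoc_cons,
      ← Fin.cons_snoc_eq_snoc_cons, pow_cons]
    generalize Fin.tail a = a', Fin.tail b = b', a 0 = a0, b 0 = b0
    have hp : ∀ (a : Fin k → ι) i, (R.pow (k + 1)).p (Fin.snoc a i : Fin (k + 1) → ι) =
        (tens (R.pow k) R).p (a, i) := fun a i => by
      rw [pow_p, Fin.sum_univ_castSucc]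
      simp only [Fin.snoc_castSucc, Fin.snoc_last, ← pow_p]
      rfl
    rw [tens_congr_right R (R.pow (k + 1)) (tens (R.pow k) R) (hp a' i) (hp b' j)
      (fun x => ih x a' b'), ← tens_assoc]
    exact (tens_congr_left (tens R (R.pow k)) R (R.pow (k + 1)) (a := (a0, a')) (b := (b0, b'))
      (a' := Fin.cons a0 a') (b' := Fin.cons b0 b') rfl (fun x => rfl) _ _ _)

end GRep

/-! ### Duals of tensor powers -/

section Antipode
variable {m n : ℕ} {q : ℝ} [Fact (0 < q)]

theorem antipode_mem {i : ZMod 2} {x : Uq m n q} (hx : x ∈ homog m n q i) :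
    antipode m n q x ∈ homog m n q i := by
  have h2 : (isRel_antipodeGen.lift x).unop ∈ homog m n q i := by
    rw [mem_homog, part_parity, mem_homog.1 hx]
    · simp
    · intro u
      rw [IsRel.lift_gen]
      cases u <;> simp [antipodeGen, parity_gen, gpar, parity_kap, parity_kapInv, smul_smul,
        mul_comm]
  unfold antipode
  rw [superOp_of_mem _ hx]
  exact Submodule.smul_mem _ _ h2

theorem antipode_parity (x : Uq m n q) :
    antipode m n q (parity m n q x) = parity m n q (antipode m n q x) := by
  rw [← part_add_part x]
  simp only [map_add, mem_homog.1 (part_mem _ x), mem_homog.1 (antipode_mem (part_mem _ x)),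
    map_smul]

theorem antipode_one : antipode m n q 1 = 1 := by
  unfold antipode
  rw [superOp_of_mem _ (SetLike.GradedOne.one_mem : (1 : Uq m n q) ∈ homog m n q 0)]
  simp

theorem antipode_Kinv (a : Fin (m + n)) : antipode m n q (gen q (.Kinv a)) = gen q (.K a) := by
  unfold antipode
  rw [superOp_of_mem _ (gen_mem _), IsRel.lift_gen]
  simp [gpar, antipodeGen]

theorem antipode_kap (j : Fin (m + n - 1)) :
    antipode m n q (kap (gen q) j) = kapInv (gen q) j := by
  unfold kap
  rw [antipode_mul (gen_mem _) (gen_mem _), antipode_K, antipode_Kinv]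
  simp only [gpar, mul_zero, sgn_zero, one_smul, kapInv]
  exact (isRel_gen.kik _ _).symm

theorem antipode_kapInv (j : Fin (m + n - 1)) :
    antipode m n q (kapInv (gen q) j) = kap (gen q) j := by
  unfold kapInv
  rw [antipode_mul (gen_mem _) (gen_mem _), antipode_K, antipode_Kinv]
  simp only [gpar, mul_zero, sgn_zero, one_smul, kap]
  exact isRel_gen.kik _ _

end Antipode

namespace GRep
variable {m n : ℕ} {q : ℝ} [Fact (0 < q)] {ι κ μ : Type} [Fintype ι] [DecidableEq ι]
  [Fintype κ] [DecidableEq κ] [Fintype μ] [DecidableEq μ]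
variable (R : GRep m n q ι) (R' : GRep m n q κ) (R'' : GRep m n q μ)

/-- The linear map underlying the dual of a graded representation in the dual basis. -/
def dualLin : Uq m n q →ₗ[ℂ] Matrix ι ι ℂ where
  toFun x := Matrix.of fun a b => sgn (R.p b * (R.p a + R.p b)) * R.ρ (antipode m n q x) b a
  map_add' x y := by ext a b; simp [mul_add]
  map_smul' c x := by ext a b; simp; ring

theorem dualLin_apply (x : Uq m n q) (a b : ι) : R.dualLin x a b =
    sgn (R.p b * (R.p a + R.p b)) * R.ρ (antipode m n q x) b a := rfl

theorem dualLin_mul (x y : Uq m n q) : R.dualLin (x * y) = R.dualLin x * R.dualLin y := by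
  have hom : ∀ i j, ∀ x ∈ homog m n q i, ∀ y ∈ homog m n q j,
      R.dualLin (x * y) = R.dualLin x * R.dualLin y := by
    intro i j x hx y hy
    ext a b
    rw [Matrix.mul_apply, dualLin_apply, antipode_mul hx hy, map_smul, map_mul, Matrix.smul_apply,
      Matrix.mul_apply, smul_eq_mul, Finset.mul_sum, Finset.mul_sum]
    refine Finset.sum_congr rfl fun c _ => ?_
    rw [dualLin_apply, dualLin_apply]
    by_cases h1 : R.p c + R.p a = i
    · by_cases h2 : R.p b + R.p c = j
      · have hs : sgn (R.p b * (R.p a + R.p b)) * sgn (i * j) =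
            sgn (R.p c * (R.p a + R.p c)) * sgn (R.p b * (R.p c + R.p b)) := by
          rw [← sgn_add, ← sgn_add, ← h1, ← h2]
          congr 1
          have : ∀ a b c : ZMod 2, b * (a + b) + (c + a) * (b + c) =
            c * (a + c) + b * (c + b) := by decide
          exact this _ _ _
        linear_combination
          (R.ρ (antipode m n q y) b c * R.ρ (antipode m n q x) c a) * hs
      · rw [R.apply_eq_zero (antipode_mem hy) h2]; ring
    · rw [R.apply_eq_zero (antipode_mem hx) h1]; ring
  rw [← part_add_part x, ← part_add_part y]
  simp only [add_mul, mul_add, map_add, hom _ _ _ (part_mem _ x) _ (part_mem _ y)]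

/-- The dual of a graded representation in the dual basis,
`x ↦ ((-1)^{[x][b]} ρ(S(x))_{ba})_{ab}`. -/
def dual : GRep m n q ι where
  p := R.p
  ρ := AlgHom.ofLinearMap R.dualLin
    (by
      ext a b
      rw [dualLin_apply, antipode_one, map_one, Matrix.one_apply, Matrix.one_apply]
      by_cases h : a = b
      · subst h; simp [mul_add, sgn_add_self]
      · simp [h, Ne.symm h])
    R.dualLin_mul
  parity_apply x a b := by
    change R.dualLin _ a b = _ * R.dualLin _ a b
    rw [dualLin_apply, dualLin_apply, antipode_parity, R.parity_apply, add_comm (R.p b)]; ring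

theorem dual_apply (x : Uq m n q) (a b : ι) : R.dual.ρ x a b =
    sgn (R.p b * (R.p a + R.p b)) * R.ρ (antipode m n q x) b a := rfl

theorem dual_K (c : Fin (m + n)) (a b : ι) :
    R.dual.ρ (gen q (.K c)) a b = R.ρ (gen q (.Kinv c)) b a := by
  rw [dual_apply, antipode_K, add_comm (R.p a), even_apply _ (gen_mem (.Kinv c))]

theorem dual_Kinv (c : Fin (m + n)) (a b : ι) :
    R.dual.ρ (gen q (.Kinv c)) a b = R.ρ (gen q (.K c)) b a := by
  rw [dual_apply, antipode_Kinv, add_comm (R.p a), even_apply _ (gen_mem (.K c))]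

theorem dual_kap (j : Fin (m + n - 1)) (a b : ι) :
    R.dual.ρ (kap (gen q) j) a b = R.ρ (kapInv (gen q) j) b a := by
  rw [dual_apply, antipode_kap, add_comm (R.p a), even_apply _ (kapInv_mem j)]

theorem dual_kapInv (j : Fin (m + n - 1)) (a b : ι) :
    R.dual.ρ (kapInv (gen q) j) a b = R.ρ (kap (gen q) j) b a := by
  rw [dual_apply, antipode_kapInv, add_comm (R.p a), even_apply _ (kap_mem j)]

theorem E_kapInv_mem (j : Fin (m + n - 1)) :
    gen q (.E j) * kapInv (gen q) j ∈ homog m n q (odd j) := by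
  simpa [gpar] using SetLike.mul_mem_graded (gen_mem (q := q) (.E j)) (kapInv_mem j)

theorem kap_F_mem (j : Fin (m + n - 1)) :
    kap (gen q) j * gen q (.F j) ∈ homog m n q (odd j) := by
  simpa [gpar] using SetLike.mul_mem_graded (kap_mem j) (gen_mem (q := q) (.F j))

theorem sgn_of_mem {x : Uq m n q} {i : ZMod 2} (hx : x ∈ homog m n q i) (s : ZMod 2) (a b : κ) :
    sgn (s * (R'.p a + R'.p b)) * R'.ρ x a b = sgn (i * s) * R'.ρ x a b := by
  by_cases h : R'.p a + R'.p b = i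
  · rw [h, mul_comm s]
  · simp [R'.apply_eq_zero hx h]

theorem dual_E (j : Fin (m + n - 1)) (a b : ι) : R.dual.ρ (gen q (.E j)) a b =
    -(sgn (odd j * R.p b) * R.ρ (gen q (.E j) * kapInv (gen q) j) b a) := by
  rw [dual_apply, antipode_E, map_neg, Matrix.neg_apply, add_comm (R.p a), mul_neg,
    sgn_of_mem _ (E_kapInv_mem j)]

theorem dual_F (j : Fin (m + n - 1)) (a b : ι) : R.dual.ρ (gen q (.F j)) a b =
    -(sgn (odd j * R.p b) * R.ρ (kap (gen q) j * gen q (.F j)) b a) := by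
  rw [dual_apply, antipode_F, map_neg, Matrix.neg_apply, add_comm (R.p a), mul_neg,
    sgn_of_mem _ (kap_F_mem j)]

theorem tensRight_tensLeft_comm {x : Uq m n q} (hx : x ∈ homog m n q 0) (y : Uq m n q) :
    tensRight R R' y * tensLeft (κ := κ) R x = tensLeft (κ := κ) R x * tensRight R R' y := by
  ext a b
  rw [tensLeft_mul_tensRight, tensRight_mul_tensLeft]
  by_cases h : R.p a.1 + R.p b.1 = 0
  · have : R.p a.1 = R.p b.1 := by
      revert h; generalize R.p a.1 = u, R.p b.1 = v; revert u v; decide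
    rw [this]
  · simp [R.apply_eq_zero hx h]

theorem tensRight_tensLeft_comm' (x : Uq m n q) {y : Uq m n q} (hy : y ∈ homog m n q 0) :
    tensRight R R' y * tensLeft (κ := κ) R x = tensLeft (κ := κ) R x * tensRight R R' y := by
  ext a b
  rw [tensLeft_mul_tensRight, tensRight_mul_tensLeft, mul_left_comm, even_apply _ hy,
    mul_left_comm, even_apply _ hy]

theorem tensHom_kap_eq (j : Fin (m + n - 1)) : tensHom R R' (kap (gen q) j) =
    tensLeft R (kap (gen q) j) * tensRight R R' (kap (gen q) j) := by
  ext a b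
  rw [tensHom_kap, tensLeft_mul_tensRight, mul_left_comm, even_apply _ (kap_mem j)]

theorem tensHom_kapInv_eq (j : Fin (m + n - 1)) : tensHom R R' (kapInv (gen q) j) =
    tensLeft R (kapInv (gen q) j) * tensRight R R' (kapInv (gen q) j) := by
  ext a b
  rw [tensHom_kapInv, tensLeft_mul_tensRight, mul_left_comm, even_apply _ (kapInv_mem j)]

theorem tensHom_E_eq (j : Fin (m + n - 1)) : tensHom R R' (gen q (.E j)) =
    tensLeft R (gen q (.E j)) * tensRight R R' (kap (gen q) j) + tensRight R R' (gen q (.E j)) := by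
  rw [tensHom_gen, comulGen, kap, kap, ← map_mul]

theorem tensHom_F_eq (j : Fin (m + n - 1)) : tensHom R R' (gen q (.F j)) =
    tensLeft R (gen q (.F j)) + tensLeft R (kapInv (gen q) j) * tensRight R R' (gen q (.F j)) := by
  rw [tensHom_gen, comulGen, kapInv, kapInv, ← map_mul]

theorem tensHom_E_kapInv (j : Fin (m + n - 1)) (a b : ι × κ) :
    tensHom R R' (gen q (.E j) * kapInv (gen q) j) a b =
      (if a.2 = b.2 then R.ρ (gen q (.E j) * kapInv (gen q) j) a.1 b.1 else 0) +
      sgn (odd j * R.p b.1) * (R.ρ (kapInv (gen q) j) a.1 b.1 *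
        R'.ρ (gen q (.E j) * kapInv (gen q) j) a.2 b.2) := by
  have h : tensHom R R' (gen q (.E j) * kapInv (gen q) j) =
      tensLeft R (gen q (.E j) * kapInv (gen q) j) +
        tensLeft R (kapInv (gen q) j) * tensRight R R' (gen q (.E j) * kapInv (gen q) j) := by
    rw [map_mul, tensHom_E_eq, tensHom_kapInv_eq, add_mul]
    congr 1
    · rw [mul_assoc, ← mul_assoc (tensRight R R' _), tensRight_tensLeft_comm' _ _ _ (kap_mem j),
        mul_assoc, ← map_mul (tensRight R R'), isRel_gen.kap_kapInv, map_one, mul_one, ← map_mul]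
    · rw [← mul_assoc, tensRight_tensLeft_comm _ _ (kapInv_mem j), mul_assoc, ← map_mul]
  rw [h, Matrix.add_apply, tensLeft_apply, tensLeft_mul_tensRight, mul_left_comm,
    sgn_of_mem _ (E_kapInv_mem j)]
  ring

theorem tensHom_kap_F (j : Fin (m + n - 1)) (a b : ι × κ) :
    tensHom R R' (kap (gen q) j * gen q (.F j)) a b =
      R.ρ (kap (gen q) j * gen q (.F j)) a.1 b.1 * R'.ρ (kap (gen q) j) a.2 b.2 +
      if a.1 = b.1 then sgn (odd j * R.p b.1) *
        R'.ρ (kap (gen q) j * gen q (.F j)) a.2 b.2 else 0 := by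
  have h : tensHom R R' (kap (gen q) j * gen q (.F j)) =
      tensLeft R (kap (gen q) j * gen q (.F j)) * tensRight R R' (kap (gen q) j) +
        tensRight R R' (kap (gen q) j * gen q (.F j)) := by
    rw [map_mul, tensHom_F_eq, tensHom_kap_eq, mul_add]
    congr 1
    · rw [mul_assoc, tensRight_tensLeft_comm' _ _ _ (kap_mem j), ← mul_assoc, ← map_mul]
    · rw [mul_assoc, ← mul_assoc (tensRight R R' _), tensRight_tensLeft_comm _ _ (kapInv_mem j),
        mul_assoc, ← map_mul, ← mul_assoc, ← map_mul, isRel_gen.kap_kapInv, map_one, one_mul]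
  rw [h, Matrix.add_apply, tensRight_apply, tensLeft_mul_tensRight, mul_left_comm,
    sgn_of_mem _ (kap_F_mem j), even_apply _ (kap_mem j)]

/-- The dual of a tensor product is the tensor product of the duals in the opposite order. -/
theorem dual_tens (x : Uq m n q) (a b : ι) (c d : κ) :
    (tens R R').dual.ρ x (a, c) (b, d) = (tens R'.dual R.dual).ρ x (c, a) (d, b) := by
  have h : (tens R R').dual.ρ = (Matrix.reindexAlgEquiv ℂ ℂ (Equiv.prodComm κ ι) :
      Matrix (κ × ι) (κ × ι) ℂ →ₐ[ℂ] Matrix (ι × κ) (ι × κ) ℂ).comp (tens R'.dual R.dual).ρ := by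
    apply Uq.hom_ext
    intro u
    ext ⟨a, c⟩ ⟨b, d⟩
    change _ = (tens R'.dual R.dual).ρ (gen q u) (c, a) (d, b)
    have hp : (tens R R').p (b, d) = R.p b + R'.p d := rfl
    have hp' : R'.dual.p d = R'.p d := rfl
    have hs : ∀ o, sgn (o * (R.p b + R'.p d)) = sgn (o * R.p b) * sgn (o * R'.p d) := fun o => by
      rw [mul_add, sgn_add]
    cases u with
    | K i => rw [dual_K, tens_apply, tens_apply, tensHom_K, tensHom_Kinv, dual_K, dual_K, mul_comm]
    | Kinv i =>
      rw [dual_Kinv, tens_apply, tens_apply, tensHom_K, tensHom_Kinv, dual_Kinv, dual_Kinv, mul_comm]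
    | E j =>
      rw [dual_E, tens_apply, tens_apply, tensHom_E_kapInv, tensHom_E, dual_kap, dual_E, dual_E,
        hp, hp', hs]
      have h1 : R.ρ (kapInv (gen q) j) b a * (sgn (odd j * R.p a) * sgn (odd j * R.p b)) =
          R.ρ (kapInv (gen q) j) b a := by
        rw [← sgn_add, ← mul_add, add_comm (R.p a), mul_comm, even_apply _ (kapInv_mem j)]
      by_cases hcd : c = d
      · simp only [hcd, if_true]
        linear_combination (-(sgn (odd j * R'.p d)) *
          R'.ρ (gen q (.E j) * kapInv (gen q) j) d d) * h1
      · simp only [hcd, Ne.symm hcd, if_false]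
        linear_combination (-(sgn (odd j * R'.p d)) *
          R'.ρ (gen q (.E j) * kapInv (gen q) j) d c) * h1
    | F j =>
      rw [dual_F, tens_apply, tens_apply, tensHom_kap_F, tensHom_F, dual_kapInv, dual_F, dual_F,
        hp, hp', hs]
      have h1 : R'.ρ (kap (gen q) j) d c * (sgn (odd j * R'.p d) * sgn (odd j * R'.p d)) =
          R'.ρ (kap (gen q) j) d c := by
        rw [sgn_mul_self, mul_one]
      by_cases hab : a = b
      · subst hab
        simp only [if_true]
        linear_combination (-(sgn (odd j * R'.p d)) *
          R'.ρ (kap (gen q) j * gen q (.F j)) d c) * sgn_mul_self (odd j * R.p a)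
      · simp only [hab, Ne.symm hab, if_false]
        ring
  exact congrFun (congrFun (DFunLike.congr_fun h x) (a, c)) (b, d)

/-- The matrix elements of the dual of a tensor power are those of the tensor power of the dual,
with the words read backwards. -/
theorem dual_pow {k : ℕ} (x : Uq m n q) (a b : Fin k → ι) :
    (R.pow k).dual.ρ x a b = (R.dual.pow k).ρ x (a ∘ Fin.rev) (b ∘ Fin.rev) := by
  induction k generalizing x with
  | zero =>
    have h1 : (R.pow 0).dual.ρ = (R.dual.pow 0).ρ := by
      apply Uq.hom_ext
      intro u
      ext a b
      have hab : a = b := Subsingleton.elim _ _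
      have hc : ∀ u, counit m n q (gen q u) = match u with
        | .K _ => (1 : ℂ) | .Kinv _ => 1 | .E _ => 0 | .F _ => 0 := fun u => IsRel.lift_gen _ u
      cases u <;> simp [dual_K, dual_Kinv, dual_E, dual_F, pow_zero_apply, hc]
    rw [h1, Subsingleton.elim (a ∘ Fin.rev) a, Subsingleton.elim (b ∘ Fin.rev) b]
  | succ k ih =>
    rw [← Fin.snoc_init_self a, ← Fin.snoc_init_self b]
    generalize Fin.init a = a', Fin.init b = b', a (Fin.last k) = i, b (Fin.last k) = j
    have hrev : ∀ (a : Fin k → ι) i, (Fin.snoc a i : Fin (k + 1) → ι) ∘ Fin.rev =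
        Fin.cons i (a ∘ Fin.rev) := fun a i => by
      funext l
      refine Fin.cases ?_ (fun l => ?_) l
      · simp
      · simp [Fin.rev_succ]
    have hp : ∀ (a : Fin k → ι) i, (R.pow (k + 1)).p (Fin.snoc a i : Fin (k + 1) → ι) =
        (tens (R.pow k) R).p (a, i) := fun a i => by
      rw [pow_p, Fin.sum_univ_castSucc]
      simp only [Fin.snoc_castSucc, Fin.snoc_last, ← pow_p]
      rfl
    have hp' : ∀ a : Fin k → ι, (R.pow k).dual.p a = (R.dual.pow k).p (a ∘ Fin.rev) := fun a => by
      rw [pow_p]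
      change (R.pow k).p a = ∑ i, R.p (a (Fin.rev i))
      rw [pow_p]
      exact (Equiv.sum_comp Fin.revPerm fun i => R.p (a i)).symm
    rw [hrev, hrev, pow_cons]
    have h2 : (R.pow (k + 1)).dual.ρ x (Fin.snoc a' i : Fin (k + 1) → ι)
        (Fin.snoc b' j : Fin (k + 1) → ι) = (tens (R.pow k) R).dual.ρ x (a', i) (b', j) := by
      rw [dual_apply, dual_apply, hp, hp, pow_snoc]
    rw [h2, dual_tens]
    exact tens_congr_right R.dual _ _ (hp' a') (hp' b') (fun x => ih x a' b') i j x

end GRep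

/-! ### Words and their contents -/

section Words
variable {N : ℕ} {k : ℕ}

/-- The number of occurrences of the letter `x` in the word `a`. -/
def content (a : Fin k → Fin N) (x : Fin N) : ℕ := ∑ i, if a i = x then 1 else 0

theorem content_cons (y : Fin N) (a : Fin k → Fin N) (x : Fin N) :
    content (Fin.cons y a : Fin (k + 1) → Fin N) x = (if y = x then 1 else 0) + content a x := by
  rw [content, Fin.sum_univ_succ]
  simp only [Fin.cons_zero, Fin.cons_succ, content]

theorem content_comp_perm (a : Fin k → Fin N) (σ : Equiv.Perm (Fin k)) :
    content (a ∘ σ) = content a := by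
  funext x
  exact Equiv.sum_comp σ fun i => if a i = x then 1 else 0

theorem sum_content (a : Fin k → Fin N) : ∑ x, content a x = k := by
  unfold content
  rw [Finset.sum_comm]
  simp

theorem content_eq_count (a : Fin k → Fin N) (x : Fin N) :
    content a x = (List.ofFn a).count x := by
  induction k with
  | zero => simp [content]
  | succ k ih =>
    rw [← Fin.cons_self_tail a, content_cons, ih, List.ofFn_cons, List.count_cons]
    simp [add_comm]

theorem content_pos {a : Fin k → Fin N} {x : Fin N} : 0 < content a x ↔ ∃ i, a i = x := by
  rw [content_eq_count, List.count_pos_iff, List.mem_ofFn]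

/-- Words with the same content are rearrangements of each other. -/
theorem exists_perm_of_content_eq {a b : Fin k → Fin N} (h : content a = content b) :
    ∃ σ : Equiv.Perm (Fin k), b = a ∘ σ := by
  have hp : (List.ofFn (a ∘ Tuple.sort a)).Perm (List.ofFn (b ∘ Tuple.sort b)) := by
    rw [List.perm_iff_count]
    intro x
    rw [← content_eq_count, ← content_eq_count, content_comp_perm, content_comp_perm, h]
  have he : a ∘ Tuple.sort a = b ∘ Tuple.sort b :=
    List.ofFn_injective (hp.eq_of_pairwise' (List.pairwise_ofFn.2 fun i j hij =>
      Tuple.monotone_sort a hij.le) (List.pairwise_ofFn.2 fun i j hij =>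
      Tuple.monotone_sort b hij.le))
  refine ⟨(Tuple.sort b).symm.trans (Tuple.sort a), ?_⟩
  funext i
  have := congrFun he ((Tuple.sort b).symm i)
  simpa using this.symm

theorem content_const (x y : Fin N) :
    content (fun _ : Fin k => x) y = if x = y then k else 0 := by
  unfold content; split_ifs <;> simp

theorem eq_const_of_content {a : Fin k → Fin N} {x : Fin N} (h : ∀ y, y ≠ x → content a y = 0) :
    a = fun _ => x := by
  funext i
  by_contra hi
  exact (content_pos.2 ⟨i, rfl⟩).ne' (h (a i) hi)

/-- The word `1^{L_1} 2^{L_2} ⋯` of a multi-index, as a list. -/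
def multiWord (L : Fin N → ℕ) : List (Fin N) :=
  (List.finRange N).flatMap fun x => List.replicate (L x) x

theorem count_multiWord (L : Fin N → ℕ) (x : Fin N) : (multiWord L).count x = L x := by
  have : ∀ l : List (Fin N), l.Nodup →
      (l.flatMap fun x => List.replicate (L x) x).count x = if x ∈ l then L x else 0 := by
    intro l
    induction l with
    | nil => simp
    | cons y l ih =>
      intro hl
      rw [List.nodup_cons] at hl
      rw [List.flatMap_cons, List.count_append, ih hl.2, List.count_replicate]
      simp only [List.mem_cons, beq_iff_eq]
      by_cases h : x = y
      · subst h; simp [hl.1]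
      · simp [h, Ne.symm h]
  rw [multiWord, this _ (List.nodup_finRange N)]
  simp

theorem exists_word {L : Fin N → ℕ} (hL : ∑ x, L x = k) :
    ∃ a : Fin k → Fin N, List.ofFn a = multiWord L ∧ content a = L := by
  have h2 : (multiWord L).length = k := by
    rw [multiWord, List.length_flatMap, ← hL, ← List.sum_ofFn, List.ofFn_eq_map]
    simp
  subst h2
  refine ⟨(multiWord L).get, List.ofFn_get _, ?_⟩
  funext x
  rw [content_eq_count, List.ofFn_get, count_multiWord]

end Words

namespace GRep
variable {m n : ℕ} {q : ℝ} [Fact (0 < q)] {ι : Type} [Fintype ι] [DecidableEq ι]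
variable (R : GRep m n q ι)

/-- The span of the matrix elements of all tensor powers of a graded representation. -/
def powSpan : Submodule ℂ (Module.Dual ℂ (Uq m n q)) :=
  Submodule.span ℂ {f | ∃ (k : ℕ) (a b : Fin k → ι), f = (R.pow k).coef a b}

theorem conv_coef_pow {k : ℕ} (i j : ι) (a b : Fin k → ι) :
    conv (R.coef i j) ((R.pow k).coef a b) = sgn (R.p i * ((R.pow k).p a + (R.pow k).p b)) •
      (R.pow (k + 1)).coef (Fin.cons i a) (Fin.cons j b) := conv_coef _ _ _ _ _ _

theorem conv_mem_powSpan {f g : Module.Dual ℂ (Uq m n q)} (hf : f ∈ R.powSpan)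
    (hg : g ∈ R.powSpan) : conv f g ∈ R.powSpan := by
  have h1 : ∀ i j, ∀ g ∈ R.powSpan, conv (R.coef i j) g ∈ R.powSpan := by
    intro i j g hg
    induction hg using Submodule.span_induction with
    | mem g hg =>
      obtain ⟨k, a, b, rfl⟩ := hg
      rw [conv_coef_pow]
      exact Submodule.smul_mem _ _ (Submodule.subset_span ⟨_, _, _, rfl⟩)
    | zero =>
      have h := conv_smul_right 0 (R.coef i j) 0
      rw [zero_smul, zero_smul] at h
      rw [h]; exact Submodule.zero_mem _
    | add g h _ _ hg hh => rw [conv_add_right]; exact Submodule.add_mem _ hg hh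
    | smul c g _ hg => rw [conv_smul_right]; exact Submodule.smul_mem _ _ hg
  have hz : ∀ g : Module.Dual ℂ (Uq m n q), conv 0 g = 0 := fun g => by
    simpa using conv_smul_left 0 0 g
  have hz' : ∀ g : Module.Dual ℂ (Uq m n q), conv g 0 = 0 := fun g => by
    simpa using conv_smul_right 0 g 0
  have h2 : ∀ (k l : ℕ) (a b : Fin k → ι) (c d : Fin l → ι),
      conv ((R.pow k).coef a b) ((R.pow l).coef c d) ∈ R.powSpan := by
    intro k l
    induction k with
    | zero =>
      intro a b c d
      rw [conv_coef]
      refine Submodule.smul_mem _ _ (Submodule.subset_span ⟨l, c, d, ?_⟩)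
      ext x
      exact tens_triv_left (R.pow l) x a b c d
    | succ k ih =>
      intro a b c d
      rw [← Fin.cons_self_tail a, ← Fin.cons_self_tail b]
      generalize Fin.tail a = a', Fin.tail b = b', a 0 = i, b 0 = j
      have h3 : (R.pow (k + 1)).coef (Fin.cons i a') (Fin.cons j b') =
          sgn (R.p i * ((R.pow k).p a' + (R.pow k).p b')) •
            conv (R.coef i j) ((R.pow k).coef a' b') := by
        rw [conv_coef_pow, smul_smul, sgn_mul_self, one_smul]
      rw [h3, conv_smul_left, conv_assoc]
      exact Submodule.smul_mem _ _ (h1 _ _ _ (ih _ _ _ _))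
  induction hf using Submodule.span_induction with
  | mem f hf =>
    obtain ⟨k, a, b, rfl⟩ := hf
    induction hg using Submodule.span_induction with
    | mem g hg =>
      obtain ⟨l, c, d, rfl⟩ := hg
      exact h2 k l a b c d
    | zero => rw [hz']; exact Submodule.zero_mem _
    | add g h _ _ hg hh => rw [conv_add_right]; exact Submodule.add_mem _ hg hh
    | smul c g _ hg => rw [conv_smul_right]; exact Submodule.smul_mem _ _ hg
  | zero => rw [hz]; exact Submodule.zero_mem _
  | add g h _ _ hg hh => rw [conv_add_left]; exact Submodule.add_mem _ hg hh
  | smul c g _ hg => rw [conv_smul_left]; exact Submodule.smul_mem _ _ hg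

theorem pow_zero_coef (a b : Fin 0 → ι) : (R.pow 0).coef a b = (counit m n q).toLinearMap := by
  ext x; exact R.pow_zero_apply x a b

/-- Ordered products of matrix elements from one column are matrix elements of a tensor power. -/
theorem foldr_conv_coef {k : ℕ} (a : Fin k → ι) (j : ι) :
    ∃ s : ℂ, s ≠ 0 ∧ ((List.ofFn a).map fun i => R.coef i j).foldr conv
      (counit m n q).toLinearMap = s • (R.pow k).coef a (fun _ => j) := by
  induction k with
  | zero => exact ⟨1, one_ne_zero, by simp [pow_zero_coef]⟩
  | succ k ih =>
    rw [← Fin.cons_self_tail a]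
    generalize Fin.tail a = a', a 0 = i
    obtain ⟨s, hs, h⟩ := ih a'
    refine ⟨s * sgn (R.p i * ((R.pow k).p a' + (R.pow k).p fun _ => j)),
      mul_ne_zero hs (sgn_ne_zero _), ?_⟩
    have hc : (fun _ : Fin (k + 1) => j) = Fin.cons j (fun _ => j) := by
      funext l; refine Fin.cases rfl (fun _ => rfl) l
    rw [List.ofFn_cons, List.map_cons, List.foldr_cons, h, conv_smul_right, conv_coef_pow,
      smul_smul, hc]

end GRep

/-! ### Matrix elements of the vector representation and its dual -/

section Vector
variable {m n : ℕ} (q : ℝ) [Fact (0 < q)] [Fact (q ≠ 1)]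

theorem odd_eq (j : Fin (m + n - 1)) : odd j = par (lo j) + par (hi j) := by
  unfold odd par lo hi
  have h11 : (1 : ZMod 2) + 1 = 0 := rfl
  split_ifs <;> simp_all <;> omega

/-- The vector representation as a graded representation. -/
def vecRep : GRep m n q (Fin (m + n)) :=
  GRep.ofGen par (vec m n q) (by
    intro u a b
    rw [vec, IsRel.lift_gen]
    cases u with
    | K c =>
      by_cases h : a = b
      · subst h; simp [gpar, sgn_add_self]
      · simp [vecGen, h]
    | Kinv c =>
      by_cases h : a = b
      · subst h; simp [gpar, sgn_add_self]
      · simp [vecGen, h]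
    | E j =>
      simp only [vecGen, gpar, Matrix.single_apply]
      split_ifs with h
      · rw [← h.1, ← h.2, odd_eq]
      · simp
    | F j =>
      simp only [vecGen, gpar, Matrix.single_apply]
      split_ifs with h
      · rw [← h.1, ← h.2, odd_eq, add_comm]
      · simp)

theorem vecRep_p (a : Fin (m + n)) : (vecRep q).p a = par a := rfl

theorem tEl_eq (a b : Fin (m + n)) : tEl q a b = (vecRep q).coef a b := rfl

theorem tBarEl_eq (a b : Fin (m + n)) : tBarEl q a b = (vecRep q).dual.coef a b := by
  ext x
  change (vecRep q).ρ (antipode m n q (part 0 x + sgn (par b) • part 1 x)) b a =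
    sgn (par b * (par a + par b)) * (vecRep q).ρ (antipode m n q x) b a
  have h0 := fun h => (vecRep q).apply_eq_zero (antipode_mem (part_mem 0 x)) (a := b) (b := a) h
  have h1 := fun h => (vecRep q).apply_eq_zero (antipode_mem (part_mem 1 x)) (a := b) (b := a) h
  conv_rhs => rw [← part_add_part x]
  simp only [map_add, map_smul, Matrix.add_apply, Matrix.smul_apply, smul_eq_mul]
  rw [vecRep_p, vecRep_p, add_comm (par b)] at h0 h1
  rcases zmod2 (par a + par b) with h | h
  · rw [h1 (by rw [h]; decide), h]; simp
  · rw [h0 (by rw [h]; decide), h]; simp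

theorem genAlg_le (R : GRep m n q (Fin (m + n))) : genAlg R.coef ≤ R.powSpan := by
  refine sInf_le ⟨?_, ?_, ?_⟩
  · exact Submodule.subset_span ⟨0, Fin.elim0, Fin.elim0, (R.pow_zero_coef _ _).symm⟩
  · intro a b
    refine Submodule.subset_span ⟨1, Fin.cons a Fin.elim0, Fin.cons b Fin.elim0, ?_⟩
    ext x
    exact (GRep.tens_triv_right R x Fin.elim0 Fin.elim0 a b).symm
  · exact fun g hg h hh => R.conv_mem_powSpan hg hh

theorem pow_coef_mem_genAlg (R : GRep m n q (Fin (m + n))) {k : ℕ} (a b : Fin k → Fin (m + n)) :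
    (R.pow k).coef a b ∈ genAlg R.coef := by
  rw [genAlg, Submodule.mem_sInf]
  rintro G ⟨h0, h1, h2⟩
  induction k with
  | zero => rw [R.pow_zero_coef]; exact h0
  | succ k ih =>
    rw [← Fin.cons_self_tail a, ← Fin.cons_self_tail b]
    have h3 : (R.pow (k + 1)).coef (Fin.cons (a 0) (Fin.tail a)) (Fin.cons (b 0) (Fin.tail b)) =
        sgn (R.p (a 0) * ((R.pow k).p (Fin.tail a) + (R.pow k).p (Fin.tail b))) •
          conv (R.coef (a 0) (b 0)) ((R.pow k).coef (Fin.tail a) (Fin.tail b)) := by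
      rw [R.conv_coef_pow, smul_smul, sgn_mul_self, one_smul]
    rw [h3]
    exact G.smul_mem _ (h2 _ (h1 _ _) _ (ih _ _))

theorem tensorCoeff_eq {k : ℕ} (a b : Fin k → Fin (m + n)) :
    tensorCoeff q k a b = ((vecRep q).pow k).coef a b := by
  induction k with
  | zero => exact ((vecRep q).pow_zero_coef a b).symm
  | succ k ih =>
    rw [← Fin.cons_self_tail a, ← Fin.cons_self_tail b]
    generalize Fin.tail a = a', Fin.tail b = b', a 0 = i, b 0 = j
    have h1 : ((vecRep q).pow k).coef a' b' ∘ₗ (part 0 + sgn (par j) • part 1) =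
        sgn (par j * (((vecRep q).pow k).p a' + ((vecRep q).pow k).p b')) •
          ((vecRep q).pow k).coef a' b' := by
      rw [LinearMap.comp_add, LinearMap.comp_smul, GRep.coef_part, GRep.coef_part]
      rcases zmod2 (((vecRep q).pow k).p a' + ((vecRep q).pow k).p b') with h | h <;> simp [h]
    have h2 : tensorCoeff q (k + 1) (Fin.cons i a') (Fin.cons j b') =
        splitMul (tEl q i j) (tensorCoeff q k a' b' ∘ₗ (part 0 + sgn (par j) • part 1)) := rfl
    rw [h2, ih, h1]
    have h3 := GRep.tens_coef (vecRep q) ((vecRep q).pow k) (i, a') (j, b')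
    refine Eq.trans ?_ h3.symm
    ext x
    simp [splitMul, TensorProduct.map_smul_right, tEl_eq, vecRep_p]

theorem tensorAct_eq {k : ℕ} (x : Uq m n q) (c : (Fin k → Fin (m + n)) → ℂ) :
    tensorAct q k x c = (((vecRep q).pow k).ρ x).mulVec c := by
  funext a
  simp only [tensorAct, tensorCoeff_eq]
  rfl

theorem monomial_eq {k : ℕ} (R : GRep m n q (Fin (m + n))) (j : Fin (m + n))
    {L : Fin (m + n) → ℕ} {a : Fin k → Fin (m + n)} (ha : List.ofFn a = multiWord L) :
    ∃ s : ℂ, s ≠ 0 ∧ monomial (fun i => R.coef i j) L = s • (R.pow k).coef a (fun _ => j) := by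
  obtain ⟨s, hs, h⟩ := R.foldr_conv_coef a j
  refine ⟨s, hs, ?_⟩
  rw [← h, ha, monomial, multiWord, List.map_flatMap]
  simp only [List.map_replicate]

end Vector

/-! ### Generators on the tensor powers of the vector representation -/

section TensorPower
variable {m n : ℕ} (q : ℝ) [Fact (0 < q)] [Fact (q ≠ 1)] {k : ℕ}

/-- The `k`-th tensor power of the vector representation, in the basis of words of length `k`. -/
def tpow (k : ℕ) : Uq m n q →ₐ[ℂ] Matrix (Fin k → Fin (m + n)) (Fin k → Fin (m + n)) ℂ :=
  ((vecRep q).pow k).ρ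

/-- The eigenvalue of `K_j K_{j+1}⁻¹` on the basis tensor of the word `a`. -/
def kapVal (j : Fin (m + n - 1)) (a : Fin k → Fin (m + n)) : ℂ := ∏ i, wt q (a i) j

theorem kapVal_cons (j : Fin (m + n - 1)) (x : Fin (m + n)) (a : Fin k → Fin (m + n)) :
    kapVal q j (Fin.cons x a : Fin (k + 1) → Fin (m + n)) = wt q x j * kapVal q j a := by
  simp [kapVal, Fin.prod_univ_succ]

theorem kapVal_ne (j : Fin (m + n - 1)) (a : Fin k → Fin (m + n)) : kapVal q j a ≠ 0 :=
  Finset.prod_ne_zero_iff.2 fun _ _ => wt_ne _ _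

variable {q}

theorem vec_K (c a b : Fin (m + n)) :
    (vecRep q).ρ (gen q (.K c)) a b = if a = b then (if a = c then qa q c else 1) else 0 := by
  change vec m n q _ a b = _
  rw [vec, IsRel.lift_gen]; simp [vecGen, Matrix.diagonal_apply]

theorem vec_Kinv (c a b : Fin (m + n)) :
    (vecRep q).ρ (gen q (.Kinv c)) a b = if a = b then (if a = c then (qa q c)⁻¹ else 1) else 0 := by
  change vec m n q _ a b = _
  rw [vec, IsRel.lift_gen]; simp [vecGen, Matrix.diagonal_apply]

theorem vec_E (j : Fin (m + n - 1)) (a b : Fin (m + n)) :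
    (vecRep q).ρ (gen q (.E j)) a b = if a = lo j ∧ b = hi j then 1 else 0 := by
  change vec m n q _ a b = _
  rw [vec, IsRel.lift_gen]; simp [vecGen, Matrix.single_apply, eq_comm]

theorem vec_F (j : Fin (m + n - 1)) (a b : Fin (m + n)) :
    (vecRep q).ρ (gen q (.F j)) a b = if a = hi j ∧ b = lo j then 1 else 0 := by
  change vec m n q _ a b = _
  rw [vec, IsRel.lift_gen]; simp [vecGen, Matrix.single_apply, eq_comm]

theorem vec_kap (j : Fin (m + n - 1)) (a b : Fin (m + n)) :
    (vecRep q).ρ (kap (gen q) j) a b = if a = b then wt q a j else 0 := by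
  have h := lo_ne_hi j
  rw [kap, map_mul, Matrix.mul_apply, Finset.sum_eq_single a]
  · rw [vec_K, vec_Kinv]
    by_cases hab : a = b
    · subst hab
      unfold wt
      by_cases h1 : a = lo j
      · subst h1; simp [h]
      · by_cases h2 : a = hi j
        · subst h2; simp [h.symm]
        · simp [h1, h2]
    · simp [hab]
  · intro c _ hc
    rw [vec_K, if_neg (Ne.symm hc), zero_mul]
  · simp

theorem vec_kapInv (j : Fin (m + n - 1)) (a b : Fin (m + n)) :
    (vecRep q).ρ (kapInv (gen q) j) a b = if a = b then (wt q a j)⁻¹ else 0 := by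
  have h := lo_ne_hi j
  rw [kapInv, map_mul, Matrix.mul_apply, Finset.sum_eq_single a]
  · rw [vec_K, vec_Kinv]
    by_cases hab : a = b
    · subst hab
      unfold wt
      by_cases h1 : a = lo j
      · subst h1; simp [h]
      · by_cases h2 : a = hi j
        · subst h2; simp [h.symm]
        · simp [h1, h2]
    · simp [hab]
  · intro c _ hc
    rw [vec_Kinv, if_neg (Ne.symm hc), zero_mul]
  · simp

theorem tpow_cons (x : Uq m n q) (i j : Fin (m + n)) (a b : Fin k → Fin (m + n)) :
    tpow q (k + 1) x (Fin.cons i a) (Fin.cons j b) =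
      GRep.tensHom (vecRep q) ((vecRep q).pow k) x (i, a) (j, b) := rfl

theorem cons_induction {P : ∀ k : ℕ, (Fin k → Fin (m + n)) → (Fin k → Fin (m + n)) → Prop}
    (h0 : ∀ a b, P 0 a b)
    (hs : ∀ k i j a b, P k a b → P (k + 1) (Fin.cons i a) (Fin.cons j b))
    (a b : Fin k → Fin (m + n)) : P k a b := by
  induction k with
  | zero => exact h0 a b
  | succ k ih =>
    rw [← Fin.cons_self_tail a, ← Fin.cons_self_tail b]
    exact hs _ _ _ _ _ (ih _ _)

theorem tpow_zero_apply (x : Uq m n q) (a b : Fin 0 → Fin (m + n)) :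
    tpow q 0 x a b = counit m n q x := (vecRep q).pow_zero_apply x a b

theorem counit_gen (u : Gen m n) : counit m n q (gen q u) = match u with
    | .K _ => (1 : ℂ) | .Kinv _ => 1 | .E _ => 0 | .F _ => 0 := IsRel.lift_gen _ u

theorem tpow_K (c : Fin (m + n)) :
    tpow q k (gen q (.K c)) = Matrix.diagonal fun a => qa q c ^ content a c := by
  ext a b
  induction a, b using cons_induction with
  | h0 a b => rw [tpow_zero_apply, counit_gen, Subsingleton.elim a b]; simp [content]
  | hs k i j a b ih =>
    rw [tpow_cons, GRep.tensHom_K, vec_K]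
    change _ * tpow q k _ a b = _
    rw [ih, Matrix.diagonal_apply, Matrix.diagonal_apply, content_cons, pow_add]
    simp only [Fin.cons_inj]
    by_cases h1 : i = j <;> by_cases h2 : a = b <;> by_cases h3 : i = c <;> simp [h1, h2, h3]

theorem tpow_Kinv (c : Fin (m + n)) :
    tpow q k (gen q (.Kinv c)) = Matrix.diagonal fun a => (qa q c ^ content a c)⁻¹ := by
  ext a b
  induction a, b using cons_induction with
  | h0 a b => rw [tpow_zero_apply, counit_gen, Subsingleton.elim a b]; simp [content]
  | hs k i j a b ih =>
    rw [tpow_cons, GRep.tensHom_Kinv, vec_Kinv]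
    change _ * tpow q k _ a b = _
    rw [ih, Matrix.diagonal_apply, Matrix.diagonal_apply, content_cons, pow_add]
    simp only [Fin.cons_inj]
    by_cases h1 : i = j
    · subst h1
      by_cases h2 : a = b <;> by_cases h3 : i = c <;> simp [h2, h3, mul_comm]
    · simp [h1]

theorem tpow_kap (j : Fin (m + n - 1)) :
    tpow q k (kap (gen q) j) = Matrix.diagonal (kapVal q j) := by
  ext a b
  induction a, b using cons_induction with
  | h0 a b =>
    rw [tpow_zero_apply, Subsingleton.elim a b, lift_kap, counit_gen, counit_gen]; simp [kapVal]
  | hs k i i' a b ih =>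
    rw [tpow_cons, GRep.tensHom_kap, vec_kap]
    change _ * tpow q k _ a b = _
    rw [ih, Matrix.diagonal_apply, Matrix.diagonal_apply, kapVal_cons]
    simp only [Fin.cons_inj]
    by_cases h1 : i = i' <;> by_cases h2 : a = b <;> simp [h1, h2]

theorem tpow_kapInv (j : Fin (m + n - 1)) :
    tpow q k (kapInv (gen q) j) = Matrix.diagonal fun a => (kapVal q j a)⁻¹ := by
  ext a b
  induction a, b using cons_induction with
  | h0 a b =>
    rw [tpow_zero_apply, Subsingleton.elim a b, lift_kapInv, counit_gen, counit_gen]; simp [kapVal]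
  | hs k i i' a b ih =>
    rw [tpow_cons, GRep.tensHom_kapInv, vec_kapInv]
    change _ * tpow q k _ a b = _
    rw [ih, Matrix.diagonal_apply, Matrix.diagonal_apply, kapVal_cons]
    simp only [Fin.cons_inj]
    by_cases h1 : i = i' <;> by_cases h2 : a = b <;> simp [h1, h2, mul_comm]

theorem tpow_E_cons (j : Fin (m + n - 1)) (x y : Fin (m + n)) (a b : Fin k → Fin (m + n)) :
    tpow q (k + 1) (gen q (.E j)) (Fin.cons x a) (Fin.cons y b) =
      (if x = lo j ∧ y = hi j ∧ a = b then kapVal q j a else 0) +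
      if x = y then sgn (odd j * par x) * tpow q k (gen q (.E j)) a b else 0 := by
  rw [tpow_cons, GRep.tensHom_E, vec_E]
  change _ * tpow q k _ a b + _ = _
  rw [tpow_kap, Matrix.diagonal_apply]
  congr 1
  · by_cases h1 : x = lo j <;> by_cases h2 : y = hi j <;> by_cases h3 : a = b <;> simp [h1, h2, h3]
  · by_cases h : x = y
    · subst h; rfl
    · simp [h]

theorem tpow_F_cons (j : Fin (m + n - 1)) (x y : Fin (m + n)) (a b : Fin k → Fin (m + n)) :
    tpow q (k + 1) (gen q (.F j)) (Fin.cons x a) (Fin.cons y b) =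
      (if x = hi j ∧ y = lo j ∧ a = b then 1 else 0) +
      if x = y then sgn (odd j * par x) * (wt q x j)⁻¹ * tpow q k (gen q (.F j)) a b else 0 := by
  rw [tpow_cons, GRep.tensHom_F, vec_F, vec_kapInv]
  congr 1
  · by_cases h1 : x = hi j <;> by_cases h2 : y = lo j <;> by_cases h3 : a = b <;> simp [h1, h2, h3]
  · by_cases h : x = y
    · subst h
      simp only [if_true, vecRep_p, mul_assoc]; rfl
    · simp [h]

theorem sum_words {M : Type*} [AddCommMonoid M] (f : (Fin (k + 1) → Fin (m + n)) → M) :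
    ∑ b, f b = ∑ y, ∑ b : Fin k → Fin (m + n), f (Fin.cons y b) := by
  rw [← Fintype.sum_prod_type']
  exact ((Fin.consEquiv fun _ => Fin (m + n)).sum_comp f).symm

/-- The action of `E_j`, by the first letter of words. -/
theorem E_mulVec_cons (j : Fin (m + n - 1)) (c : (Fin (k + 1) → Fin (m + n)) → ℂ)
    (x : Fin (m + n)) (a : Fin k → Fin (m + n)) :
    (tpow q (k + 1) (gen q (.E j))).mulVec c (Fin.cons x a) =
      (if x = lo j then kapVal q j a * c (Fin.cons (hi j) a) else 0) +
      sgn (odd j * par x) * (tpow q k (gen q (.E j))).mulVec (fun b => c (Fin.cons x b)) a := by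
  simp only [Matrix.mulVec, dotProduct]
  rw [sum_words]
  simp only [tpow_E_cons, add_mul, Finset.sum_add_distrib]
  congr 1
  · rw [Finset.sum_eq_single (hi j)]
    · rw [Finset.sum_eq_single a]
      · split_ifs with h1 h2 h2 <;> simp_all
      · intro b _ hb; simp [Ne.symm hb]
      · simp
    · intro y _ hy; simp [hy]
    · simp
  · rw [Finset.sum_eq_single x]
    · simp only [if_true, mul_assoc, Finset.mul_sum]
    · intro y _ hy; simp [Ne.symm hy]
    · simp

/-- The action of `F_j`, by the first letter of words. -/
theorem F_mulVec_cons (j : Fin (m + n - 1)) (c : (Fin (k + 1) → Fin (m + n)) → ℂ)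
    (x : Fin (m + n)) (a : Fin k → Fin (m + n)) :
    (tpow q (k + 1) (gen q (.F j))).mulVec c (Fin.cons x a) =
      (if x = hi j then c (Fin.cons (lo j) a) else 0) +
      sgn (odd j * par x) * (wt q x j)⁻¹ *
        (tpow q k (gen q (.F j))).mulVec (fun b => c (Fin.cons x b)) a := by
  simp only [Matrix.mulVec, dotProduct]
  rw [sum_words]
  simp only [tpow_F_cons, add_mul, Finset.sum_add_distrib]
  congr 1
  · rw [Finset.sum_eq_single (lo j)]
    · rw [Finset.sum_eq_single a]
      · split_ifs with h1 h2 h2 <;> simp_all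
      · intro b _ hb; simp [Ne.symm hb]
      · simp
    · intro y _ hy; simp [hy]
    · simp
  · rw [Finset.sum_eq_single x]
    · simp only [if_true, mul_assoc, Finset.mul_sum]
    · intro y _ hy; simp [Ne.symm hy]
    · simp

/-- Up to invertible diagonal factors, `F_j` acts by the transpose of `E_j`. -/
theorem tpow_F_mul_kapVal (j : Fin (m + n - 1)) (a b : Fin k → Fin (m + n)) :
    tpow q k (gen q (.F j)) a b * kapVal q j b = qa q (lo j) * tpow q k (gen q (.E j)) b a := by
  induction a, b using cons_induction with
  | h0 a b => rw [tpow_zero_apply, tpow_zero_apply, counit_gen, counit_gen]; simp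
  | hs k x y a b ih =>
    rw [tpow_F_cons, tpow_E_cons, kapVal_cons, add_mul, mul_add]
    congr 1
    · by_cases h1 : x = hi j
      · by_cases h2 : y = lo j
        · by_cases h3 : a = b
          · subst h1 h2 h3; simp [wt]
          · simp [h3, Ne.symm h3]
        · simp [h2]
      · simp [h1]
    · by_cases h : x = y
      · subst h
        have := wt_ne (q := q) x j
        simp only [if_true]
        field_simp
        linear_combination sgn (odd j * par x) * ih
      · simp [h, Ne.symm h]

theorem tpow_E_transpose (j : Fin (m + n - 1)) : (tpow q k (gen q (.E j))).transpose =
    tpow q k ((qa q (lo j))⁻¹ • (gen q (.F j) * kap (gen q) j)) := by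
  ext a b
  rw [map_smul, map_mul, tpow_kap, Matrix.smul_apply, Matrix.mul_diagonal, tpow_F_mul_kapVal,
    smul_eq_mul, inv_mul_cancel_left₀ (qa_ne _)]
  rfl

theorem tpow_F_transpose (j : Fin (m + n - 1)) : (tpow q k (gen q (.F j))).transpose =
    tpow q k (qa q (lo j) • (kapInv (gen q) j * gen q (.E j))) := by
  ext b a
  rw [map_smul, map_mul, tpow_kapInv, Matrix.smul_apply, Matrix.diagonal_mul, Matrix.transpose_apply,
    smul_eq_mul, mul_left_comm, ← tpow_F_mul_kapVal]
  have := kapVal_ne q j b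
  field_simp

/-- The operators by which `U_q(gl(m|n))` acts on a tensor power are closed under transposition. -/
theorem exists_transpose (x : Uq m n q) : ∃ y, (tpow q k x).transpose = tpow q k y := by
  let A : Subalgebra ℂ (Uq m n q) :=
    { carrier := {x | ∃ y, (tpow q k x).transpose = tpow q k y}
      mul_mem' := by
        rintro x y ⟨x', hx⟩ ⟨y', hy⟩
        exact ⟨y' * x', by rw [map_mul, map_mul, Matrix.transpose_mul, hx, hy]⟩
      add_mem' := by
        rintro x y ⟨x', hx⟩ ⟨y', hy⟩
        exact ⟨x' + y', by rw [map_add, map_add, Matrix.transpose_add, hx, hy]⟩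
      algebraMap_mem' := fun r => ⟨algebraMap ℂ _ r, by
        rw [AlgHom.commutes, Algebra.algebraMap_eq_smul_one, Matrix.transpose_smul,
          Matrix.transpose_one]⟩ }
  refine Uq.mem_of_gen A (fun u => ?_) x
  cases u with
  | K i => exact ⟨gen q (.K i), by rw [tpow_K, Matrix.diagonal_transpose]⟩
  | Kinv i => exact ⟨gen q (.Kinv i), by rw [tpow_Kinv, Matrix.diagonal_transpose]⟩
  | E j => exact ⟨_, tpow_E_transpose j⟩
  | F j => exact ⟨_, tpow_F_transpose j⟩

end TensorPower

/-! ### Stability of the skew supersymmetric tensors -/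

section Skew
variable {m n : ℕ} {q : ℝ} {k : ℕ}

/-- The factor `-(-1)^{[x][y]} q⁻¹` by which the coordinate of a skew supersymmetric tensor changes
when adjacent letters `x < y` are exchanged. -/
def swapFactor (q : ℝ) (x y : Fin (m + n)) : ℝ := -(if par x * par y = 0 then 1 else -1) * q⁻¹

theorem swapFactor_cast (x y : Fin (m + n)) :
    ((swapFactor q x y : ℝ) : ℂ) = -sgn (par x * par y) * (q : ℂ)⁻¹ := by
  unfold swapFactor sgn
  split_ifs <;> simp

theorem cons_comp_swap_succ (x : Fin (m + n)) (a : Fin k → Fin (m + n)) (i j : Fin k) :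
    (Fin.cons x a : Fin (k + 1) → Fin (m + n)) ∘ Equiv.swap i.succ j.succ =
      Fin.cons x (a ∘ Equiv.swap i j) := by
  funext l
  refine Fin.cases ?_ (fun l => ?_) l
  · rw [Function.comp_apply, Equiv.swap_apply_of_ne_of_ne (Fin.succ_ne_zero i).symm
      (Fin.succ_ne_zero j).symm]
    rfl
  · rw [Function.comp_apply, ← (Fin.succ_injective k).map_swap]
    rfl

theorem cons_cons_comp_swap (x y : Fin (m + n)) (a : Fin k → Fin (m + n)) :
    (Fin.cons x (Fin.cons y a) : Fin (k + 2) → Fin (m + n)) ∘ Equiv.swap 0 1 =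
      Fin.cons y (Fin.cons x a) := by
  funext l
  refine Fin.cases ?_ (fun l => Fin.cases ?_ (fun l => ?_) l) l
  · simp
  · rw [Function.comp_apply, Fin.succ_zero_eq_one, Equiv.swap_apply_right]; rfl
  · rw [Function.comp_apply, Equiv.swap_apply_of_ne_of_ne (Fin.succ_ne_zero _)
      (by rw [← Fin.succ_zero_eq_one]; exact fun h => Fin.succ_ne_zero _ (Fin.succ_injective _ h))]
    rfl

theorem mem_skew {c : (Fin k → Fin (m + n)) → ℂ} : c ∈ skewTensors m n k q ↔
    ∀ (a : Fin k → Fin (m + n)) (i j : Fin k), (i : ℕ) + 1 = j →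
      (a i = a j → par (a i) = 0 → c a = 0) ∧
      (a i < a j → c (a ∘ Equiv.swap i j) = (swapFactor q (a i) (a j) : ℝ) * c a) := by
  simp only [swapFactor_cast]; exact Iff.rfl

theorem skew_slice {c : (Fin (k + 1) → Fin (m + n)) → ℂ} (hc : c ∈ skewTensors m n (k + 1) q)
    (x : Fin (m + n)) : (fun b => c (Fin.cons x b)) ∈ skewTensors m n k q := by
  rw [mem_skew] at hc ⊢
  intro a i j hij
  have := hc (Fin.cons x a) i.succ j.succ (by simpa using hij)
  rw [cons_comp_swap_succ] at this
  exact this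

theorem skew_pair {c : (Fin (k + 2) → Fin (m + n)) → ℂ} (hc : c ∈ skewTensors m n (k + 2) q)
    (x y : Fin (m + n)) (a : Fin k → Fin (m + n)) :
    (x = y → par x = 0 → c (Fin.cons x (Fin.cons y a)) = 0) ∧
    (x < y → c (Fin.cons y (Fin.cons x a)) =
      (swapFactor q x y : ℝ) * c (Fin.cons x (Fin.cons y a))) := by
  rw [mem_skew] at hc
  have := hc (Fin.cons x (Fin.cons y a)) 0 1 rfl
  rw [cons_cons_comp_swap] at this
  exact this

/-- Skew supersymmetry can be checked on the slices by the first letter and on the first two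
letters. -/
theorem skew_succ {c : (Fin (k + 2) → Fin (m + n)) → ℂ}
    (h : ∀ x, (fun b => c (Fin.cons x b)) ∈ skewTensors m n (k + 1) q)
    (h2 : ∀ (x y : Fin (m + n)) (a : Fin k → Fin (m + n)),
      (x = y → par x = 0 → c (Fin.cons x (Fin.cons y a)) = 0) ∧
      (x < y → c (Fin.cons y (Fin.cons x a)) =
        (swapFactor q x y : ℝ) * c (Fin.cons x (Fin.cons y a)))) :
    c ∈ skewTensors m n (k + 2) q := by
  rw [mem_skew]
  intro a i j hij
  rcases Fin.eq_zero_or_eq_succ i with rfl | ⟨i, rfl⟩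
  · have hj : j = 1 := Fin.ext (by rw [← hij]; rfl)
    subst hj
    rw [← Fin.cons_self_tail a, ← Fin.cons_self_tail (Fin.tail a)]
    generalize a 0 = x, Fin.tail a 0 = y, Fin.tail (Fin.tail a) = b
    rw [cons_cons_comp_swap]
    exact h2 x y b
  · rcases Fin.eq_zero_or_eq_succ j with rfl | ⟨j, rfl⟩
    · simp at hij
    · rw [← Fin.cons_self_tail a]
      generalize a 0 = x, Fin.tail a = b
      rw [cons_comp_swap_succ]
      have := h x
      rw [mem_skew] at this
      exact this b i j (by simpa using hij)

theorem mem_skew_of_le_one (hk : k ≤ 1) (c : (Fin k → Fin (m + n)) → ℂ) :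
    c ∈ skewTensors m n k q := by
  rw [mem_skew]; intro a i j hij; omega

/-- Multiplication by a function of words that does not depend on the order of the letters
preserves skew supersymmetry. -/
theorem skew_mul {g c : (Fin k → Fin (m + n)) → ℂ} (hg : ∀ a (σ : Equiv.Perm (Fin k)), g (a ∘ σ) = g a)
    (hc : c ∈ skewTensors m n k q) : (fun a => g a * c a) ∈ skewTensors m n k q := by
  rw [mem_skew] at hc ⊢
  intro a i j hij
  refine ⟨fun h1 h2 => by simp only [(hc a i j hij).1 h1 h2, mul_zero], fun h => ?_⟩
  simp only [hg, (hc a i j hij).2 h]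
  ring

variable [hq : Fact (0 < q)] [Fact (q ≠ 1)]

theorem q_ne : (q : ℂ) ≠ 0 := by exact_mod_cast hq.out.ne'

theorem lo_lt_hi (j : Fin (m + n - 1)) : lo j < hi j := by
  simp [lo, hi, Fin.lt_def]

theorem wt_lo (j : Fin (m + n - 1)) : wt q (lo j) j = qa q (lo j) := by simp [wt]

theorem wt_hi (j : Fin (m + n - 1)) : wt q (hi j) j = (qa q (hi j))⁻¹ := by
  simp [wt, (lo_ne_hi j).symm]

theorem wt_other {j : Fin (m + n - 1)} {x : Fin (m + n)} (h : x ≠ lo j) (h' : x ≠ hi j) :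
    wt q x j = 1 := by simp [wt, h, h']

theorem qa_of_par {x : Fin (m + n)} : qa q x = if par x = 0 then (q : ℂ) else (q : ℂ)⁻¹ := by
  unfold qa par; split_ifs <;> simp_all

theorem kapVal_comp_perm (j : Fin (m + n - 1)) (a : Fin k → Fin (m + n)) (σ : Equiv.Perm (Fin k)) :
    kapVal q j (a ∘ σ) = kapVal q j a := Equiv.prod_comp σ fun i => wt q (a i) j

/-- The two-letter identity by which `E_j` preserves the skew symmetry in two adjacent letters. -/
theorem skew_E_pair (j : Fin (m + n - 1)) (C : Fin (m + n) → Fin (m + n) → ℂ)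
    (h0 : ∀ x, par x = 0 → C x x = 0)
    (h1 : ∀ x y, x < y → C y x = (swapFactor q x y : ℝ) * C x y) (x y : Fin (m + n)) (hxy : x < y) :
    (if y = lo j then wt q x j * C (hi j) x else 0) +
        sgn (odd j * par y) * (if x = lo j then C y (hi j) else 0) =
      (swapFactor q x y : ℝ) * ((if x = lo j then wt q y j * C (hi j) y else 0) +
        sgn (odd j * par x) * (if y = lo j then C x (hi j) else 0)) := by
  have hq0 := q_ne (q := q)
  have hlt := lo_lt_hi j
  have ho := odd_eq j
  by_cases hx : x = lo j
  · subst hx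
    have hy : y ≠ lo j := hxy.ne'
    simp only [hy, if_false, if_true, zero_add, mul_zero, add_zero]
    by_cases hy2 : y = hi j
    · subst hy2
      rw [wt_hi, swapFactor_cast, qa_of_par, ho]
      rcases zmod2 (par (hi j)) with h | h
      · rw [h0 _ h]; simp
      · rcases zmod2 (par (lo j)) with h' | h' <;>
          simp [h, h', hq0, show (1 : ZMod 2) + 1 = 0 from rfl]
    · have hlt2 : hi j < y := by
        simp only [Fin.lt_def, lo, hi, ne_eq, Fin.ext_iff] at *; omega
      rw [wt_other hy hy2, h1 _ _ hlt2, swapFactor_cast, swapFactor_cast, ho, add_mul, sgn_add]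
      linear_combination (-(sgn (par (lo j) * par y)) * (q : ℂ)⁻¹ * C (hi j) y) *
        sgn_mul_self (par (hi j) * par y)
  · by_cases hy : y = lo j
    · subst hy
      have hx2 : x ≠ hi j := (hxy.trans hlt).ne
      simp only [hx, if_false, if_true, zero_add, mul_zero, add_zero]
      rw [wt_other hx hx2, h1 _ _ (hxy.trans hlt), swapFactor_cast, swapFactor_cast, ho, add_mul,
        sgn_add, mul_comm (par x), mul_comm (par x)]
      linear_combination (sgn (par (hi j) * par x) * (q : ℂ)⁻¹ * C x (hi j)) *
        sgn_mul_self (par (lo j) * par x)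
    · simp [hx, hy]

/-- The two-letter identity by which `F_j` preserves the skew symmetry in two adjacent letters. -/
theorem skew_F_pair (j : Fin (m + n - 1)) (C : Fin (m + n) → Fin (m + n) → ℂ)
    (h0 : ∀ x, par x = 0 → C x x = 0)
    (h1 : ∀ x y, x < y → C y x = (swapFactor q x y : ℝ) * C x y) (x y : Fin (m + n)) (hxy : x < y) :
    (if y = hi j then C (lo j) x else 0) +
        sgn (odd j * par y) * (wt q y j)⁻¹ * (if x = hi j then C y (lo j) else 0) =
      (swapFactor q x y : ℝ) * ((if x = hi j then C (lo j) y else 0) +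
        sgn (odd j * par x) * (wt q x j)⁻¹ * (if y = hi j then C x (lo j) else 0)) := by
  have hq0 := q_ne (q := q)
  have hlt := lo_lt_hi j
  have ho := odd_eq j
  by_cases hy : y = hi j
  · subst hy
    have hx : x ≠ hi j := hxy.ne
    simp only [hx, if_false, if_true, zero_add, mul_zero, add_zero]
    by_cases hx2 : x = lo j
    · subst hx2
      rw [wt_lo, swapFactor_cast, qa_of_par, ho]
      rcases zmod2 (par (lo j)) with h | h
      · rw [h0 _ h]; simp
      · rcases zmod2 (par (hi j)) with h' | h' <;>
          simp [h, h', hq0, show (1 : ZMod 2) + 1 = 0 from rfl]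
    · have hlt2 : x < lo j := by
        simp only [Fin.lt_def, lo, hi, ne_eq, Fin.ext_iff] at *; omega
      rw [wt_other hx2 hx, h1 _ _ hlt2, swapFactor_cast, swapFactor_cast, ho, add_mul, sgn_add,
        mul_comm (par x), mul_comm (par x)]
      simp only [inv_one]
      linear_combination (sgn (par (lo j) * par x) * (q : ℂ)⁻¹ * C x (lo j)) *
        sgn_mul_self (par (hi j) * par x)
  · by_cases hx : x = hi j
    · subst hx
      have hy2 : y ≠ lo j := (hlt.trans hxy).ne'
      simp only [hy, if_false, if_true, zero_add, mul_zero, add_zero]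
      rw [wt_other hy2 hy, h1 _ _ (hlt.trans hxy), swapFactor_cast, swapFactor_cast, ho, add_mul,
        sgn_add]
      simp only [inv_one]
      linear_combination (-(sgn (par (hi j) * par y)) * (q : ℂ)⁻¹ * C (lo j) y) *
        sgn_mul_self (par (lo j) * par y)
    · simp [hx, hy]

theorem skew_diag {g : (Fin k → Fin (m + n)) → ℂ} (hg : ∀ a (σ : Equiv.Perm (Fin k)), g (a ∘ σ) = g a)
    {c : (Fin k → Fin (m + n)) → ℂ} (hc : c ∈ skewTensors m n k q) :
    (Matrix.diagonal g).mulVec c ∈ skewTensors m n k q := by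
  have : (Matrix.diagonal g).mulVec c = fun a => g a * c a := by
    funext a; rw [Matrix.mulVec_diagonal]
  rw [this]
  exact skew_mul hg hc

theorem skew_E (j : Fin (m + n - 1)) {c : (Fin k → Fin (m + n)) → ℂ}
    (hc : c ∈ skewTensors m n k q) :
    (tpow q k (gen q (.E j))).mulVec c ∈ skewTensors m n k q := by
  induction k with
  | zero => exact mem_skew_of_le_one (by omega) _
  | succ k ih =>
    rcases k with _ | l
    · exact mem_skew_of_le_one (by omega) _
    refine skew_succ ?_ ?_
    · intro x
      have h : (fun b => (tpow q (l + 2) (gen q (.E j))).mulVec c (Fin.cons x b)) =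
          (if x = lo j then (fun b => kapVal q j b * c (Fin.cons (hi j) b)) else 0) +
            sgn (odd j * par x) •
              (tpow q (l + 1) (gen q (.E j))).mulVec (fun b => c (Fin.cons x b)) := by
        funext b
        rw [E_mulVec_cons]
        split_ifs <;> simp
      rw [h]
      refine Submodule.add_mem _ ?_ (Submodule.smul_mem _ _ (ih (skew_slice hc x)))
      split_ifs
      · exact skew_mul (kapVal_comp_perm j) (skew_slice hc _)
      · exact Submodule.zero_mem _
    · intro x y a
      have hC0 : ∀ x, par x = 0 → c (Fin.cons x (Fin.cons x a)) = 0 :=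
        fun x hx => (skew_pair hc x x a).1 rfl hx
      have hC1 : ∀ x y, x < y → c (Fin.cons y (Fin.cons x a)) =
          (swapFactor q x y : ℝ) * c (Fin.cons x (Fin.cons y a)) :=
        fun x y => (skew_pair hc x y a).2
      simp only [E_mulVec_cons, kapVal_cons]
      refine ⟨?_, fun hxy => ?_⟩
      · rintro rfl hx
        have : (fun b => c (Fin.cons x (Fin.cons x b))) = 0 := by
          funext b; exact (skew_pair hc x x b).1 rfl hx
        rw [this, Matrix.mulVec_zero]
        split_ifs with h
        · have h2 := hC1 _ _ (lo_lt_hi j)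
          rw [h] at hx ⊢
          rw [wt_lo, h2, swapFactor_cast, qa_of_par, hx]
          have := q_ne (q := q)
          simp
          field_simp
          ring
        · simp
      · have hD : (fun b => c (Fin.cons y (Fin.cons x b))) =
            ((swapFactor q x y : ℝ) : ℂ) • fun b => c (Fin.cons x (Fin.cons y b)) := by
          funext b; exact (skew_pair hc x y b).2 hxy
        rw [hD, Matrix.mulVec_smul, Pi.smul_apply, smul_eq_mul]
        have key := skew_E_pair j (fun x y => kapVal q j a * c (Fin.cons x (Fin.cons y a)))
          (fun x hx => by simp [hC0 x hx]) (fun x y h => by simp only [hC1 x y h]; ring) x y hxy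
        simp only [mul_ite, mul_zero, mul_add, ← mul_assoc] at key ⊢
        split_ifs at key ⊢ <;> linear_combination key
  
theorem skew_F (j : Fin (m + n - 1)) {c : (Fin k → Fin (m + n)) → ℂ}
    (hc : c ∈ skewTensors m n k q) :
    (tpow q k (gen q (.F j))).mulVec c ∈ skewTensors m n k q := by
  induction k with
  | zero => exact mem_skew_of_le_one (by omega) _
  | succ k ih =>
    rcases k with _ | l
    · exact mem_skew_of_le_one (by omega) _
    refine skew_succ ?_ ?_
    · intro x
      have h : (fun b => (tpow q (l + 2) (gen q (.F j))).mulVec c (Fin.cons x b)) =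
          (if x = hi j then (fun b => c (Fin.cons (lo j) b)) else 0) +
            (sgn (odd j * par x) * (wt q x j)⁻¹) •
              (tpow q (l + 1) (gen q (.F j))).mulVec (fun b => c (Fin.cons x b)) := by
        funext b
        rw [F_mulVec_cons]
        split_ifs <;> simp
      rw [h]
      refine Submodule.add_mem _ ?_ (Submodule.smul_mem _ _ (ih (skew_slice hc x)))
      split_ifs
      · exact skew_slice hc _
      · exact Submodule.zero_mem _
    · intro x y a
      have hC0 : ∀ x, par x = 0 → c (Fin.cons x (Fin.cons x a)) = 0 :=
        fun x hx => (skew_pair hc x x a).1 rfl hx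
      have hC1 : ∀ x y, x < y → c (Fin.cons y (Fin.cons x a)) =
          (swapFactor q x y : ℝ) * c (Fin.cons x (Fin.cons y a)) :=
        fun x y => (skew_pair hc x y a).2
      simp only [F_mulVec_cons]
      refine ⟨?_, fun hxy => ?_⟩
      · rintro rfl hx
        have : (fun b => c (Fin.cons x (Fin.cons x b))) = 0 := by
          funext b; exact (skew_pair hc x x b).1 rfl hx
        rw [this, Matrix.mulVec_zero]
        split_ifs with h
        · have h2 := hC1 _ _ (lo_lt_hi j)
          rw [h] at hx ⊢
          rw [wt_hi, h2, swapFactor_cast, qa_of_par, hx]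
          have := q_ne (q := q)
          simp
          field_simp
          ring
        · simp
      · have hD : (fun b => c (Fin.cons y (Fin.cons x b))) =
            ((swapFactor q x y : ℝ) : ℂ) • fun b => c (Fin.cons x (Fin.cons y b)) := by
          funext b; exact (skew_pair hc x y b).2 hxy
        rw [hD, Matrix.mulVec_smul, Pi.smul_apply, smul_eq_mul]
        have key := skew_F_pair j (fun x y => c (Fin.cons x (Fin.cons y a))) hC0 hC1 x y hxy
        linear_combination key

/-- The skew supersymmetric tensors form a submodule of the tensor power. -/
theorem skew_stable (x : Uq m n q) {c : (Fin k → Fin (m + n)) → ℂ}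
    (hc : c ∈ skewTensors m n k q) : (tpow q k x).mulVec c ∈ skewTensors m n k q := by
  let A : Subalgebra ℂ (Uq m n q) :=
    { carrier := {x | ∀ c ∈ skewTensors m n k q, (tpow q k x).mulVec c ∈ skewTensors m n k q}
      mul_mem' := fun {x y} hx hy c hc => by
        rw [map_mul, ← Matrix.mulVec_mulVec]; exact hx _ (hy _ hc)
      add_mem' := fun {x y} hx hy c hc => by
        rw [map_add, Matrix.add_mulVec]; exact Submodule.add_mem _ (hx _ hc) (hy _ hc)
      algebraMap_mem' := fun r c hc => by
        rw [AlgHom.commutes, Algebra.algebraMap_eq_smul_one, Matrix.smul_mulVec, Matrix.one_mulVec]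
        exact Submodule.smul_mem _ _ hc }
  refine Uq.mem_of_gen A ?_ x c hc
  intro u c hc
  cases u with
  | K i => rw [tpow_K]; exact skew_diag (fun a σ => by rw [content_comp_perm]) hc
  | Kinv i => rw [tpow_Kinv]; exact skew_diag (fun a σ => by rw [content_comp_perm]) hc
  | E j => exact skew_E j hc
  | F j => exact skew_F j hc

end Skew

/-! ### Coordinates of skew supersymmetric tensors -/

section Coordinates
variable {m n : ℕ} (q : ℝ) {k : ℕ}

/-- The coordinate of the word `a` in a skew supersymmetric tensor, when the weakly increasing
rearrangement of `a` has coordinate `1`: each inversion contributes its exchange factor. -/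
def invCoord : {k : ℕ} → (Fin k → Fin (m + n)) → ℝ
  | 0, _ => 1
  | _ + 1, a => (∏ i, if Fin.tail a i < a 0 then swapFactor q (Fin.tail a i) (a 0) else 1) *
      invCoord (Fin.tail a)

theorem invCoord_cons (x : Fin (m + n)) (a : Fin k → Fin (m + n)) :
    invCoord q (Fin.cons x a : Fin (k + 1) → Fin (m + n)) =
      (∏ i, if a i < x then swapFactor q (a i) x else 1) * invCoord q a := rfl

theorem swapFactor_ne [hq : Fact (0 < q)] (x y : Fin (m + n)) : swapFactor q x y ≠ 0 := by
  have := hq.out.ne'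
  unfold swapFactor
  split_ifs <;> simp [this]

theorem invCoord_ne [Fact (0 < q)] (a : Fin k → Fin (m + n)) : invCoord q a ≠ 0 := by
  induction k with
  | zero => exact one_ne_zero
  | succ k ih =>
    refine mul_ne_zero (Finset.prod_ne_zero_iff.2 fun i _ => ?_) (ih _)
    split_ifs
    · exact swapFactor_ne q _ _
    · exact one_ne_zero

theorem invCoord_swap (a : Fin k → Fin (m + n)) (i j : Fin k) (hij : (i : ℕ) + 1 = j)
    (h : a i < a j) : invCoord q (a ∘ Equiv.swap i j) = swapFactor q (a i) (a j) * invCoord q a := by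
  induction k with
  | zero => exact i.elim0
  | succ k ih =>
    rcases Fin.eq_zero_or_eq_succ i with rfl | ⟨i, rfl⟩
    · rcases k with _ | k
      · omega
      have hj : j = 1 := Fin.ext (by rw [← hij]; rfl)
      subst hj
      rw [← Fin.cons_self_tail a, ← Fin.cons_self_tail (Fin.tail a)] at h ⊢
      generalize a 0 = x, Fin.tail a 0 = y, Fin.tail (Fin.tail a) = b at h ⊢
      rw [cons_cons_comp_swap]
      have h' : x < y := h
      change _ = swapFactor q x y * _
      simp only [invCoord_cons, Fin.prod_univ_succ, Fin.cons_zero, Fin.cons_succ, h', if_true,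
        h'.not_gt, if_false]
      ring
    · rcases Fin.eq_zero_or_eq_succ j with rfl | ⟨j, rfl⟩
      · simp at hij
      · rw [← Fin.cons_self_tail a] at h ⊢
        generalize a 0 = x, Fin.tail a = b at h ⊢
        rw [cons_comp_swap_succ, invCoord_cons, invCoord_cons,
          ih b i j (by simpa using hij) h, mul_left_comm]
        congr 2
        exact Equiv.prod_comp (Equiv.swap i j) fun l =>
          if b l < x then swapFactor q (b l) x else 1

variable {q} [hq : Fact (0 < q)]

/-- The coordinates of a skew supersymmetric tensor at two rearrangements of the same word are
proportional, with ratio given by `invCoord`. -/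
theorem skew_coord {c : (Fin k → Fin (m + n)) → ℂ} (hc : c ∈ skewTensors m n k q)
    {a b : Fin k → Fin (m + n)} (h : content a = content b) :
    c a * invCoord q b = c b * invCoord q a := by
  have hI : ∀ a : Fin k → Fin (m + n), ((invCoord q a : ℝ) : ℂ) ≠ 0 := fun a => by
    exact_mod_cast invCoord_ne q a
  let d : (Fin k → Fin (m + n)) → ℂ := fun a => c a / invCoord q a
  have hlt : ∀ (a : Fin k → Fin (m + n)) (i j : Fin k), (i : ℕ) + 1 = j → a i < a j →
      d (a ∘ Equiv.swap i j) = d a := by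
    intro a i j hij hl
    have h1 := ((mem_skew.1 hc) a i j hij).2 hl
    have h2 := invCoord_swap q a i j hij hl
    have h3 : ((swapFactor q (a i) (a j) : ℝ) : ℂ) ≠ 0 := by exact_mod_cast swapFactor_ne q _ _
    simp only [d, h1, h2, Complex.ofReal_mul]
    rw [mul_div_mul_left _ _ h3]
  have hsw : ∀ (a : Fin k → Fin (m + n)) (i j : Fin k), (i : ℕ) + 1 = j →
      d (a ∘ Equiv.swap i j) = d a := by
    intro a i j hij
    rcases lt_trichotomy (a i) (a j) with hl | hl | hl
    · exact hlt a i j hij hl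
    · congr 1
      funext l
      simp only [Function.comp_apply]
      rcases eq_or_ne l i with rfl | h1
      · rw [Equiv.swap_apply_left, hl]
      · rcases eq_or_ne l j with rfl | h2
        · rw [Equiv.swap_apply_right, hl]
        · rw [Equiv.swap_apply_of_ne_of_ne h1 h2]
    · have := hlt (a ∘ Equiv.swap i j) i j hij (by simpa using hl)
      rw [← this]
      congr 1
      funext l
      simp
  have hperm : ∀ (σ : Equiv.Perm (Fin k)) (a : Fin k → Fin (m + n)), d (a ∘ σ) = d a := by
    intro σ
    rcases k with _ | k
    · intro a; congr 1; funext i; exact i.elim0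
    have hσ : σ ∈ Submonoid.closure
        (Set.range fun i : Fin k => Equiv.swap i.castSucc i.succ) := by
      rw [Equiv.Perm.mclosure_swap_castSucc_succ]; trivial
    induction hσ using Submonoid.closure_induction with
    | mem x hx =>
      obtain ⟨i, rfl⟩ := hx
      intro a
      exact hsw a _ _ (by simp)
    | one => intro a; rfl
    | mul x y _ _ hx hy =>
      intro a
      rw [Equiv.Perm.coe_mul, ← Function.comp_assoc, hy, hx]
  obtain ⟨σ, rfl⟩ := exists_perm_of_content_eq h
  have := hperm σ a
  simp only [d] at this
  rw [div_eq_div_iff (hI _) (hI _)] at this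
  exact this.symm

theorem skew_ne_of_content {c : (Fin k → Fin (m + n)) → ℂ} (hc : c ∈ skewTensors m n k q)
    {a b : Fin k → Fin (m + n)} (h : content a = content b) (ha : c a ≠ 0) : c b ≠ 0 := by
  have h1 := skew_coord hc h
  intro h2
  rw [h2, zero_mul] at h1
  rcases mul_eq_zero.1 h1 with h3 | h3
  · exact ha h3
  · exact invCoord_ne q b (by exact_mod_cast h3)

/-- A content is admissible when it is a multi-index in `{0,1}^m × ℕ^n`. -/
def Admissible (L : Fin (m + n) → ℕ) : Prop := ∀ a : Fin (m + n), (a : ℕ) < m → L a ≤ 1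

theorem skew_eq_zero {c : (Fin k → Fin (m + n)) → ℂ} (hc : c ∈ skewTensors m n k q)
    {a : Fin k → Fin (m + n)} (h : ¬ Admissible (content a)) : c a = 0 := by
  unfold Admissible at h
  push Not at h
  obtain ⟨x, hx, h1⟩ := h
  have hpx : par x = 0 := by simp [par, hx]
  have h2 : 1 < (Finset.univ.filter fun i => a i = x).card := by
    rw [Finset.card_filter]; exact h1
  obtain ⟨i, hi, j, hj, hij⟩ := Finset.one_lt_card.1 h2
  simp only [Finset.mem_filter, Finset.mem_univ, true_and] at hi hj
  obtain ⟨l, rfl⟩ : ∃ l, k = l + 2 := by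
    refine ⟨k - 2, ?_⟩
    have := i.2; have := j.2
    have : (i : ℕ) ≠ j := fun h => hij (Fin.ext h)
    omega
  -- the permutation sends the first two positions to two occurrences of `x`
  let σ : Equiv.Perm (Fin (l + 2)) := Equiv.swap 0 i * Equiv.swap 1 (Equiv.swap 0 i j)
  have h3 : Equiv.swap 0 i j ≠ 0 := by
    intro h
    have h' := congrArg (Equiv.swap 0 i) h
    rw [Equiv.swap_apply_self, Equiv.swap_apply_left] at h'
    exact hij h'.symm
  have hs0 : σ 0 = i := by
    simp only [σ, Equiv.Perm.mul_apply]
    rw [Equiv.swap_apply_of_ne_of_ne (by simp) h3.symm, Equiv.swap_apply_left]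
  have hs1 : σ 1 = j := by
    simp only [σ, Equiv.Perm.mul_apply]
    rw [Equiv.swap_apply_left, Equiv.swap_apply_self]
  have h4 : c (a ∘ σ) = 0 := by
    refine ((mem_skew.1 hc) (a ∘ σ) 0 1 rfl).1 ?_ ?_
    · simp [hs0, hs1, hi, hj]
    · simp [hs0, hi, hpx]
  by_contra h5
  exact skew_ne_of_content hc (content_comp_perm a σ).symm h5 h4

theorem mem_skew_of_coord {G : (Fin (m + n) → ℕ) → ℂ} (hG : ∀ L, ¬ Admissible L → G L = 0) :
    (fun a : Fin k → Fin (m + n) => G (content a) * (invCoord q a : ℝ)) ∈ skewTensors m n k q := by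
  rw [mem_skew]
  intro a i j hij
  refine ⟨fun h1 h2 => ?_, fun h => ?_⟩
  · rw [hG, zero_mul]
    intro h
    have h3 : ((a i : Fin (m + n)) : ℕ) < m := by
      unfold par at h2; split_ifs at h2 with h; exacts [h, by simp at h2]
    have h4 := h (a i) h3
    have h5 : 1 < (Finset.univ.filter fun l => a l = a i).card :=
      Finset.one_lt_card.2 ⟨i, by simp, j, by simp [h1], fun h => by subst h; omega⟩
    rw [Finset.card_filter] at h5
    exact absurd h4 (not_le.2 h5)
  · simp only [content_comp_perm, invCoord_swap q a i j hij h, Complex.ofReal_mul]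
    ring

/-- The skew supersymmetric tensor supported on the words of content `L`. -/
def skewVec (q : ℝ) (L : Fin (m + n) → ℕ) (a : Fin k → Fin (m + n)) : ℂ :=
  if content a = L then (invCoord q a : ℝ) else 0

theorem skewVec_mem {L : Fin (m + n) → ℕ} (hL : Admissible L) :
    (skewVec q L : (Fin k → Fin (m + n)) → ℂ) ∈ skewTensors m n k q := by
  classical
  have := mem_skew_of_coord (q := q) (k := k) (G := fun M => if M = L then 1 else 0)
    (fun M hM => if_neg fun h : M = L => hM (h ▸ hL))
  convert this using 2 with a
  simp [skewVec]

theorem skewVec_ne {L : Fin (m + n) → ℕ} {a : Fin k → Fin (m + n)} (h : content a = L) :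
    skewVec q L a ≠ 0 := by
  rw [skewVec, if_pos h]
  exact_mod_cast invCoord_ne q a

/-- The squared length of `skewVec q L`. -/
def skewNorm (q : ℝ) (k : ℕ) (L : Fin (m + n) → ℕ) : ℝ :=
  ∑ a : Fin k → Fin (m + n), if content a = L then invCoord q a ^ 2 else 0

theorem skewNorm_pos (a : Fin k → Fin (m + n)) : 0 < skewNorm q k (content a) := by
  have := invCoord_ne q a
  refine Finset.sum_pos' (fun b _ => ?_) ⟨a, Finset.mem_univ _, ?_⟩
  · split_ifs <;> positivity
  · rw [if_pos rfl]; positivity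

open scoped Classical in
/-- The orthogonal projection onto the skew supersymmetric tensors, for the standard bilinear form.
The form is definite on the real tensors `skewVec q L`, which span. -/
def skewProj (m n k : ℕ) (q : ℝ) : Matrix (Fin k → Fin (m + n)) (Fin k → Fin (m + n)) ℂ :=
  Matrix.of fun b a => if content a = content b ∧ Admissible (content b) then
    (invCoord q a : ℂ) * invCoord q b / skewNorm q k (content b) else 0

theorem skewProj_transpose : (skewProj m n k q).transpose = skewProj m n k q := by
  ext a b
  simp only [skewProj, Matrix.transpose_apply, Matrix.of_apply]
  by_cases h : content a = content b
  · rw [h, mul_comm]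
  · rw [if_neg (fun h' => h h'.1), if_neg (fun h' => h h'.1.symm)]

theorem skewProj_mem (u : (Fin k → Fin (m + n)) → ℂ) :
    (skewProj m n k q).mulVec u ∈ skewTensors m n k q := by
  classical
  have := mem_skew_of_coord (q := q) (k := k) (G := fun M => if Admissible M then
    ∑ a : Fin k → Fin (m + n), (if content a = M then
      (invCoord q a : ℂ) / skewNorm q k M * u a else 0) else 0) (fun M hM => if_neg hM)
  convert this using 2 with b
  simp only [Matrix.mulVec, dotProduct, skewProj, Matrix.of_apply]
  by_cases h : Admissible (content b)
  · simp only [h, and_true, if_true, Finset.sum_mul]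
    refine Finset.sum_congr rfl fun a _ => ?_
    split_ifs <;> ring
  · simp [h]

theorem skewProj_apply {c : (Fin k → Fin (m + n)) → ℂ} (hc : c ∈ skewTensors m n k q) :
    (skewProj m n k q).mulVec c = c := by
  classical
  funext b
  by_cases h : Admissible (content b)
  · have hn : ((skewNorm q k (content b) : ℝ) : ℂ) ≠ 0 := by exact_mod_cast (skewNorm_pos b).ne'
    have : ∀ a, (skewProj m n k q) b a * c a = c b / skewNorm q k (content b) *
        ((if content a = content b then invCoord q a ^ 2 else 0 : ℝ) : ℂ) := by
      intro a
      simp only [skewProj, Matrix.of_apply, h, and_true]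
      split_ifs with h1
      · have := skew_coord hc h1
        push_cast
        field_simp
        linear_combination (invCoord q a : ℂ) * this
      · simp
    simp only [Matrix.mulVec, dotProduct, this]
    rw [← Finset.mul_sum, ← Complex.ofReal_sum]
    exact div_mul_cancel₀ _ hn
  · rw [skew_eq_zero hc h]
    simp [Matrix.mulVec, dotProduct, skewProj, h]

theorem dotProduct_skewProj (u : (Fin k → Fin (m + n)) → ℂ) {c : (Fin k → Fin (m + n)) → ℂ}
    (hc : c ∈ skewTensors m n k q) : (skewProj m n k q).mulVec u ⬝ᵥ c = u ⬝ᵥ c := by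
  rw [← skewProj_transpose, Matrix.mulVec_transpose, ← Matrix.dotProduct_mulVec,
    skewProj_apply hc]

/-- The projection of a basis tensor. -/
theorem skewProj_single {a : Fin k → Fin (m + n)} (h : Admissible (content a)) :
    ∃ s : ℂ, s ≠ 0 ∧ (skewProj m n k q).mulVec (Pi.single a 1) = s • skewVec q (content a) := by
  have hn : ((skewNorm q k (content a) : ℝ) : ℂ) ≠ 0 := by exact_mod_cast (skewNorm_pos a).ne'
  have hi : ((invCoord q a : ℝ) : ℂ) ≠ 0 := by exact_mod_cast invCoord_ne q a
  refine ⟨invCoord q a / skewNorm q k (content a), div_ne_zero hi hn, ?_⟩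
  rw [Matrix.mulVec_single_one]
  funext b
  simp only [Matrix.col_apply, skewProj, Matrix.of_apply, Pi.smul_apply, smul_eq_mul, skewVec]
  by_cases h1 : content a = content b
  · rw [← h1]; simp only [h, and_self, if_true]; ring
  · rw [if_neg (fun h' => h1 h'.1), if_neg (Ne.symm h1), mul_zero]

theorem skewProj_single_eq_zero {a : Fin k → Fin (m + n)} (h : ¬ Admissible (content a)) :
    (skewProj m n k q).mulVec (Pi.single a 1) = 0 := by
  rw [Matrix.mulVec_single_one]
  funext b
  simp only [Matrix.col_apply, skewProj, Matrix.of_apply, Pi.zero_apply]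
  exact if_neg fun h' : content a = content b ∧ Admissible (content b) => h (h'.1 ▸ h'.2)

theorem skew_eq_span : skewTensors m n k q =
    Submodule.span ℂ (Set.range fun L : MultiIndex m n k =>
      (skewVec q L.1 : (Fin k → Fin (m + n)) → ℂ)) := by
  apply le_antisymm
  · intro c hc
    rw [← skewProj_apply hc, ← Matrix.mulVecLin_apply, LinearMap.pi_apply_eq_sum_univ]
    refine Submodule.sum_mem _ fun a _ => Submodule.smul_mem _ _ ?_
    have hs : (fun j => if a = j then (1 : ℂ) else 0) = Pi.single a 1 := by
      funext j; simp [Pi.single_apply, eq_comm]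
    rw [hs, Matrix.mulVecLin_apply]
    by_cases h : Admissible (content a)
    · obtain ⟨s, _, h2⟩ := skewProj_single (q := q) h
      rw [h2]
      exact Submodule.smul_mem _ _ (Submodule.subset_span ⟨⟨content a, h, sum_content a⟩, rfl⟩)
    · rw [skewProj_single_eq_zero h]; exact Submodule.zero_mem _
  · rw [Submodule.span_le]
    rintro _ ⟨L, rfl⟩
    exact skewVec_mem L.2.1

theorem linearIndependent_skewVec : LinearIndependent ℂ fun L : MultiIndex m n k =>
    (skewVec q L.1 : (Fin k → Fin (m + n)) → ℂ) := by
  rw [linearIndependent_iff']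
  intro s g hg L hL
  obtain ⟨a, -, ha⟩ := exists_word L.2.2
  have h := congrFun hg a
  rw [Finset.sum_apply, Finset.sum_eq_single L] at h
  · exact (mul_eq_zero.1 h).resolve_right (skewVec_ne ha)
  · intro M _ hM
    simp only [Pi.smul_apply, smul_eq_mul]
    rw [skewVec, if_neg, mul_zero]
    rw [ha]
    exact fun h => hM (Subtype.ext h.symm)
  · exact fun h => absurd hL h

end Coordinates

/-! ### Irreducibility of the skew supersymmetric tensors -/

section Irreducible
variable {m n : ℕ} {q : ℝ} {k : ℕ} [hq : Fact (0 < q)] [hq1 : Fact (q ≠ 1)]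

theorem qa_pow_injective (x : Fin (m + n)) : Function.Injective fun r : ℕ => qa q x ^ r := by
  intro r s h
  have h0 := hq.out
  have hinv : q⁻¹ ≠ 1 := fun h => hq1.out (inv_eq_one.1 h)
  simp only [qa] at h
  split_ifs at h
  · exact pow_right_injective₀ h0 hq1.out (by exact_mod_cast h)
  · exact pow_right_injective₀ (inv_pos.2 h0) hinv (by exact_mod_cast h)

/-- A subspace stable under the `K_x` is stable under every operator that multiplies the
coordinates by a function of the content: the weights separate the contents, as `q` is not a root
of unity. -/
theorem mul_mem_of_K_stable {W : Submodule ℂ ((Fin k → Fin (m + n)) → ℂ)}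
    (hW : ∀ x, ∀ w ∈ W, (fun a => qa q x ^ content a x * w a) ∈ W)
    {g : (Fin k → Fin (m + n)) → ℂ} (hg : ∀ a b, content a = content b → g a = g b)
    {w : (Fin k → Fin (m + n)) → ℂ} (hw : w ∈ W) : (fun a => g a * w a) ∈ W := by
  classical
  let A : Subalgebra ℂ ((Fin k → Fin (m + n)) → ℂ) :=
    { carrier := {g | ∀ w ∈ W, g * w ∈ W}
      mul_mem' := fun {x y} hx hy w hw => by rw [mul_assoc]; exact hx _ (hy _ hw)
      add_mem' := fun {x y} hx hy w hw => by
        rw [add_mul]; exact Submodule.add_mem _ (hx _ hw) (hy _ hw)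
      algebraMap_mem' := fun r w hw => by
        rw [← Algebra.smul_def]; exact Submodule.smul_mem _ _ hw }
  have hsep : ∀ b c : Fin k → Fin (m + n), content c ≠ content b →
      ∃ h ∈ A, (∀ a, content a = content b → h a = 1) ∧ ∀ a, content a = content c → h a = 0 := by
    intro b c hbc
    obtain ⟨x, hx⟩ := Function.ne_iff.1 hbc
    have hd : qa q x ^ content b x - qa q x ^ content c x ≠ 0 :=
      sub_ne_zero.2 fun h => hx (qa_pow_injective x h).symm
    refine ⟨(qa q x ^ content b x - qa q x ^ content c x)⁻¹ •
      ((fun a => qa q x ^ content a x) - algebraMap ℂ _ (qa q x ^ content c x)),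
      A.smul_mem (A.sub_mem (hW x) (A.algebraMap_mem _)) _, fun a ha => ?_, fun a ha => ?_⟩
    · simp only [Pi.smul_apply, Pi.sub_apply, Pi.algebraMap_apply, Algebra.algebraMap_self,
        RingHom.id_apply, ha, smul_eq_mul]
      exact inv_mul_cancel₀ hd
    · simp [ha]
  have hind : ∀ b : Fin k → Fin (m + n),
      (fun a => if content a = content b then (1 : ℂ) else 0) ∈ A := by
    intro b
    choose! h hA h1 h0 using hsep b
    have : (fun a => if content a = content b then (1 : ℂ) else 0) =
        ∏ c, if content c ≠ content b then h c else 1 := by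
      funext a
      rw [Finset.prod_apply]
      split_ifs with hab
      · symm
        refine Finset.prod_eq_one fun c _ => ?_
        split_ifs with hc
        · exact h1 c hc a hab
        · rfl
      · symm
        refine Finset.prod_eq_zero (Finset.mem_univ a) ?_
        rw [if_pos hab]
        exact h0 a hab a rfl
    rw [this]
    refine Subalgebra.prod_mem _ fun c _ => ?_
    split_ifs with hc
    · exact hA c hc
    · exact A.one_mem
  let card : (Fin k → Fin (m + n)) → ℂ := fun b => ∑ a : Fin k → Fin (m + n), if content b = content a then 1 else 0
  have hcard : ∀ b, card b ≠ 0 := by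
    intro b
    simp only [card, Finset.sum_boole]
    rw [Nat.cast_ne_zero]
    exact Finset.card_ne_zero.2 ⟨b, by simp⟩
  have hgA : g ∈ A := by
    have : g = ∑ b, (g b / card b) • fun a => if content a = content b then (1 : ℂ) else 0 := by
      funext a
      rw [Finset.sum_apply]
      have h1 : ∀ b, ((g b / card b) • fun a => if content a = content b then (1 : ℂ) else 0) a =
          g a / card a * if content a = content b then (1 : ℂ) else 0 := by
        intro b
        simp only [Pi.smul_apply, smul_eq_mul]
        split_ifs with h
        · have : card a = card b := by simp only [card, h]
          rw [hg a b h, this]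
        · simp
      rw [Finset.sum_congr rfl fun b _ => h1 b, ← Finset.mul_sum]
      exact (div_mul_cancel₀ _ (hcard a)).symm
    rw [this]
    exact A.sum_mem fun b _ => A.smul_mem (hind b) _
  exact hgA w hw

/-- `F_j` raises the sum of the letters by one. -/
theorem sum_of_F_ne {j : Fin (m + n - 1)} {a b : Fin k → Fin (m + n)}
    (h : tpow q k (gen q (.F j)) a b ≠ 0) : ∑ i, (a i : ℕ) = ∑ i, (b i : ℕ) + 1 := by
  induction a, b using cons_induction with
  | h0 a b => rw [tpow_zero_apply, counit_gen] at h; exact absurd rfl h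
  | hs k x y a b ih =>
    rw [tpow_F_cons] at h
    simp only [Fin.sum_univ_succ, Fin.cons_zero, Fin.cons_succ]
    by_cases h1 : x = hi j ∧ y = lo j ∧ a = b
    · obtain ⟨rfl, rfl, rfl⟩ := h1
      simp only [hi, lo]; omega
    · rw [if_neg h1, zero_add] at h
      split_ifs at h with h2
      · rw [ih (right_ne_zero_of_mul h), h2]; omega
      · exact absurd rfl h

/-- A word of a tensor of the form `F_j c` contains the letter `j + 1`. -/
theorem F_eq_zero {j : Fin (m + n - 1)} {a b : Fin k → Fin (m + n)} (ha : ∀ i, a i ≠ hi j) :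
    tpow q k (gen q (.F j)) a b = 0 := by
  induction a, b using cons_induction with
  | h0 a b => rw [tpow_zero_apply, counit_gen]
  | hs k x y a b ih =>
    have h0 : x ≠ hi j := ha 0
    rw [tpow_F_cons, ih fun i => ha i.succ]
    simp [h0]

theorem F_mulVec_of_ne {j : Fin (m + n - 1)} {a : Fin k → Fin (m + n)} (ha : ∀ i, a i ≠ hi j)
    (c : (Fin k → Fin (m + n)) → ℂ) : (tpow q k (gen q (.F j))).mulVec c a = 0 :=
  Finset.sum_eq_zero fun _ _ => mul_eq_zero_of_left (F_eq_zero ha) _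

/-- Applying `F_j` to a skew supersymmetric tensor, the contributions to a word beginning with its
odd maximal letter `j + 1` have the same sign. -/
theorem F_mulVec_leading {j : Fin (m + n - 1)} (hj : par (hi j) = 1)
    {c : (Fin (k + 1) → Fin (m + n)) → ℂ} (hc : c ∈ skewTensors m n (k + 1) q)
    {a : Fin k → Fin (m + n)} (ha : Antitone a) (hle : ∀ i, a i ≤ hi j) :
    ∃ t : ℝ, 0 < t ∧ (tpow q (k + 1) (gen q (.F j))).mulVec c (Fin.cons (hi j) a) =
      t * c (Fin.cons (lo j) a) := by
  induction k with
  | zero =>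
    refine ⟨1, one_pos, ?_⟩
    rw [F_mulVec_cons, if_pos rfl, F_mulVec_of_ne fun i => i.elim0]
    simp
  | succ k ih =>
    rw [F_mulVec_cons, if_pos rfl]
    by_cases h0 : a 0 = hi j
    · obtain ⟨t, ht, h⟩ := ih (skew_slice hc (hi j)) (a := Fin.tail a)
        (fun i i' hii => ha (Fin.succ_le_succ_iff.2 hii)) (fun i => hle i.succ)
      refine ⟨1 + (q⁻¹) ^ 2 * t, by positivity, ?_⟩
      rw [← Fin.cons_self_tail a, h0, h, (skew_pair hc (lo j) (hi j) _).2 (lo_lt_hi j),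
        swapFactor_cast, wt_hi, qa_of_par, odd_eq, hj]
      have : q ≠ 0 := hq.out.ne'
      rcases zmod2 (par (lo j)) with h' | h' <;>
        simp [h', show (1 : ZMod 2) + 1 = 0 from rfl] <;> ring
    · refine ⟨1, one_pos, ?_⟩
      rw [F_mulVec_of_ne fun i => (lt_of_le_of_lt (ha (Fin.zero_le i))
        (lt_of_le_of_ne (hle 0) h0)).ne]
      simp

/-- The lowest weight tensor `v_N ⊗ ⋯ ⊗ v_N`. -/
def lowVec (hn : 0 < n) (k : ℕ) : (Fin k → Fin (m + n)) → ℂ := Pi.single (fun _ => lastIdx hn) 1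

/-- A skew supersymmetric tensor killed by all `F_j` is supported on the word `N ⋯ N`: otherwise,
if `j` is the largest letter other than `N` of a word in its support, then `F_j` does not kill it. If
`j + 1 < N` this is because the letter `j + 1` does not occur, and if `j + 1 = N` it is
`F_mulVec_leading`. -/
theorem eq_last_of_lowest (hn : 0 < n) {w : (Fin k → Fin (m + n)) → ℂ}
    (hw : w ∈ skewTensors m n k q) (hF : ∀ j, (tpow q k (gen q (.F j))).mulVec w = 0)
    {a : Fin k → Fin (m + n)} (ha : w a ≠ 0) (i : Fin k) : a i = lastIdx hn := by
  by_contra hne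
  have hlt : ∀ x : Fin (m + n), x ≠ lastIdx hn → (x : ℕ) + 1 < m + n := by
    intro x hx
    have h1 : (x : ℕ) ≠ m + n - 1 := fun h => hx (Fin.ext h)
    have := x.2; omega
  -- the largest letter of `a` below the last one
  obtain ⟨i₀, hi₀, hmax⟩ := Finset.exists_max_image (Finset.univ.filter fun i => a i ≠ lastIdx hn)
    (fun i => a i) ⟨i, by simp [hne]⟩
  simp only [Finset.mem_filter, Finset.mem_univ, true_and] at hi₀ hmax
  have hl := hlt _ hi₀
  obtain ⟨j, hj⟩ : ∃ j : Fin (m + n - 1), lo j = a i₀ := ⟨⟨a i₀, by omega⟩, rfl⟩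
  obtain ⟨k, rfl⟩ : ∃ l, k = l + 1 := ⟨k - 1, by have := i.2; omega⟩
  -- rearranging `a` so that it begins with this letter and decreases afterwards
  let b := Fin.tail (a ∘ Equiv.swap 0 i₀)
  let b' : Fin k → Fin (m + n) := b ∘ (Fin.revPerm.trans (Tuple.sort b))
  have hb' : Antitone b' := fun s t hst =>
    Tuple.monotone_sort b (Fin.rev_le_rev.2 hst)
  have hcont : content (Fin.cons (lo j) b' : Fin (k + 1) → Fin (m + n)) = content a := by
    have h1 : content (Fin.cons (lo j) b : Fin (k + 1) → Fin (m + n)) = content a := by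
      have : (Fin.cons (lo j) b : Fin (k + 1) → Fin (m + n)) = a ∘ Equiv.swap 0 i₀ := by
        conv_rhs => rw [← Fin.cons_self_tail (a ∘ Equiv.swap 0 i₀)]
        simp [b, hj]
      rw [this, content_comp_perm]
    rw [← h1]
    funext x
    rw [content_cons, content_cons, content_comp_perm]
  have hne' : w (Fin.cons (lo j) b') ≠ 0 := skew_ne_of_content hw hcont.symm ha
  have hletters : ∀ s, b' s ≠ lastIdx hn → b' s ≤ lo j := by
    intro s hs
    rw [hj]
    exact hmax _ hs
  have hval := congrFun (hF j) (Fin.cons (hi j) b')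
  by_cases hlast : hi j = lastIdx hn
  · have hpar : par (hi j) = 1 := by
      rw [hlast]; unfold par lastIdx; rw [if_neg]; simp only; omega
    obtain ⟨t, ht, h⟩ := F_mulVec_leading hpar hw hb' fun s => by
      by_cases hs : b' s = lastIdx hn
      · rw [hs, hlast]
      · exact (hletters s hs).trans (lo_lt_hi j).le
    rw [h] at hval
    rcases mul_eq_zero.1 hval with h1 | h1
    · exact ht.ne' (by exact_mod_cast h1)
    · exact hne' h1
  · rw [F_mulVec_cons, if_pos rfl, F_mulVec_of_ne] at hval
    · simp only [mul_zero, add_zero] at hval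
      exact hne' hval
    · intro s hs
      by_cases hs' : b' s = lastIdx hn
      · exact hlast (hs ▸ hs')
      · exact absurd (hs ▸ hletters s hs') (lo_lt_hi j).not_ge

/-- A nonzero submodule contains the lowest weight tensor: a weight vector whose words have maximal
letter sum is killed by all `F_j`. -/
theorem lowVec_mem_of_stable (hn : 0 < n) {W : Submodule ℂ ((Fin k → Fin (m + n)) → ℂ)}
    (hle : W ≤ skewTensors m n k q) (hW : ∀ x, ∀ w ∈ W, (tpow q k x).mulVec w ∈ W) (h0 : W ≠ ⊥) :
    lowVec hn k ∈ W := by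
  classical
  have hK : ∀ x, ∀ w ∈ W, (fun a => qa q x ^ content a x * w a) ∈ W := by
    intro x w hw
    have := hW (gen q (.K x)) w hw
    rw [tpow_K] at this
    convert this using 1
    funext a; rw [Matrix.mulVec_diagonal]
  obtain ⟨c, hc, hc0⟩ := (Submodule.ne_bot_iff _).1 h0
  obtain ⟨a₀, ha₀⟩ := Function.ne_iff.1 hc0
  -- a word of maximal letter sum among those with a nonzero coordinate in `W`
  obtain ⟨a, ha, hmax⟩ := Finset.exists_max_image
    (Finset.univ.filter fun a : Fin k → Fin (m + n) => ∃ c ∈ W, c a ≠ 0)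
    (fun a => ∑ i, (a i : ℕ)) ⟨a₀, by simpa using ⟨c, hc, ha₀⟩⟩
  simp only [Finset.mem_filter, Finset.mem_univ, true_and] at ha hmax
  obtain ⟨c', hc', hca⟩ := ha
  let w : (Fin k → Fin (m + n)) → ℂ := fun b => (if content b = content a then 1 else 0) * c' b
  have hw : w ∈ W := mul_mem_of_K_stable hK (fun b d h => by rw [h]) hc'
  have hwa : w a ≠ 0 := by simpa [w] using hca
  have hsum : ∀ b : Fin k → Fin (m + n), content b = content a →
      ∑ i, (b i : ℕ) = ∑ i, (a i : ℕ) := by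
    intro b hb
    obtain ⟨σ, rfl⟩ := exists_perm_of_content_eq hb
    exact (Equiv.sum_comp σ fun i => (b i : ℕ)).symm
  have hF : ∀ j, (tpow q k (gen q (.F j))).mulVec w = 0 := by
    intro j
    by_contra hne
    obtain ⟨b, hb⟩ := Function.ne_iff.1 hne
    obtain ⟨d, -, hd⟩ := Finset.exists_ne_zero_of_sum_ne_zero hb
    have h1 := sum_of_F_ne (left_ne_zero_of_mul hd)
    have h2 := right_ne_zero_of_mul hd
    simp only [w] at h2
    have h3 := hsum d (by by_contra h; simp [h] at h2)
    have h4 := hmax b ⟨_, hW _ _ hw, hb⟩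
    omega
  have hlast := eq_last_of_lowest hn (hle hw) hF hwa
  have hw' : w = w a • lowVec hn k := by
    have haeq : a = fun _ => lastIdx hn := funext hlast
    funext b
    by_cases hb : b = a
    · subst hb; rw [lowVec, ← haeq]; simp
    · have : w b = 0 := by
        by_contra h
        exact hb ((funext fun i => eq_last_of_lowest hn (hle hw) hF h i).trans haeq.symm)
      rw [this, lowVec, ← haeq]; simp [hb]
  rw [hw'] at hw
  exact (Submodule.smul_mem_iff _ hwa).1 hw

/-- The lowest weight tensor generates: the orthogonal complement of a submodule is a submodule,
since the action is closed under transposition, so it would also contain the lowest weight tensor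
if it were nonzero. -/
theorem eq_skew_of_lowVec_mem (hn : 0 < n) {W : Submodule ℂ ((Fin k → Fin (m + n)) → ℂ)}
    (hle : W ≤ skewTensors m n k q) (hW : ∀ x, ∀ w ∈ W, (tpow q k x).mulVec w ∈ W)
    (hv : lowVec hn k ∈ W) : W = skewTensors m n k q := by
  by_contra hne
  obtain ⟨u₀, hu₀, hu₀W⟩ := SetLike.exists_of_lt (lt_of_le_of_ne hle hne)
  obtain ⟨f, hf, hfW⟩ := Submodule.exists_dual_map_eq_bot_of_notMem hu₀W inferInstance
  -- the functional is the pairing with a skew supersymmetric tensor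
  obtain ⟨u, hu, hfu⟩ : ∃ u ∈ skewTensors m n k q, ∀ c ∈ skewTensors m n k q, f c = u ⬝ᵥ c := by
    refine ⟨_, skewProj_mem fun a => f (Pi.single a 1), fun c hc => ?_⟩
    rw [dotProduct_skewProj _ hc, LinearMap.pi_apply_eq_sum_univ f c]
    refine Finset.sum_congr rfl fun a _ => ?_
    have : (fun j => if a = j then (1 : ℂ) else 0) = Pi.single a 1 := by
      funext j; simp [Pi.single_apply, eq_comm]
    rw [this, smul_eq_mul, mul_comm]
  have hfW' : ∀ w ∈ W, f w = 0 := fun w hw => by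
    have : f w ∈ W.map f := Submodule.mem_map_of_mem hw
    rwa [hfW, Submodule.mem_bot] at this
  let W' : Submodule ℂ ((Fin k → Fin (m + n)) → ℂ) :=
    { carrier := {u | u ∈ skewTensors m n k q ∧ ∀ w ∈ W, u ⬝ᵥ w = 0}
      zero_mem' := ⟨Submodule.zero_mem _, fun w _ => zero_dotProduct w⟩
      add_mem' := fun hx hy => ⟨Submodule.add_mem _ hx.1 hy.1, fun w hw => by
        rw [add_dotProduct, hx.2 w hw, hy.2 w hw, add_zero]⟩
      smul_mem' := fun r x hx => ⟨Submodule.smul_mem _ r hx.1, fun w hw => by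
        rw [smul_dotProduct, hx.2 w hw, smul_zero]⟩ }
  have hW' : lowVec hn k ∈ W' := by
    refine lowVec_mem_of_stable (q := q) hn (fun u hu => hu.1) ?_ ?_
    · rintro x u ⟨hu, huW⟩
      refine ⟨skew_stable x hu, fun w hw => ?_⟩
      obtain ⟨y, hy⟩ := exists_transpose (k := k) x
      rw [← Matrix.vecMul_transpose, ← Matrix.dotProduct_mulVec, hy]
      exact huW _ (hW y w hw)
    · refine (Submodule.ne_bot_iff _).2 ⟨u, ⟨hu, fun w hw => ?_⟩, ?_⟩
      · rw [← hfu w (hle hw), hfW' w hw]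
      · rintro rfl
        exact hf (by rw [hfu u₀ hu₀, zero_dotProduct])
  have := hW'.2 _ hv
  simp [lowVec] at this

/-- The skew supersymmetric tensors form an irreducible module. -/
theorem skew_irreducible (hn : 0 < n) {W : Submodule ℂ ((Fin k → Fin (m + n)) → ℂ)}
    (hle : W ≤ skewTensors m n k q) (hW : ∀ x, ∀ w ∈ W, (tpow q k x).mulVec w ∈ W) :
    W = ⊥ ∨ W = skewTensors m n k q :=
  or_iff_not_imp_left.2 fun h =>
    eq_skew_of_lowVec_mem hn hle hW (lowVec_mem_of_stable hn hle hW h)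

theorem lowVec_mem (hn : 0 < n) : lowVec hn k ∈ skewTensors m n k q := by
  have hne : ∀ x y : Fin (m + n), x ≠ y → ∀ a i, a i = x → ∀ j, a j = y →
      lowVec hn k a = 0 := fun x y hxy a i hi j hj => by
    refine Pi.single_eq_of_ne (fun h => hxy ?_) 1
    rw [← hi, ← hj, h]
  rw [mem_skew]
  intro a i j hij
  refine ⟨fun _ h => ?_, fun h => ?_⟩
  · refine Pi.single_eq_of_ne (fun h' => ?_) 1
    rw [h'] at h
    unfold par lastIdx at h
    rw [if_neg (by simp only; omega)] at h
    exact one_ne_zero h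
  · rw [hne _ _ h.ne a i rfl j rfl,
      hne _ _ h.ne (a ∘ Equiv.swap i j) j (by simp) i (by simp), mul_zero]

end Irreducible

/-! ### The square of the antipode -/

section AntipodeSquare
variable {m n : ℕ} {q : ℝ} [hq : Fact (0 < q)] [hq1 : Fact (q ≠ 1)] {k : ℕ}

/-- The factor by which `v_x` is scaled by the diagonal operator implementing the square of the
antipode in the vector representation. -/
def sqLetter (q : ℝ) (x : Fin (m + n)) : ℂ :=
  ∏ b : Fin (m + n - 1), if (x : ℕ) ≤ b then cw q b b else 1

theorem sqLetter_lo (j : Fin (m + n - 1)) : sqLetter q (lo j) = cw q j j * sqLetter q (hi j) := by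
  have h1 : ((lo j : Fin (m + n)) : ℕ) = j := rfl
  have h2 : ((hi j : Fin (m + n)) : ℕ) = j + 1 := rfl
  unfold sqLetter
  rw [h1, h2, ← Finset.mul_prod_erase _ _ (Finset.mem_univ j), if_pos le_rfl]
  congr 1
  rw [← Finset.mul_prod_erase Finset.univ (fun b : Fin (m + n - 1) =>
    if (j : ℕ) + 1 ≤ b then cw q b b else 1) (Finset.mem_univ j), if_neg (by omega), one_mul]
  refine Finset.prod_congr rfl fun b hb => ?_
  have : (b : ℕ) ≠ j := fun h => (Finset.mem_erase.1 hb).1 (Fin.ext h)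
  have h3 : ((j : ℕ) ≤ b) ↔ ((j : ℕ) + 1 ≤ b) := by omega
  simp only [h3]

theorem sqLetter_ne (x : Fin (m + n)) : sqLetter q x ≠ 0 := by
  refine Finset.prod_ne_zero_iff.2 fun b _ => ?_
  split_ifs
  · exact cw_ne _ _
  · exact one_ne_zero

/-- The diagonal entries, on words, of the operator implementing the square of the antipode. -/
def sqVal (q : ℝ) (a : Fin k → Fin (m + n)) : ℂ := ∏ i, sqLetter q (a i)

theorem sqVal_cons (x : Fin (m + n)) (a : Fin k → Fin (m + n)) :
    sqVal q (Fin.cons x a : Fin (k + 1) → Fin (m + n)) = sqLetter q x * sqVal q a := by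
  simp [sqVal, Fin.prod_univ_succ]

theorem sqVal_ne (a : Fin k → Fin (m + n)) : sqVal q a ≠ 0 :=
  Finset.prod_ne_zero_iff.2 fun _ _ => sqLetter_ne _

theorem sqVal_E (j : Fin (m + n - 1)) (a b : Fin k → Fin (m + n)) :
    sqVal q a * tpow q k (gen q (.E j)) a b =
      cw q j j * tpow q k (gen q (.E j)) a b * sqVal q b := by
  induction a, b using cons_induction with
  | h0 a b => rw [tpow_zero_apply, counit_gen]; simp
  | hs k x y a b ih =>
    rw [tpow_E_cons, sqVal_cons, sqVal_cons]
    by_cases h1 : x = lo j ∧ y = hi j ∧ a = b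
    · obtain ⟨rfl, rfl, rfl⟩ := h1
      simp only [and_self, if_true, lo_ne_hi, if_false, sqLetter_lo]
      ring
    · rw [if_neg h1]
      split_ifs with h2
      · subst h2
        linear_combination sgn (odd j * par x) * sqLetter q x * ih
      · simp

theorem sqVal_F (j : Fin (m + n - 1)) (a b : Fin k → Fin (m + n)) :
    cw q j j * (sqVal q a * tpow q k (gen q (.F j)) a b) =
      tpow q k (gen q (.F j)) a b * sqVal q b := by
  have h1 := tpow_F_mul_kapVal (q := q) j a b
  have h2 := sqVal_E (q := q) j b a
  have h3 := kapVal_ne q j b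
  have : (cw q j j * (sqVal q a * tpow q k (gen q (.F j)) a b)) * kapVal q j b =
      (tpow q k (gen q (.F j)) a b * sqVal q b) * kapVal q j b := by
    linear_combination (cw q j j * sqVal q a - sqVal q b) * h1 - qa q (lo j) * h2
  exact mul_right_cancel₀ h3 this

theorem antipode_antipode_mul {i j : ZMod 2} {x y : Uq m n q} (hx : x ∈ homog m n q i)
    (hy : y ∈ homog m n q j) : antipode m n q (antipode m n q (x * y)) =
      antipode m n q (antipode m n q x) * antipode m n q (antipode m n q y) := by
  rw [antipode_mul hx hy, map_smul, antipode_mul (antipode_mem hy) (antipode_mem hx), smul_smul,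
    mul_comm j i, sgn_mul_self, one_smul]

/-- On a tensor power of the vector representation, the square of the antipode is conjugation by a
diagonal operator. -/
theorem antipode_antipode_apply (x : Uq m n q) (a b : Fin k → Fin (m + n)) :
    tpow q k (antipode m n q (antipode m n q x)) a b * sqVal q b = sqVal q a * tpow q k x a b := by
  suffices h : tpow q k (antipode m n q (antipode m n q x)) * Matrix.diagonal (sqVal q) =
      Matrix.diagonal (sqVal q) * tpow q k x by
    simpa [Matrix.mul_diagonal, Matrix.diagonal_mul] using congrFun (congrFun h a) b
  have hself : ∀ x : Uq m n q, (∀ a b : Fin k → Fin (m + n),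
      tpow q k (antipode m n q (antipode m n q x)) a b * sqVal q b = sqVal q a * tpow q k x a b) →
      tpow q k (antipode m n q (antipode m n q x)) * Matrix.diagonal (sqVal q) =
      Matrix.diagonal (sqVal q) * tpow q k x := fun x h => by
    ext a b
    rw [Matrix.mul_diagonal, Matrix.diagonal_mul, h]
  induction x using Uq.induction_homog with
  | add x y hx hy => simp only [map_add, add_mul, mul_add, hx, hy]
  | smul c x hx => simp only [map_smul, smul_mul_assoc, mul_smul_comm, hx]
  | one => simp only [antipode_one, map_one, one_mul, mul_one]
  | mul u i x hxi hx =>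
    rw [antipode_antipode_mul (gen_mem u) hxi, map_mul, map_mul, mul_assoc, hx, ← mul_assoc,
      ← mul_assoc]
    congr 1
    apply hself
    intro a b
    have hc := cw_ne (q := q) (m := m) (n := n)
    cases u with
    | K c =>
      rw [antipode_K, antipode_Kinv, tpow_K, Matrix.diagonal_apply]
      split_ifs with h
      · rw [h, mul_comm]
      · simp
    | Kinv c =>
      rw [antipode_Kinv, antipode_K, tpow_Kinv, Matrix.diagonal_apply]
      split_ifs with h
      · rw [h, mul_comm]
      · simp
    | E j =>
      rw [sqVal_E, antipode_E, map_neg, antipode_mul (gen_mem _) (GRep.kapInv_mem j), antipode_kapInv,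
        antipode_E, mul_zero, sgn_zero, one_smul, mul_neg, neg_neg, ← mul_assoc, isRel_gen.kap_e,
        smul_mul_assoc, mul_assoc, isRel_gen.kap_kapInv, mul_one, map_smul, Matrix.smul_apply,
        smul_eq_mul]
    | F j =>
      have h := isRel_gen (m := m) (n := n) (q := q) |>.kap_f j j
      rw [antipode_F, map_neg, antipode_mul (GRep.kap_mem j) (gen_mem _), antipode_kap,
        antipode_F, zero_mul, sgn_zero, one_smul, neg_mul, neg_neg, h,
        smul_mul_assoc, mul_assoc, isRel_gen.kap_kapInv, mul_one, map_smul, Matrix.smul_apply,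
        smul_eq_mul, mul_assoc, ← sqVal_F, inv_mul_cancel_left₀ (hc j j)]

end AntipodeSquare

/-! ### Matrix elements along the lowest weight tensor -/

section Functionals
variable {m n : ℕ} {q : ℝ} [hq : Fact (0 < q)] [hq1 : Fact (q ≠ 1)] {k : ℕ} (hn : 0 < n)

theorem dual_ext_homog {f g : Module.Dual ℂ (Uq m n q)}
    (h : ∀ j, ∀ y ∈ homog m n q j, f y = g y) : f = g := by
  ext y
  rw [← part_add_part y, map_add, map_add, h 0 _ (part_mem 0 y), h 1 _ (part_mem 1 y)]

/-- The word `N ⋯ N` of length `k`. -/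
def lastWord (hn : 0 < n) (k : ℕ) : Fin k → Fin (m + n) := fun _ => lastIdx hn

theorem lowVec_eq : lowVec (m := m) hn k = Pi.single (lastWord hn k) 1 := rfl

/-- The parity of the basis tensor of a word. -/
def wordPar (a : Fin k → Fin (m + n)) : ZMod 2 := ∑ i, par (a i)

theorem par_last : par (lastIdx hn : Fin (m + n)) = 1 := by
  unfold par lastIdx; rw [if_neg]; simp only; omega

theorem wordPar_last : wordPar (lastWord (m := m) hn k) = k := by
  simp [wordPar, lastWord, par_last]

theorem wordPar_content {a b : Fin k → Fin (m + n)} (h : content a = content b) :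
    wordPar a = wordPar b := by
  obtain ⟨σ, rfl⟩ := exists_perm_of_content_eq h
  exact (Equiv.sum_comp σ fun i => par (a i)).symm

theorem sqVal_content {a b : Fin k → Fin (m + n)} (h : content a = content b) :
    sqVal q a = sqVal q b := by
  obtain ⟨σ, rfl⟩ := exists_perm_of_content_eq h
  exact (Equiv.prod_comp σ fun i => sqLetter q (a i)).symm

theorem tpow_eq_zero {i : ZMod 2} {x : Uq m n q} (hx : x ∈ homog m n q i)
    {a b : Fin k → Fin (m + n)} (h : wordPar a + wordPar b ≠ i) : tpow q k x a b = 0 :=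
  ((vecRep q).pow k).apply_eq_zero hx (by rw [GRep.pow_p, GRep.pow_p]; exact h)

/-- The functional `y ↦ ⟨v_N ⊗ ⋯ ⊗ v_N, S(y) u⟩`. -/
def phiMap (q : ℝ) [Fact (0 < q)] [Fact (q ≠ 1)] (hn : 0 < n) (k : ℕ) :
    ((Fin k → Fin (m + n)) → ℂ) →ₗ[ℂ] Module.Dual ℂ (Uq m n q) :=
  Fintype.linearCombination ℂ fun a =>
    ((vecRep q).pow k).coef (lastWord hn k) a ∘ₗ antipode m n q

/-- The functional `y ↦ ⟨u, y (v_N ⊗ ⋯ ⊗ v_N)⟩`. -/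
def psiMap (q : ℝ) [Fact (0 < q)] [Fact (q ≠ 1)] (hn : 0 < n) (k : ℕ) :
    ((Fin k → Fin (m + n)) → ℂ) →ₗ[ℂ] Module.Dual ℂ (Uq m n q) :=
  Fintype.linearCombination ℂ fun a => ((vecRep q).pow k).coef a (lastWord hn k)

theorem phiMap_apply (u : (Fin k → Fin (m + n)) → ℂ) (y : Uq m n q) :
    phiMap q hn k u y = (tpow q k (antipode m n q y)).mulVec u (lastWord hn k) := by
  simp only [phiMap, Fintype.linearCombination_apply, LinearMap.sum_apply, LinearMap.smul_apply,
    LinearMap.comp_apply, GRep.coef_apply, smul_eq_mul, Matrix.mulVec, dotProduct]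
  exact Finset.sum_congr rfl fun a _ => mul_comm _ _

theorem psiMap_apply (u : (Fin k → Fin (m + n)) → ℂ) (y : Uq m n q) :
    psiMap q hn k u y = Matrix.vecMul u (tpow q k y) (lastWord hn k) := by
  simp only [psiMap, Fintype.linearCombination_apply, LinearMap.sum_apply, LinearMap.smul_apply,
    GRep.coef_apply, smul_eq_mul, Matrix.vecMul, dotProduct]
  rfl

theorem phiMap_single (a : Fin k → Fin (m + n)) : phiMap q hn k (Pi.single a 1) =
    ((vecRep q).pow k).coef (lastWord hn k) a ∘ₗ antipode m n q := by
  simp [phiMap]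

theorem psiMap_single (a : Fin k → Fin (m + n)) :
    psiMap q hn k (Pi.single a 1) = ((vecRep q).pow k).coef a (lastWord hn k) := by
  simp [psiMap]

/-- `phiMap` intertwines the tensor power with the left translations. -/
theorem dot_phiMap (x : Uq m n q) (u : (Fin k → Fin (m + n)) → ℂ) :
    dot m n q x (phiMap q hn k u) = phiMap q hn k ((tpow q k x).mulVec u) := by
  have key : ∀ i, ∀ x ∈ homog m n q i,
      dot m n q x (phiMap q hn k u) = phiMap q hn k ((tpow q k x).mulVec u) := by
    intro i x hx
    refine dual_ext_homog fun j y hy => ?_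
    change dotLin m n q x _ y = _
    rw [dotLin_apply hx hy, phiMap_apply, phiMap_apply, antipode_mul (antipodeInv_mem hx) hy,
      antipode_antipodeInv, map_smul, Matrix.smul_mulVec, Pi.smul_apply, smul_eq_mul, ← mul_assoc,
      sgn_mul_self, one_mul, map_mul, Matrix.mulVec_mulVec]
  rw [← part_add_part x, map_add, map_add, LinearMap.add_apply, Matrix.add_mulVec, map_add,
    key 0 _ (part_mem 0 x), key 1 _ (part_mem 1 x)]

theorem psiMap_vecMul (x y : Uq m n q) (u : (Fin k → Fin (m + n)) → ℂ) :
    psiMap q hn k (Matrix.vecMul u (tpow q k x)) y = psiMap q hn k u (x * y) := by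
  rw [psiMap_apply, psiMap_apply, map_mul, Matrix.vecMul_vecMul]

/-- Left translations on the image of `psiMap`. -/
theorem dot_psiMap {i : ZMod 2} {x : Uq m n q} (hx : x ∈ homog m n q i)
    (u : (Fin k → Fin (m + n)) → ℂ) :
    dot m n q x (psiMap q hn k u) = sgn (i * k) • psiMap q hn k
      (fun a => sgn (i * wordPar a) * Matrix.vecMul u (tpow q k (antipodeInv m n q x)) a) := by
  refine dual_ext_homog fun j y hy => ?_
  change dotLin m n q x _ y = _
  rw [dotLin_apply hx hy, ← psiMap_vecMul, LinearMap.smul_apply, smul_eq_mul, psiMap_apply,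
    psiMap_apply]
  generalize Matrix.vecMul u (tpow q k (antipodeInv m n q x)) = w
  simp only [Matrix.vecMul, dotProduct, Finset.mul_sum]
  refine Finset.sum_congr rfl fun a _ => ?_
  by_cases h : wordPar a + wordPar (lastWord (m := m) hn k) = j
  · rw [wordPar_last] at h
    rw [← h, mul_add, sgn_add]
    ring
  · rw [tpow_eq_zero hy h]; simp

theorem skew_vecMul (x : Uq m n q) {u : (Fin k → Fin (m + n)) → ℂ}
    (hu : u ∈ skewTensors m n k q) : Matrix.vecMul u (tpow q k x) ∈ skewTensors m n k q := by
  obtain ⟨y, hy⟩ := exists_transpose (k := k) x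
  rw [← Matrix.mulVec_transpose, hy]
  exact skew_stable y hu

/-- The lowest weight tensor is skew supersymmetric, so its pairing with `S(y) u` only depends on
the orthogonal projection of `u`. -/
theorem phiMap_skewProj (u : (Fin k → Fin (m + n)) → ℂ) :
    phiMap q hn k ((skewProj m n k q).mulVec u) = phiMap q hn k u := by
  ext y
  rw [phiMap_apply, phiMap_apply]
  have h : ∀ w, (tpow q k (antipode m n q y)).mulVec w (lastWord hn k) =
      w ⬝ᵥ Matrix.vecMul (lowVec hn k) (tpow q k (antipode m n q y)) := fun w => by
    rw [dotProduct_comm, ← Matrix.dotProduct_mulVec, lowVec_eq, single_one_dotProduct]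
  rw [h, h, dotProduct_skewProj _ (skew_vecMul _ (lowVec_mem hn))]

theorem psiMap_skewProj (u : (Fin k → Fin (m + n)) → ℂ) :
    psiMap q hn k ((skewProj m n k q).mulVec u) = psiMap q hn k u := by
  ext y
  rw [psiMap_apply, psiMap_apply]
  have h : ∀ w, Matrix.vecMul w (tpow q k y) (lastWord hn k) =
      w ⬝ᵥ (tpow q k y).mulVec (lowVec hn k) := fun w => by
    rw [Matrix.dotProduct_mulVec, lowVec_eq, dotProduct_single_one]
  rw [h, h, dotProduct_skewProj _ (skew_stable _ (lowVec_mem hn))]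

/-- The tensors in the kernel form a submodule of an irreducible module that does not contain the
lowest weight tensor. -/
theorem phiMap_injOn {u : (Fin k → Fin (m + n)) → ℂ} (hu : u ∈ skewTensors m n k q)
    (h : phiMap q hn k u = 0) : u = 0 := by
  have hirr := skew_irreducible hn (W := skewTensors m n k q ⊓ LinearMap.ker (phiMap q hn k))
    inf_le_left (fun x w hw => ⟨skew_stable x hw.1, by
      refine LinearMap.mem_ker.2 ?_
      rw [← dot_phiMap, LinearMap.mem_ker.1 hw.2, map_zero]⟩)
  rcases hirr with h0 | h0
  · have : u ∈ skewTensors m n k q ⊓ LinearMap.ker (phiMap q hn k) := ⟨hu, h⟩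
    rwa [h0, Submodule.mem_bot] at this
  · have hv := lowVec_mem (m := m) (q := q) (k := k) hn
    rw [← h0] at hv
    have := congrArg (fun f => f 1) (LinearMap.mem_ker.1 hv.2)
    simp [phiMap_apply, antipode_one, lowVec_eq] at this

theorem psiMap_injOn {u : (Fin k → Fin (m + n)) → ℂ} (hu : u ∈ skewTensors m n k q)
    (h : psiMap q hn k u = 0) : u = 0 := by
  have hirr := skew_irreducible hn (W := skewTensors m n k q ⊓ LinearMap.ker (psiMap q hn k))
    inf_le_left (fun x w hw => ⟨skew_stable x hw.1, by
      obtain ⟨y, hy⟩ := exists_transpose (k := k) x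
      rw [← Matrix.vecMul_transpose, hy]
      refine LinearMap.mem_ker.2 ?_
      ext z
      rw [psiMap_vecMul, LinearMap.mem_ker.1 hw.2]; rfl⟩)
  rcases hirr with h0 | h0
  · have : u ∈ skewTensors m n k q ⊓ LinearMap.ker (psiMap q hn k) := ⟨hu, h⟩
    rwa [h0, Submodule.mem_bot] at this
  · have hv := lowVec_mem (m := m) (q := q) (k := k) hn
    rw [← h0] at hv
    have := congrArg (fun f => f 1) (LinearMap.mem_ker.1 hv.2)
    simp [psiMap_apply, lowVec_eq] at this

end Functionals

/-! ### Characters of the parabolic subalgebras -/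

section Characters
variable {m n : ℕ} {q : ℝ} [hq : Fact (0 < q)] [hq1 : Fact (q ≠ 1)] {k : ℕ}

/-- The elements for which the basis covector `v` is an eigenvector. -/
def GRep.rowStab {ι : Type} [Fintype ι] [DecidableEq ι] (R : GRep m n q ι) (v : ι) :
    Subalgebra ℂ (Uq m n q) where
  carrier := {x | ∀ b, b ≠ v → R.ρ x v b = 0}
  mul_mem' := fun {x y} hx hy b hb => by
    rw [map_mul, Matrix.mul_apply]
    refine Finset.sum_eq_zero fun c _ => ?_
    by_cases hc : c = v
    · rw [hc, hy b hb, mul_zero]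
    · rw [hx c hc, zero_mul]
  add_mem' := fun {x y} hx hy b hb => by
    rw [map_add, Matrix.add_apply, hx b hb, hy b hb, add_zero]
  algebraMap_mem' := fun r b hb => by
    rw [AlgHom.commutes, Matrix.algebraMap_matrix_apply, if_neg hb.symm]

/-- The eigenvalue on the basis covector `v`, as a character. -/
def GRep.rowChar {ι : Type} [Fintype ι] [DecidableEq ι] (R : GRep m n q ι) (v : ι)
    {P : Subalgebra ℂ (Uq m n q)} (hP : P ≤ R.rowStab v) : P →ₐ[ℂ] ℂ :=
  AlgHom.ofLinearMap (R.coef v v ∘ₗ P.val.toLinearMap) (by simp) (fun x y => by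
    simp only [LinearMap.comp_apply, AlgHom.toLinearMap_apply, Subalgebra.coe_val, GRep.coef_apply]
    rw [MulMemClass.coe_mul, map_mul, Matrix.mul_apply]
    exact Finset.sum_eq_single v (fun c _ hc => by rw [hP x.2 c hc, zero_mul]) (by simp))

theorem E_eq_zero {j : Fin (m + n - 1)} {a b : Fin k → Fin (m + n)} (ha : ∀ i, a i ≠ lo j) :
    tpow q k (gen q (.E j)) a b = 0 := by
  induction a, b using cons_induction with
  | h0 a b => rw [tpow_zero_apply, counit_gen]
  | hs k x y a b ih =>
    have h0 : x ≠ lo j := ha 0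
    rw [tpow_E_cons, ih fun i => ha i.succ]
    simp [h0]

theorem F_eq_zero_right {j : Fin (m + n - 1)} {a b : Fin k → Fin (m + n)}
    (hb : ∀ i, b i ≠ lo j) : tpow q k (gen q (.F j)) a b = 0 := by
  have h := tpow_F_mul_kapVal (q := q) j a b
  rw [E_eq_zero hb, mul_zero] at h
  exact (mul_eq_zero.1 h).resolve_right (kapVal_ne q j b)

theorem E_eq_zero_right {j : Fin (m + n - 1)} {a b : Fin k → Fin (m + n)}
    (hb : ∀ i, b i ≠ hi j) : tpow q k (gen q (.E j)) a b = 0 := by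
  have h := tpow_F_mul_kapVal (q := q) j b a
  rw [F_eq_zero hb, zero_mul] at h
  exact (mul_eq_zero.1 h.symm).resolve_left (qa_ne _)

theorem lo_ne_last (hn : 0 < n) (j : Fin (m + n - 1)) : lastIdx hn ≠ lo j := by
  have := j.2
  simp only [lastIdx, lo, ne_eq, Fin.ext_iff]; omega

theorem hi_ne_last (hn : 0 < n) {j : Fin (m + n - 1)} (hj : j ∈ theta m n) :
    lastIdx hn ≠ hi j := by
  have h : (j : ℕ) + 2 ≠ m + n := hj
  have := j.2
  simp only [lastIdx, hi, ne_eq, Fin.ext_iff]; omega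

theorem qa_last (hn : 0 < n) : qa q (lastIdx hn : Fin (m + n)) = (q : ℂ)⁻¹ := by
  unfold qa lastIdx; rw [if_neg]; simp only; omega

theorem content_lastWord (hn : 0 < n) (x : Fin (m + n)) :
    content (lastWord hn k) x = if x = lastIdx hn then k else 0 := by
  refine (content_const _ x).trans ?_
  simp only [eq_comm]
  rfl

theorem dual_row_last (hn : 0 < n) (x : Uq m n q) (b : Fin k → Fin (m + n)) :
    ((vecRep q).pow k).dual.ρ x (lastWord hn k) b =
      sgn (wordPar b * (k + wordPar b)) * tpow q k (antipode m n q x) b (lastWord hn k) := by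
  rw [GRep.dual_apply, GRep.pow_p, GRep.pow_p, ← wordPar_last (m := m) hn]
  rfl

theorem pPlus_le (hn : 0 < n) : pPlus m n q ≤ ((vecRep q).pow k).rowStab (lastWord hn k) := by
  refine Algebra.adjoin_le ?_
  rintro _ ⟨u, hu, rfl⟩ b hb
  change tpow q k _ _ _ = 0
  cases u with
  | K a => rw [tpow_K, Matrix.diagonal_apply_ne _ hb.symm]
  | Kinv a => rw [tpow_Kinv, Matrix.diagonal_apply_ne _ hb.symm]
  | E j => exact E_eq_zero fun i => lo_ne_last hn j
  | F j => exact F_eq_zero fun i => hi_ne_last hn hu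

theorem pMinus_le (hn : 0 < n) :
    pMinus m n q ≤ ((vecRep q).pow k).dual.rowStab (lastWord hn k) := by
  refine Algebra.adjoin_le ?_
  rintro _ ⟨u, hu, rfl⟩ b hb
  rw [dual_row_last]
  refine mul_eq_zero_of_right _ ?_
  cases u with
  | K a => rw [antipode_K, tpow_Kinv, Matrix.diagonal_apply_ne _ hb]
  | Kinv a => rw [antipode_Kinv, tpow_K, Matrix.diagonal_apply_ne _ hb]
  | E j =>
    rw [antipode_E, map_neg, map_mul, tpow_kapInv, Matrix.neg_apply, Matrix.mul_diagonal,
      E_eq_zero_right (b := lastWord hn k) fun i => hi_ne_last hn hu, zero_mul, neg_zero]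
  | F j =>
    rw [antipode_F, map_neg, map_mul, tpow_kap, Matrix.neg_apply, Matrix.diagonal_mul,
      F_eq_zero_right (b := lastWord hn k) fun i => lo_ne_last hn j, mul_zero, neg_zero]

/-- The character of `U_q(p_+)` on the covector of `v_N ⊗ ⋯ ⊗ v_N`. -/
def plusChar (q : ℝ) [Fact (0 < q)] [Fact (q ≠ 1)] (hn : 0 < n) (k : ℕ) : pPlus m n q →ₐ[ℂ] ℂ :=
  ((vecRep q).pow k).rowChar (lastWord hn k) (pPlus_le hn)

/-- The character of `U_q(p_-)` on `v_N ⊗ ⋯ ⊗ v_N`, seen in the dual module. -/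
def minusChar (q : ℝ) [Fact (0 < q)] [Fact (q ≠ 1)] (hn : 0 < n) (k : ℕ) : pMinus m n q →ₐ[ℂ] ℂ :=
  ((vecRep q).pow k).dual.rowChar (lastWord hn k) (pMinus_le hn)

theorem plusChar_apply (hn : 0 < n) (p : pPlus m n q) : plusChar q hn k p =
    tpow q k (p : Uq m n q) (lastWord hn k) (lastWord hn k) := rfl

theorem minusChar_apply (hn : 0 < n) (p : pMinus m n q) : minusChar q hn k p =
    tpow q k (antipode m n q (p : Uq m n q)) (lastWord hn k) (lastWord hn k) := by
  refine (dual_row_last hn (p : Uq m n q) (lastWord hn k)).trans ?_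
  rw [wordPar_last, show ((k : ZMod 2) + k) = 0 from CharTwo.add_self_eq_zero _, mul_zero, sgn_zero,
    one_mul]

theorem isPlusChar (hn : 0 < n) : IsPlusChar hn k (plusChar (m := m) q hn k) where
  e j := E_eq_zero fun i => lo_ne_last hn j
  f j hj := F_eq_zero fun i => hi_ne_last hn hj
  k_one a ha := by
    rw [plusChar_apply, tpow_K, Matrix.diagonal_apply_eq, content_lastWord, if_neg ha, pow_zero]
  k_last := by
    rw [plusChar_apply, tpow_K, Matrix.diagonal_apply_eq, content_lastWord, if_pos rfl, qa_last,
      inv_pow]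

theorem isMinusChar (hn : 0 < n) : IsMinusChar hn k (minusChar (m := m) q hn k) where
  e j hj := by
    rw [minusChar_apply, antipode_E, map_neg, map_mul, tpow_kapInv, Matrix.neg_apply,
      Matrix.mul_diagonal, E_eq_zero_right (b := lastWord hn k) fun i => hi_ne_last hn hj, zero_mul, neg_zero]
  f j := by
    rw [minusChar_apply, antipode_F, map_neg, map_mul, tpow_kap, Matrix.neg_apply,
      Matrix.diagonal_mul, F_eq_zero_right (b := lastWord hn k) fun i => lo_ne_last hn j, mul_zero, neg_zero]
  k_one a ha := by
    rw [minusChar_apply, antipode_K, tpow_Kinv, Matrix.diagonal_apply_eq, content_lastWord,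
      if_neg ha, pow_zero, inv_one]
  k_last := by
    rw [minusChar_apply, antipode_K, tpow_Kinv, Matrix.diagonal_apply_eq, content_lastWord,
      if_pos rfl, qa_last, inv_pow, inv_inv]

/-- A character of a parabolic subalgebra is determined by its values on the `K_a`, `E_b`, `F_b`. -/
theorem char_ext {A B : Set (Fin (m + n - 1))} {φ φ' : parabolic q A B →ₐ[ℂ] ℂ}
    (hK : ∀ a, φ ⟨gen q (.K a), gen_mem_parabolic q trivial⟩ =
      φ' ⟨gen q (.K a), gen_mem_parabolic q trivial⟩)
    (hE : ∀ b (hb : b ∈ A), φ ⟨gen q (.E b), gen_mem_parabolic q hb⟩ =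
      φ' ⟨gen q (.E b), gen_mem_parabolic q hb⟩)
    (hF : ∀ b (hb : b ∈ B), φ ⟨gen q (.F b), gen_mem_parabolic q hb⟩ =
      φ' ⟨gen q (.F b), gen_mem_parabolic q hb⟩) : φ = φ' := by
  refine AlgHom.adjoin_ext ?_
  rintro _ ⟨u, hu, rfl⟩
  cases u with
  | K a => exact hK a
  | Kinv a =>
    have h : ∀ χ : parabolic q A B →ₐ[ℂ] ℂ,
        χ ⟨gen q (.K a), gen_mem_parabolic q trivial⟩ *
          χ ⟨gen q (.Kinv a), gen_mem_parabolic q trivial⟩ = 1 := fun χ => by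
      rw [← map_mul, ← map_one χ]
      exact congrArg χ (Subtype.ext (isRel_gen.k_ki a))
    have h1 := h φ
    have h2 := h φ'
    rw [hK] at h1
    exact mul_left_cancel₀ (left_ne_zero_of_mul_eq_one h1) (h1.trans h2.symm)
  | E b => exact hE b hu
  | F b => exact hF b hu

theorem IsPlusChar.eq_plusChar {hn : 0 < n} {φ : pPlus m n q →ₐ[ℂ] ℂ} (h : IsPlusChar hn k φ) :
    φ = plusChar q hn k := by
  have h' := isPlusChar (m := m) (q := q) (k := k) hn
  refine char_ext (fun a => ?_) (fun b _ => (h.e b).trans (h'.e b).symm)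
    fun b hb => (h.f b hb).trans (h'.f b hb).symm
  by_cases ha : a = lastIdx hn
  · rw [ha]; exact h.k_last.trans h'.k_last.symm
  · exact (h.k_one a ha).trans (h'.k_one a ha).symm

theorem IsMinusChar.eq_minusChar {hn : 0 < n} {ψ : pMinus m n q →ₐ[ℂ] ℂ}
    (h : IsMinusChar hn k ψ) : ψ = minusChar q hn k := by
  have h' := isMinusChar (m := m) (q := q) (k := k) hn
  refine char_ext (fun a => ?_) (fun b hb => (h.e b hb).trans (h'.e b hb).symm)
    fun b _ => (h.f b).trans (h'.f b).symm
  by_cases ha : a = lastIdx hn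
  · rw [ha]; exact h.k_last.trans h'.k_last.symm
  · exact (h.k_one a ha).trans (h'.k_one a ha).symm

theorem minusChar_antipode (hn : 0 < n) (p : pMinus m n q) :
    minusChar q hn k (antipodeP _ _ p) =
      tpow q k (p : Uq m n q) (lastWord hn k) (lastWord hn k) := by
  refine (minusChar_apply hn _).trans ?_
  have h := antipode_antipode_apply (q := q) (k := k) (p : Uq m n q) (lastWord hn k) (lastWord hn k)
  rw [mul_comm (sqVal q _)] at h
  exact mul_right_cancel₀ (sqVal_ne _) h

end Characters

/-! ### The induced modules -/

section Induced
variable {m n : ℕ} {q : ℝ} [hq : Fact (0 < q)] [hq1 : Fact (q ≠ 1)] {k : ℕ}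

/-- The map `f ↦ v ⊗ f`. -/
def oneTensor (m n : ℕ) (q : ℝ) : Module.Dual ℂ (Uq m n q) ≃ₗ[ℂ] VDual m n q :=
  (TensorProduct.lid ℂ _).symm

theorem circV_oneTensor (x : Uq m n q) (f : Module.Dual ℂ (Uq m n q)) :
    circV m n q x (oneTensor m n q f) = oneTensor m n q (circ m n q x f) := rfl

theorem oneTensor_mem_vTensor {G : Submodule ℂ (Module.Dual ℂ (Uq m n q))}
    {f : Module.Dual ℂ (Uq m n q)} : oneTensor m n q f ∈ vTensor G ↔ f ∈ G := by
  constructor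
  · rintro ⟨t, ht⟩
    have h : ∀ t : ℂ ⊗[ℂ] G, (oneTensor m n q).symm (G.subtype.lTensor ℂ t) ∈ G := by
      intro t
      induction t using TensorProduct.induction_on with
      | zero => simp
      | tmul c g =>
        have : (oneTensor m n q).symm (G.subtype.lTensor ℂ (c ⊗ₜ g)) = c • (g : _) := rfl
        rw [this]; exact G.smul_mem _ g.2
      | add s t hs ht => rw [map_add, map_add]; exact G.add_mem hs ht
    have := h t
    rwa [ht, LinearEquiv.symm_apply_apply] at this
  · exact fun h => ⟨1 ⊗ₜ ⟨f, h⟩, rfl⟩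

theorem oneTensor_mem_induced {A B : Set (Fin (m + n - 1))} {φ : parabolic q A B →ₐ[ℂ] ℂ}
    {G : Submodule ℂ (Module.Dual ℂ (Uq m n q))} {f : Module.Dual ℂ (Uq m n q)} :
    oneTensor m n q f ∈ induced φ G ↔
      f ∈ G ∧ ∀ p : parabolic q A B, circ m n q p f = φ (antipodeP A B p) • f := by
  change (_ ∈ vTensor G ∧ _) ↔ _
  rw [oneTensor_mem_vTensor]
  simp only [circV_oneTensor, ← map_smul, (oneTensor m n q).injective.eq_iff]

/-- In the span of joint eigenvectors, a joint eigenvector is spanned by those of its own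
eigenvalues. -/
theorem mem_span_of_eigen {M X I : Type*} [AddCommGroup M] [Module ℂ M] [Finite X]
    (T : X → Module.End ℂ M) {s : I → M} {μ : I → X → ℂ} (hs : ∀ i x, T x (s i) = μ i x • s i)
    {f : M} (hf : f ∈ Submodule.span ℂ (Set.range s)) {l : X → ℂ} (hl : ∀ x, T x f = l x • f) :
    f ∈ Submodule.span ℂ (s '' {i | ∀ x, μ i x = l x}) := by
  have _ := Fintype.ofFinite X
  classical
  suffices h : ∀ F : Finset X, f ∈ Submodule.span ℂ (s '' {i | ∀ x ∈ F, μ i x = l x}) by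
    simpa using h Finset.univ
  intro F
  induction F using Finset.induction_on with
  | empty => simpa using hf
  | insert x F _ ih =>
    have hle : s '' {i | ∀ y ∈ F, μ i y = l y} ⊆
        s '' {i | ∀ y ∈ insert x F, μ i y = l y} ∪ s '' {i | μ i x ≠ l x} := by
      rintro _ ⟨i, h, rfl⟩
      by_cases h1 : μ i x = l x
      · exact Or.inl ⟨i, fun y hy => (Finset.mem_insert.1 hy).elim (fun e => e ▸ h1) (h y), rfl⟩
      · exact Or.inr ⟨i, h1, rfl⟩
    have h12 := Submodule.span_mono hle ih
    rw [Submodule.span_union] at h12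
    obtain ⟨f₁, hf₁, f₂, hf₂, hff⟩ := Submodule.mem_sup.1 h12
    have hle₁ : Submodule.span ℂ (s '' {i | ∀ y ∈ insert x F, μ i y = l y}) ≤
        (T x).eigenspace (l x) := by
      rw [Submodule.span_le]
      rintro _ ⟨i, hi, rfl⟩
      exact Module.End.mem_eigenspace_iff.2 (by rw [hs, hi x (Finset.mem_insert_self _ _)])
    have hle₂ : Submodule.span ℂ (s '' {i | μ i x ≠ l x}) ≤
        ⨆ (c : ℂ) (_ : c ≠ l x), (T x).eigenspace c := by
      rw [Submodule.span_le]
      rintro _ ⟨i, hi, rfl⟩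
      exact Submodule.mem_iSup_of_mem (μ i x) (Submodule.mem_iSup_of_mem hi
        (Module.End.mem_eigenspace_iff.2 (hs i x)))
    have he₂ : f₂ ∈ (T x).eigenspace (l x) := by
      have h := Submodule.sub_mem _ (Module.End.mem_eigenspace_iff.2 (hl x)) (hle₁ hf₁)
      rwa [← hff, add_sub_cancel_left] at h
    have h0 : f₂ = 0 := Submodule.disjoint_def.1
      ((Module.End.eigenspaces_iSupIndep (T x)) (l x)) f₂ he₂ (hle₂ hf₂)
    rw [← hff, h0, add_zero]
    exact hf₁

theorem circ_coef {ι : Type} [Fintype ι] [DecidableEq ι] (R : GRep m n q ι) {x : Uq m n q}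
    {d : ι → ℂ} (hx : R.ρ x = Matrix.diagonal d) (a b : ι) :
    circ m n q x (R.coef a b) = d b • R.coef a b := by
  ext y
  rw [circ_apply, GRep.coef_apply, map_mul, hx, Matrix.mul_diagonal, mul_comm]
  rfl

theorem eq_of_content_eq (hn : 0 < n) {l : ℕ} {b : Fin l → Fin (m + n)}
    (h : ∀ x, content b x = if x = lastIdx hn then k else 0) :
    l = k ∧ b = lastWord hn l := by
  refine ⟨?_, eq_const_of_content fun y hy => (h y).trans (if_neg hy)⟩
  rw [← sum_content b]
  simp [h]

/-- A functional in the span of the matrix elements of the tensor powers of `R` on which the `K_x`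
act by the weights of the word `N ⋯ N` of length `k` is a combination of matrix elements of the
`k`-th power in the column of that word. -/
theorem mem_span_column (hn : 0 < n) (R : GRep m n q (Fin (m + n))) (g : Fin (m + n) → ℕ → ℂ)
    (hg : ∀ x, Function.Injective (g x))
    (hR : ∀ l x, (R.pow l).ρ (gen q (.K x)) = Matrix.diagonal fun b => g x (content b x))
    {f : Module.Dual ℂ (Uq m n q)} (hf : f ∈ genAlg R.coef)
    (hK : ∀ x, circ m n q (gen q (.K x)) f = g x (content (lastWord hn k) x) • f) :
    f ∈ Submodule.span ℂ (Set.range fun a => (R.pow k).coef a (lastWord hn k)) := by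
  have hf' := genAlg_le q R hf
  let s : (Σ l : ℕ, (Fin l → Fin (m + n)) × (Fin l → Fin (m + n))) → Module.Dual ℂ (Uq m n q) :=
    fun i => (R.pow i.1).coef i.2.1 i.2.2
  have hS : f ∈ Submodule.span ℂ (Set.range s) := by
    refine (Submodule.span_mono ?_) hf'
    rintro _ ⟨l, a, b, rfl⟩
    exact ⟨⟨l, a, b⟩, rfl⟩
  have h := mem_span_of_eigen (fun x => circ m n q (gen q (.K x)))
    (μ := fun i x => g x (content i.2.2 x)) (fun i x => circ_coef _ (hR i.1 x) _ _) hS hK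
  refine (Submodule.span_mono ?_) h
  rintro _ ⟨⟨l, a, b⟩, hl, rfl⟩
  obtain ⟨rfl, rfl⟩ := eq_of_content_eq (k := k) (b := b) hn fun x => by
    rw [hg x (hl x), content_lastWord]
  exact ⟨a, rfl⟩

theorem tpow_K_pow (l : ℕ) (x : Fin (m + n)) : ((vecRep q).pow l).ρ (gen q (.K x)) =
    Matrix.diagonal fun b => qa q x ^ content b x := tpow_K x

theorem dual_tpow_K (l : ℕ) (x : Fin (m + n)) : ((vecRep q).dual.pow l).ρ (gen q (.K x)) =
    Matrix.diagonal fun b => (qa q x ^ content b x)⁻¹ := by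
  ext a b
  have h := (vecRep q).dual_pow (gen q (.K x)) (a ∘ Fin.rev) (b ∘ Fin.rev)
  have hr : ∀ a : Fin l → Fin (m + n), (a ∘ Fin.rev) ∘ Fin.rev = a := fun a => by
    funext i; simp
  have hc : ∀ a : Fin l → Fin (m + n), content (a ∘ Fin.rev) = content a := fun a =>
    content_comp_perm a Fin.revPerm
  rw [hr, hr, GRep.dual_K] at h
  rw [← h]
  change tpow q l _ _ _ = _
  rw [tpow_Kinv, Matrix.diagonal_apply, Matrix.diagonal_apply]
  have : b ∘ Fin.rev = a ∘ Fin.rev ↔ a = b :=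
    ⟨fun h => by rw [← hr a, ← h, hr], fun h => by rw [h]⟩
  simp only [this, hc]
  split_ifs with hab
  · rw [hab]
  · rfl

/-- Matrix elements of the dual in the column `N ⋯ N` are values of `phiMap`. -/
theorem dual_coef_last (hn : 0 < n) (a : Fin k → Fin (m + n)) : ∃ s : ℂ, s ≠ 0 ∧
    ((vecRep q).dual.pow k).coef a (lastWord hn k) =
      s • phiMap q hn k (Pi.single (a ∘ Fin.rev) 1) := by
  refine ⟨_, sgn_ne_zero (((vecRep q).pow k).p (lastWord (m := m) hn k) *
    (((vecRep q).pow k).p (a ∘ Fin.rev) + ((vecRep q).pow k).p (lastWord (m := m) hn k))), ?_⟩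
  ext y
  have h := (vecRep q).dual_pow y (a ∘ Fin.rev) (lastWord hn k)
  have hr : (a ∘ Fin.rev) ∘ Fin.rev = a := by funext i; simp
  rw [hr] at h
  rw [GRep.coef_apply]
  refine h.symm.trans ?_
  rw [phiMap_single, GRep.dual_apply]
  rfl

theorem genAlg_tBar : genAlg (tBarEl (m := m) (n := n) q) = genAlg (vecRep q).dual.coef := by
  congr 1; funext a b; exact tBarEl_eq q a b

/-- The values of `phiMap` are eigenvectors of the right translations by `U_q(p_+)`. -/
theorem circ_phiMap (hn : 0 < n) {p : Uq m n q} (hp : p ∈ pPlus m n q)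
    (u : (Fin k → Fin (m + n)) → ℂ) : circ m n q p (phiMap q hn k u) =
      tpow q k (antipode m n q p) (lastWord hn k) (lastWord hn k) • phiMap q hn k u := by
  have key : ∀ i, ∀ p ∈ pPlus m n q, p ∈ homog m n q i → circ m n q p (phiMap q hn k u) =
      tpow q k (antipode m n q p) (lastWord hn k) (lastWord hn k) • phiMap q hn k u := by
    intro i p hp hpi
    refine dual_ext_homog fun j y hy => ?_
    have h1 : ∀ w : (Fin k → Fin (m + n)) → ℂ,
        (tpow q k (antipode m n q p)).mulVec w (lastWord hn k) =
          tpow q k (antipode m n q p) (lastWord hn k) (lastWord hn k) * w (lastWord hn k) := fun w =>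
      Finset.sum_eq_single (lastWord hn k) (fun b _ hb =>
        mul_eq_zero_of_left (pPlus_le hn (antipode_mem_parabolic hp) b hb) _) (by simp)
    rw [circ_apply, phiMap_apply, antipode_mul hy hpi, map_smul, map_mul, Matrix.smul_mulVec,
      Pi.smul_apply, ← Matrix.mulVec_mulVec, LinearMap.smul_apply, phiMap_apply, h1]
    rcases zmod2 i with rfl | rfl
    · simp
    · rw [tpow_eq_zero (antipode_mem hpi) (by rw [CharTwo.add_self_eq_zero]; exact zero_ne_one)]
      simp
  have h := congrArg₂ (· + ·) (key 0 _ (part_mem_parabolic hp 0) (part_mem 0 p))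
    (key 1 _ (part_mem_parabolic hp 1) (part_mem 1 p))
  rwa [← LinearMap.add_apply, ← map_add, part_add_part, ← add_smul, ← Matrix.add_apply, ← map_add,
    ← map_add, part_add_part] at h

/-- The values of `psiMap` are eigenvectors of the right translations by `U_q(p_-)`. -/
theorem circ_psiMap (hn : 0 < n) {p : Uq m n q} (hp : p ∈ pMinus m n q)
    (u : (Fin k → Fin (m + n)) → ℂ) : circ m n q p (psiMap q hn k u) =
      tpow q k p (lastWord hn k) (lastWord hn k) • psiMap q hn k u := by
  ext y
  rw [circ_apply, psiMap_apply, map_mul, ← Matrix.vecMul_vecMul, LinearMap.smul_apply,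
    psiMap_apply, smul_eq_mul, mul_comm]
  refine Finset.sum_eq_single (lastWord hn k) (fun b _ hb => mul_eq_zero_of_right _ ?_) (by simp)
  have h1 := pMinus_le (k := k) hn (antipode_mem_parabolic hp) b hb
  rw [dual_row_last] at h1
  have h2 := (mul_eq_zero.1 h1).resolve_left (sgn_ne_zero _)
  have h3 := antipode_antipode_apply p b (lastWord (m := m) hn k)
  rw [h2, zero_mul] at h3
  exact (mul_eq_zero.1 h3.symm).resolve_left (sqVal_ne _)

theorem mem_induced_plus (hn : 0 < n) {f : Module.Dual ℂ (Uq m n q)} :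
    oneTensor m n q f ∈ induced (plusChar q hn k) (genAlg (tBarEl (m := m) (n := n) q)) ↔
      ∃ u ∈ skewTensors m n k q, phiMap q hn k u = f := by
  refine oneTensor_mem_induced.trans ?_
  rw [genAlg_tBar]
  constructor
  · rintro ⟨hf, h⟩
    have h1 := mem_span_column hn (vecRep q).dual (fun x r => (qa q x ^ r)⁻¹)
      (fun x r s h => qa_pow_injective x (inv_injective h)) dual_tpow_K (k := k) hf (fun x => by
        refine (h ⟨gen q (.K x), gen_mem_parabolic q trivial⟩).trans ?_
        congr 1
        refine (plusChar_apply hn _).trans ?_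
        change tpow q k (antipode m n q (gen q (.K x))) _ _ = _
        rw [antipode_K, tpow_Kinv, Matrix.diagonal_apply_eq])
    have h2 : Submodule.span ℂ (Set.range fun a =>
        ((vecRep q).dual.pow k).coef a (lastWord (m := m) hn k)) ≤
        (skewTensors m n k q).map (phiMap q hn k) := by
      rw [Submodule.span_le]
      rintro _ ⟨a, rfl⟩
      obtain ⟨s, -, hs⟩ := dual_coef_last (q := q) hn a
      simp only [SetLike.mem_coe]
      rw [hs, ← phiMap_skewProj]
      exact Submodule.smul_mem _ _ (Submodule.mem_map_of_mem (skewProj_mem _))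
    exact h2 h1
  · rintro ⟨u, -, rfl⟩
    refine ⟨?_, fun p => ?_⟩
    · have hsum : phiMap q hn k u = ∑ a, u a • phiMap q hn k (Pi.single a 1) := by
        simp [phiMap, Fintype.linearCombination_apply]
      rw [hsum]
      refine Submodule.sum_mem _ fun a _ => Submodule.smul_mem _ _ ?_
      obtain ⟨s, hs, h⟩ := dual_coef_last (q := q) hn (a ∘ Fin.rev)
      have hr : (a ∘ Fin.rev) ∘ Fin.rev = a := by funext i; simp
      rw [hr] at h
      have := pow_coef_mem_genAlg q (vecRep q).dual (a ∘ Fin.rev) (lastWord hn k)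
      rw [h] at this
      exact (Submodule.smul_mem_iff _ hs).1 this
    · exact circ_phiMap hn p.2 u

theorem mem_induced_minus (hn : 0 < n) {f : Module.Dual ℂ (Uq m n q)} :
    oneTensor m n q f ∈ induced (minusChar q hn k) (genAlg (tEl (m := m) (n := n) q)) ↔
      ∃ u ∈ skewTensors m n k q, psiMap q hn k u = f := by
  refine oneTensor_mem_induced.trans ?_
  have htEl : genAlg (tEl (m := m) (n := n) q) = genAlg (vecRep q).coef := rfl
  rw [htEl]
  constructor
  · rintro ⟨hf, h⟩
    have h1 := mem_span_column hn (vecRep q) (fun x r => qa q x ^ r)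
      (fun x => qa_pow_injective x) tpow_K_pow (k := k) hf (fun x => by
        refine (h ⟨gen q (.K x), gen_mem_parabolic q trivial⟩).trans ?_
        congr 1
        refine (minusChar_antipode hn ⟨gen q (.K x), gen_mem_parabolic q trivial⟩).trans ?_
        rw [tpow_K, Matrix.diagonal_apply_eq])
    have h2 : Submodule.span ℂ (Set.range fun a =>
        ((vecRep q).pow k).coef a (lastWord (m := m) hn k)) ≤
        (skewTensors m n k q).map (psiMap q hn k) := by
      rw [Submodule.span_le]
      rintro _ ⟨a, rfl⟩
      simp only [SetLike.mem_coe]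
      rw [← psiMap_single, ← psiMap_skewProj]
      exact Submodule.mem_map_of_mem (skewProj_mem _)
    exact h2 h1
  · rintro ⟨u, -, rfl⟩
    refine ⟨?_, fun p => ?_⟩
    · have hsum : psiMap q hn k u = ∑ a, u a • psiMap q hn k (Pi.single a 1) := by
        simp [psiMap, Fintype.linearCombination_apply]
      rw [hsum]
      refine Submodule.sum_mem _ fun a _ => Submodule.smul_mem _ _ ?_
      rw [psiMap_single]
      exact pow_coef_mem_genAlg q _ _ _
    · exact (circ_psiMap hn p.2 u).trans
        (congrArg (fun c : ℂ => c • psiMap q hn k u) (minusChar_antipode hn p).symm)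

end Induced

/-! ### Bases of monomials -/

section Bases
variable {m n : ℕ} {q : ℝ} [hq : Fact (0 < q)] [hq1 : Fact (q ≠ 1)] {k : ℕ}

/-- The embedding of the tensors into `V_+ ⊗ U_q^*`. -/
def phiV (q : ℝ) [Fact (0 < q)] [Fact (q ≠ 1)] (hn : 0 < n) (k : ℕ) :
    ((Fin k → Fin (m + n)) → ℂ) →ₗ[ℂ] VDual m n q :=
  (oneTensor m n q).toLinearMap ∘ₗ phiMap q hn k

/-- The embedding of the tensors into `V_- ⊗ U_q^*`. -/
def psiV (q : ℝ) [Fact (0 < q)] [Fact (q ≠ 1)] (hn : 0 < n) (k : ℕ) :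
    ((Fin k → Fin (m + n)) → ℂ) →ₗ[ℂ] VDual m n q :=
  (oneTensor m n q).toLinearMap ∘ₗ psiMap q hn k

theorem phiV_injOn (hn : 0 < n) {u : (Fin k → Fin (m + n)) → ℂ} (hu : u ∈ skewTensors m n k q)
    (h : phiV q hn k u = 0) : u = 0 :=
  phiMap_injOn hn hu ((oneTensor m n q).map_eq_zero_iff.1 h)

theorem psiV_injOn (hn : 0 < n) {u : (Fin k → Fin (m + n)) → ℂ} (hu : u ∈ skewTensors m n k q)
    (h : psiV q hn k u = 0) : u = 0 :=
  psiMap_injOn hn hu ((oneTensor m n q).map_eq_zero_iff.1 h)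

/-- The module induced from `V_+` is the image of the skew supersymmetric tensors. -/
theorem induced_plus (hn : 0 < n) :
    induced (plusChar q hn k) (genAlg (tBarEl (m := m) (n := n) q)) =
      (skewTensors m n k q).map (phiV q hn k) := by
  ext ζ
  obtain ⟨f, rfl⟩ := (oneTensor m n q).surjective ζ
  refine (mem_induced_plus hn).trans ⟨?_, ?_⟩
  · rintro ⟨u, hu, rfl⟩; exact ⟨u, hu, rfl⟩
  · rintro ⟨u, hu, h⟩; exact ⟨u, hu, (oneTensor m n q).injective h⟩

/-- The module induced from `V_-` is the image of the skew supersymmetric tensors. -/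
theorem induced_minus (hn : 0 < n) :
    induced (minusChar q hn k) (genAlg (tEl (m := m) (n := n) q)) =
      (skewTensors m n k q).map (psiV q hn k) := by
  ext ζ
  obtain ⟨f, rfl⟩ := (oneTensor m n q).surjective ζ
  refine (mem_induced_minus hn).trans ⟨?_, ?_⟩
  · rintro ⟨u, hu, rfl⟩; exact ⟨u, hu, rfl⟩
  · rintro ⟨u, hu, h⟩; exact ⟨u, hu, (oneTensor m n q).injective h⟩

/-- A map injective on the skew supersymmetric tensors carries the tensors `skewVec q L`, up to
scalars, to a basis of the image. -/
theorem basis_image {M : Type*} [AddCommGroup M] [Module ℂ M]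
    {F : ((Fin k → Fin (m + n)) → ℂ) →ₗ[ℂ] M} (hF : ∀ u ∈ skewTensors m n k q, F u = 0 → u = 0)
    {z : MultiIndex m n k → M} (hz : ∀ L, ∃ s : ℂ, s ≠ 0 ∧ z L = s • F (skewVec q L.1)) :
    LinearIndependent ℂ z ∧ (skewTensors m n k q).map F = Submodule.span ℂ (Set.range z) := by
  choose s hs hzs using hz
  have h1 : LinearIndependent ℂ fun L : MultiIndex m n k => F (skewVec q L.1) := by
    refine (linearIndependent_skewVec (q := q)).map ?_
    rw [← skew_eq_span, Submodule.disjoint_def]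
    exact fun u hu h => hF u hu h
  have h2 : z = (fun L => Units.mk0 (s L) (hs L)) • fun L => F (skewVec q L.1) := by
    funext L; exact hzs L
  refine ⟨by rw [h2]; exact h1.units_smul _, ?_⟩
  rw [skew_eq_span, Submodule.map_span, ← Set.range_comp]
  apply le_antisymm <;> rw [Submodule.span_le] <;> rintro _ ⟨L, rfl⟩
  · have h3 : z L ∈ Submodule.span ℂ (Set.range z) := Submodule.subset_span ⟨L, rfl⟩
    rw [hzs] at h3
    exact (Submodule.smul_mem_iff _ (hs L)).1 h3
  · simp only [SetLike.mem_coe]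
    rw [hzs]
    exact Submodule.smul_mem _ _ (Submodule.subset_span ⟨L, rfl⟩)

theorem zBarMon_eq (hn : 0 < n) (L : MultiIndex m n k) : ∃ s : ℂ, s ≠ 0 ∧
    ((1 : ℂ) ⊗ₜ[ℂ] zBarMon q hn L.1 : VDual m n q) = s • phiV q hn k (skewVec q L.1) := by
  obtain ⟨a, ha, hc⟩ := exists_word L.2.2
  obtain ⟨s, hs, h⟩ := monomial_eq q (vecRep q).dual (lastIdx hn) ha
  obtain ⟨s', hs', h'⟩ := dual_coef_last (q := q) hn a
  have hc' : content (a ∘ Fin.rev) = L.1 := (content_comp_perm a Fin.revPerm).trans hc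
  obtain ⟨s'', hs'', h''⟩ := skewProj_single (q := q) (a := a ∘ Fin.rev) (by rw [hc']; exact L.2.1)
  refine ⟨s * (s' * s''), mul_ne_zero hs (mul_ne_zero hs' hs''), ?_⟩
  have hz : zBarMon q hn L.1 = (s * (s' * s'')) • phiMap q hn k (skewVec q L.1) := by
    rw [zBarMon]
    simp only [tBarEl_eq]
    rw [h]
    change s • ((vecRep q).dual.pow k).coef a (lastWord hn k) = _
    rw [h', ← phiMap_skewProj, h'', hc', map_smul, smul_smul, smul_smul, mul_assoc]
  rw [hz, TensorProduct.tmul_smul]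
  rfl

theorem zMon_eq (hn : 0 < n) (L : MultiIndex m n k) : ∃ s : ℂ, s ≠ 0 ∧
    ((1 : ℂ) ⊗ₜ[ℂ] zMon q hn L.1 : VDual m n q) = s • psiV q hn k (skewVec q L.1) := by
  obtain ⟨a, ha, hc⟩ := exists_word L.2.2
  obtain ⟨s, hs, h⟩ := monomial_eq q (vecRep q) (lastIdx hn) ha
  obtain ⟨s'', hs'', h''⟩ := skewProj_single (q := q) (a := a) (by rw [hc]; exact L.2.1)
  refine ⟨s * s'', mul_ne_zero hs hs'', ?_⟩
  have hz : zMon q hn L.1 = (s * s'') • psiMap q hn k (skewVec q L.1) := by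
    rw [zMon]
    simp only [tEl_eq]
    rw [h]
    change s • ((vecRep q).pow k).coef a (lastWord hn k) = _
    rw [← psiMap_single, ← psiMap_skewProj, h'', hc, map_smul, smul_smul]
  rw [hz, TensorProduct.tmul_smul]
  rfl

end Bases

/-! ### Irreducibility and highest weights -/

section HighestWeight
variable {m n : ℕ} {q : ℝ} [hq : Fact (0 < q)] [hq1 : Fact (q ≠ 1)] {k : ℕ}

/-- The content of the highest weight tensor. -/
def skewIndex (m n k : ℕ) (a : Fin (m + n)) : ℕ :=
  if k ≤ m then (if (a : ℕ) < k then 1 else 0)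
  else if (a : ℕ) < m then 1 else if (a : ℕ) = m then k - m else 0

theorem skewWeight_eq (a : Fin (m + n)) : skewWeight m n k a = (skewIndex m n k a : ℤ) := by
  unfold skewWeight skewIndex
  split_ifs <;> first | rfl | omega

theorem skewIndex_admissible : Admissible (skewIndex m n k) := by
  intro a ha
  unfold skewIndex
  split_ifs <;> omega

theorem sum_skewIndex (hn : 0 < n) : ∑ a, skewIndex m n k a = k := by
  rw [Fin.sum_univ_add]
  unfold skewIndex
  obtain ⟨n, rfl⟩ : ∃ l, n = l + 1 := ⟨n - 1, by omega⟩
  by_cases h : k ≤ m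
  · have h2 : ∀ i : Fin (n + 1), ¬ (m + (i : ℕ) < k) := fun i => by omega
    simp only [h, if_true, Fin.val_castAdd, Fin.val_natAdd, h2, if_false, Finset.sum_const_zero,
      add_zero]
    rw [Fin.sum_univ_eq_sum_range (fun i => if i < k then 1 else 0) m, ← Finset.card_filter]
    have : (Finset.range m).filter (fun i => i < k) = Finset.range k := by
      ext i; simp only [Finset.mem_filter, Finset.mem_range]; omega
    rw [this, Finset.card_range]
  · have h1 : ∀ i : Fin m, (i : ℕ) < m := fun i => i.2
    have h2 : ∀ i : Fin (n + 1), ¬ (m + (i : ℕ) < m) := fun i => by omega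
    simp only [h, if_false, Fin.val_castAdd, Fin.val_natAdd, h1, if_true, h2]
    rw [Fin.sum_univ_succ]
    simp
    omega

/-- `E_j` turns one letter `j + 1` into `j`. -/
theorem content_of_E_ne {j : Fin (m + n - 1)} {a b : Fin k → Fin (m + n)}
    (h : tpow q k (gen q (.E j)) a b ≠ 0) (x : Fin (m + n)) :
    content a x + (if hi j = x then 1 else 0) = content b x + if lo j = x then 1 else 0 := by
  induction a, b using cons_induction with
  | h0 a b => rw [tpow_zero_apply, counit_gen] at h; exact absurd rfl h
  | hs k y z a b ih =>
    rw [tpow_E_cons] at h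
    rw [content_cons, content_cons]
    by_cases h1 : y = lo j ∧ z = hi j ∧ a = b
    · obtain ⟨rfl, rfl, rfl⟩ := h1
      omega
    · rw [if_neg h1, zero_add] at h
      split_ifs at h with h2
      · have := ih (right_ne_zero_of_mul h)
        rw [h2]; omega
      · exact absurd rfl h

theorem E_skewIndex (j : Fin (m + n - 1)) :
    (tpow q k (gen q (.E j))).mulVec (skewVec q (skewIndex m n k)) = 0 := by
  by_contra hne
  obtain ⟨a, ha⟩ := Function.ne_iff.1 hne
  have hmem := skew_stable (gen q (.E j)) (skewVec_mem (q := q) (k := k)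
    (skewIndex_admissible (m := m) (n := n) (k := k)))
  have hadm : Admissible (content a) := by
    by_contra h
    exact ha (skew_eq_zero hmem h)
  obtain ⟨b, -, hb⟩ := Finset.exists_ne_zero_of_sum_ne_zero ha
  have h1 := content_of_E_ne (left_ne_zero_of_mul hb)
  have h2 : content b = skewIndex m n k := by
    by_contra h
    exact right_ne_zero_of_mul hb (if_neg h)
  rw [h2] at h1
  have hlo := h1 (lo j)
  have hhi := h1 (hi j)
  rw [if_neg (lo_ne_hi j).symm, if_pos rfl] at hlo
  rw [if_pos rfl, if_neg (lo_ne_hi j)] at hhi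
  have h3 : (lo j : ℕ) < m → content a (lo j) ≤ 1 := hadm (lo j)
  unfold skewIndex at hlo hhi
  have h4 : ((lo j : Fin (m + n)) : ℕ) = j := rfl
  have h5 : ((hi j : Fin (m + n)) : ℕ) = j + 1 := rfl
  rw [h4] at hlo h3
  rw [h5] at hhi
  split_ifs at hlo hhi <;> omega

theorem dotV_phiV (hn : 0 < n) (x : Uq m n q) (u : (Fin k → Fin (m + n)) → ℂ) :
    dotV m n q x (phiV q hn k u) = phiV q hn k ((tpow q k x).mulVec u) :=
  congrArg (oneTensor m n q) (dot_phiMap hn x u)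

theorem dotV_psiV (hn : 0 < n) {i : ZMod 2} {x : Uq m n q} (hx : x ∈ homog m n q i)
    (u : (Fin k → Fin (m + n)) → ℂ) :
    dotV m n q x (psiV q hn k u) = psiV q hn k (sgn (i * k) • fun a =>
      sgn (i * wordPar a) * Matrix.vecMul u (tpow q k (antipodeInv m n q x)) a) := by
  rw [map_smul]
  exact (congrArg (oneTensor m n q) (dot_psiMap hn hx u)).trans (map_smul _ _ _)

theorem irrep_plus (hn : 0 < n) : IsIrrepOfHighestWeight (dotV m n q)
    ((skewTensors m n k q).map (phiV q hn k)) (skewWeight m n k) where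
  stable := by
    rintro x _ ⟨u, hu, rfl⟩
    rw [dotV_phiV]
    exact Submodule.mem_map_of_mem (skew_stable x hu)
  ne_bot := by
    refine (Submodule.ne_bot_iff _).2 ⟨_, Submodule.mem_map_of_mem (lowVec_mem hn), fun h => ?_⟩
    have := phiV_injOn hn (lowVec_mem hn) h
    simp [lowVec] at this
  irreducible U hU hst := by
    have hirr := skew_irreducible (q := q) hn (W := skewTensors m n k q ⊓ U.comap (phiV q hn k))
      inf_le_left (fun x w hw => ⟨skew_stable x hw.1, by
        change phiV q hn k _ ∈ U
        rw [← dotV_phiV]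
        exact hst x _ hw.2⟩)
    rcases hirr with h | h
    · left
      rw [eq_bot_iff]
      intro ζ hζ
      obtain ⟨u, hu, rfl⟩ := hU hζ
      have : u ∈ skewTensors m n k q ⊓ U.comap (phiV q hn k) := ⟨hu, hζ⟩
      rw [h, Submodule.mem_bot] at this
      rw [this, map_zero]; exact Submodule.zero_mem _
    · right
      refine le_antisymm hU ?_
      rintro _ ⟨u, hu, rfl⟩
      rw [SetLike.mem_coe, ← h] at hu
      exact hu.2
  highest := by
    have hadm : Admissible (skewIndex m n k) := skewIndex_admissible
    refine ⟨phiV q hn k (skewVec q (skewIndex m n k)),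
      Submodule.mem_map_of_mem (skewVec_mem hadm), fun h => ?_, fun b => ?_, fun a => ?_⟩
    · obtain ⟨a, -, ha⟩ := exists_word (sum_skewIndex (m := m) (k := k) hn)
      have := congrFun (phiV_injOn hn (skewVec_mem hadm) h) a
      exact skewVec_ne ha this
    · rw [dotV_phiV, E_skewIndex, map_zero]
    · rw [dotV_phiV, ← map_smul]
      congr 1
      funext b
      rw [tpow_K, Matrix.mulVec_diagonal, Pi.smul_apply, smul_eq_mul, skewWeight_eq, zpow_natCast]
      unfold skewVec
      split_ifs with h
      · rw [h]
      · simp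

theorem sgn_wordPar_mem (i : ZMod 2) {u : (Fin k → Fin (m + n)) → ℂ}
    (hu : u ∈ skewTensors m n k q) : (fun a => sgn (i * wordPar a) * u a) ∈ skewTensors m n k q :=
  skew_mul (fun a σ => by rw [wordPar_content (content_comp_perm a σ)]) hu

theorem antipodeInv_K (a : Fin (m + n)) :
    antipodeInv m n q (gen q (.K a)) = gen q (.Kinv a) := by
  rw [← antipode_Kinv, antipodeInv_antipode]

theorem antipodeInv_E (j : Fin (m + n - 1)) :
    antipodeInv m n q (gen q (.E j)) = -(kapInv (gen q) j * gen q (.E j)) := by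
  have h : antipode m n q (kapInv (gen q) j * gen q (.E j)) = -gen q (.E j) := by
    rw [antipode_mul (GRep.kapInv_mem j) (gen_mem _), zero_mul, sgn_zero, one_smul, antipode_E,
      antipode_kapInv, neg_mul, mul_assoc, isRel_gen.kapInv_kap, mul_one]
  rw [← neg_neg (gen q (.E j)), ← h, map_neg, antipodeInv_antipode, h, neg_neg]

theorem vecMul_lowVec (hn : 0 < n) (A : Matrix (Fin k → Fin (m + n)) (Fin k → Fin (m + n)) ℂ) :
    Matrix.vecMul (lowVec hn k) A = A (lastWord hn k) := by
  rw [lowVec_eq, Matrix.single_one_vecMul]; rfl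

theorem irrep_minus (hn : 0 < n) : IsIrrepOfHighestWeight (dotV m n q)
    ((skewTensors m n k q).map (psiV q hn k)) (dualWeight k hn) where
  stable := by
    rintro x _ ⟨u, hu, rfl⟩
    have key : ∀ i, ∀ x ∈ homog m n q i,
        dotV m n q x (psiV q hn k u) ∈ (skewTensors m n k q).map (psiV q hn k) := by
      intro i x hx
      rw [dotV_psiV hn hx]
      exact Submodule.mem_map_of_mem (Submodule.smul_mem _ _ (sgn_wordPar_mem i (skew_vecMul _ hu)))
    rw [← part_add_part x, map_add, LinearMap.add_apply]
    exact Submodule.add_mem _ (key 0 _ (part_mem 0 x)) (key 1 _ (part_mem 1 x))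
  ne_bot := by
    refine (Submodule.ne_bot_iff _).2 ⟨_, Submodule.mem_map_of_mem (lowVec_mem hn), fun h => ?_⟩
    have := psiV_injOn hn (lowVec_mem hn) h
    simp [lowVec] at this
  irreducible U hU hst := by
    let W : Submodule ℂ ((Fin k → Fin (m + n)) → ℂ) :=
      skewTensors m n k q ⊓ U.comap (psiV q hn k)
    have hdot : ∀ i, ∀ y ∈ homog m n q i, ∀ w ∈ W,
        (fun a => sgn (i * wordPar a) * Matrix.vecMul w (tpow q k y) a) ∈ W := by
      intro i y hy w hw
      refine ⟨sgn_wordPar_mem i (skew_vecMul y hw.1), ?_⟩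
      have h := hst (antipode m n q y) _ hw.2
      rw [dotV_psiV hn (antipode_mem hy), antipodeInv_antipode, map_smul] at h
      exact (Submodule.smul_mem_iff U (sgn_ne_zero _)).1 h
    -- the weights separate the parities, so the signs may be removed
    have hK : ∀ x, ∀ w ∈ W, (fun a => qa q x ^ content a x * w a) ∈ W := by
      intro x w hw
      have h := hdot 0 (gen q (.K x)) (gen_mem (.K x)) w hw
      convert h using 1
      funext a
      rw [zero_mul, sgn_zero, one_mul, tpow_K, Matrix.vecMul_diagonal, mul_comm]
    have hvec : ∀ y, ∀ w ∈ W, Matrix.vecMul w (tpow q k y) ∈ W := by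
      intro y w hw
      have key : ∀ i, ∀ y ∈ homog m n q i, Matrix.vecMul w (tpow q k y) ∈ W := by
        intro i y hy
        have h := mul_mem_of_K_stable hK (g := fun a => sgn (i * wordPar a))
          (fun a b h => by rw [wordPar_content h]) (hdot i y hy w hw)
        convert h using 1
        funext a
        rw [← mul_assoc, sgn_mul_self, one_mul]
      rw [← part_add_part y, map_add, Matrix.vecMul_add]
      exact Submodule.add_mem _ (key 0 _ (part_mem 0 y)) (key 1 _ (part_mem 1 y))
    have hirr := skew_irreducible (q := q) hn (W := W) inf_le_left (fun x w hw => by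
      obtain ⟨y, hy⟩ := exists_transpose (k := k) x
      rw [← Matrix.vecMul_transpose, hy]
      exact hvec y w hw)
    rcases hirr with h | h
    · left
      rw [eq_bot_iff]
      intro ζ hζ
      obtain ⟨u, hu, rfl⟩ := hU hζ
      have : u ∈ W := ⟨hu, hζ⟩
      rw [h, Submodule.mem_bot] at this
      rw [this, map_zero]; exact Submodule.zero_mem _
    · right
      refine le_antisymm hU ?_
      rintro _ ⟨u, hu, rfl⟩
      rw [SetLike.mem_coe, ← h] at hu
      exact hu.2
  highest := by
    refine ⟨psiV q hn k (lowVec hn k), Submodule.mem_map_of_mem (lowVec_mem hn), fun h => ?_,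
      fun b => ?_, fun a => ?_⟩
    · have := psiV_injOn hn (lowVec_mem hn) h
      simp [lowVec] at this
    · rw [dotV_psiV hn (gen_mem _), antipodeInv_E, vecMul_lowVec, map_neg, map_mul, tpow_kapInv]
      have h : ∀ c, (-(Matrix.diagonal (fun a => (kapVal q b a)⁻¹) * tpow q k (gen q (.E b))) :
          Matrix (Fin k → Fin (m + n)) (Fin k → Fin (m + n)) ℂ) (lastWord hn k) c = 0 := fun c => by
        rw [Matrix.neg_apply, Matrix.diagonal_mul,
          E_eq_zero (a := lastWord hn k) fun i => lo_ne_last hn b, mul_zero, neg_zero]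
      simp only [h, mul_zero]
      have h0 : (fun _ : Fin k → Fin (m + n) => (0 : ℂ)) = 0 := rfl
      rw [h0, smul_zero, map_zero]
    · rw [dotV_psiV hn (gen_mem (.K a)), antipodeInv_K, ← map_smul]
      congr 1
      funext b
      rw [tpow_Kinv, Pi.smul_apply, Pi.smul_apply, Matrix.vecMul_diagonal]
      simp only [gpar, zero_mul, sgn_zero, one_mul, one_smul, smul_eq_mul]
      by_cases hb : b = lastWord hn k
      · subst hb
        rw [content_lastWord, dualWeight, mul_comm]
        split_ifs <;> simp
      · have : lowVec hn k b = 0 := Pi.single_eq_of_ne hb 1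
        rw [this]; simp

end HighestWeight

/-! ### The isomorphism with the skew tensors and the duality -/

section Duality
variable {m n : ℕ} {q : ℝ} [hq : Fact (0 < q)] [hq1 : Fact (q ≠ 1)] {k : ℕ}

/-- A linear map injective on a subspace is an equivalence onto the image of the subspace. -/
theorem exists_equiv_map {M V : Type*} [AddCommGroup M] [Module ℂ M] [AddCommGroup V] [Module ℂ V]
    {S : Submodule ℂ M} {F : M →ₗ[ℂ] V} (hF : ∀ u ∈ S, F u = 0 → u = 0) :
    ∃ T : S ≃ₗ[ℂ] S.map F, ∀ u : S, (T u : V) = F u := by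
  have hinj : Function.Injective (F.submoduleMap S) := by
    rw [← LinearMap.ker_eq_bot, LinearMap.ker_eq_bot']
    intro u hu
    exact Subtype.ext (hF u u.2 (congrArg Subtype.val hu))
  exact ⟨LinearEquiv.ofBijective _ ⟨hinj, LinearMap.submoduleMap_surjective F S⟩, fun u => rfl⟩

theorem exists_skew_equiv (hn : 0 < n) :
    ∃ T : (skewTensors m n k q).map (phiV q hn k) ≃ₗ[ℂ] skewTensors m n k q,
      ∀ (x : Uq m n q) (ζ ζ' : (skewTensors m n k q).map (phiV q hn k)),
        (ζ' : VDual m n q) = dotV m n q x ζ →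
          (T ζ' : (Fin k → Fin (m + n)) → ℂ) = tensorAct q k x (T ζ) := by
  obtain ⟨Φ, hΦ⟩ := exists_equiv_map (S := skewTensors m n k q) (F := phiV q hn k)
    fun u hu => phiV_injOn hn hu
  refine ⟨Φ.symm, fun x ζ ζ' h => ?_⟩
  rw [tensorAct_eq]
  change _ = (tpow q k x).mulVec _
  have h1 : Φ ⟨_, skew_stable x (Φ.symm ζ).2⟩ = ζ' := by
    refine Subtype.ext ?_
    rw [hΦ, h, ← dotV_phiV, ← hΦ, Φ.apply_symm_apply]
  rw [← h1, Φ.symm_apply_apply]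

/-- The diagonal weights of the pairing between the two induced modules. -/
def pairVal (q : ℝ) (a : Fin k → Fin (m + n)) : ℂ := (sqVal q a)⁻¹ * sgn (wordPar a)

/-- The pairing `⟨u, K⁻¹ P t⟩` on skew supersymmetric tensors, where `K` implements the square of
the antipode and `P` is the parity. -/
def skewPairing (m n k : ℕ) (q : ℝ) [Fact (0 < q)] [Fact (q ≠ 1)] :
    skewTensors m n k q →ₗ[ℂ] Module.Dual ℂ (skewTensors m n k q) :=
  LinearMap.mk₂ ℂ (fun u t => ∑ a, u.1 a * (pairVal q a * t.1 a))
    (fun u u' t => by simp [add_mul, Finset.sum_add_distrib])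
    (fun c u t => by simp [Finset.mul_sum, mul_assoc])
    (fun u t t' => by simp [mul_add, Finset.sum_add_distrib])
    (fun c u t => by
      simp only [Submodule.coe_smul, Pi.smul_apply, smul_eq_mul, Finset.mul_sum]
      exact Finset.sum_congr rfl fun a _ => by ring)

theorem skewPairing_apply (u t : skewTensors m n k q) :
    skewPairing m n k q u t = ∑ a, u.1 a * (pairVal q a * t.1 a) := rfl

theorem skewPairing_injective : Function.Injective (skewPairing m n k q) := by
  rw [← LinearMap.ker_eq_bot, LinearMap.ker_eq_bot']
  intro u hu
  refine Subtype.ext (funext fun b => ?_)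
  -- pairing with the projection of a basis tensor, rescaled by the weights
  have hmem : (fun a => (pairVal q a)⁻¹ * (skewProj m n k q).mulVec (Pi.single b 1) a) ∈
      skewTensors m n k q :=
    skew_mul (fun a σ => by
      rw [pairVal, pairVal, sqVal_content (content_comp_perm a σ),
        wordPar_content (content_comp_perm a σ)]) (skewProj_mem _)
  have h := congrArg (fun f => f ⟨_, hmem⟩) hu
  simp only [skewPairing_apply, LinearMap.zero_apply] at h
  have h1 : ∀ a : Fin k → Fin (m + n), pairVal q a ≠ 0 := fun a =>
    mul_ne_zero (inv_ne_zero (sqVal_ne a)) (sgn_ne_zero _)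
  simp only [mul_inv_cancel_left₀ (h1 _)] at h
  have h2 : (skewProj m n k q).mulVec (Pi.single b 1) ⬝ᵥ u.1 = 0 := by
    rw [dotProduct_comm]; exact h
  rw [dotProduct_skewProj _ u.2, single_one_dotProduct] at h2
  exact h2

theorem phiMap_parity (hn : 0 < n) (t : (Fin k → Fin (m + n)) → ℂ) :
    phiMap q hn k t ∘ₗ (parity m n q).toLinearMap =
      phiMap q hn k (fun a => sgn (k + wordPar a) * t a) := by
  ext y
  rw [LinearMap.comp_apply, AlgHom.toLinearMap_apply, phiMap_apply, phiMap_apply, antipode_parity]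
  refine Finset.sum_congr rfl fun a _ => ?_
  have h := ((vecRep q).pow k).parity_apply (antipode m n q y) (lastWord hn k) a
  rw [GRep.pow_p, GRep.pow_p] at h
  have h2 : tpow q k (parity m n q (antipode m n q y)) (lastWord hn k) a =
      sgn (k + wordPar a) * tpow q k (antipode m n q y) (lastWord hn k) a := by
    rw [← wordPar_last (m := m) hn]; exact h
  refine (congrArg (· * t a) h2).trans ?_
  ring

/-- The pairing is compatible with the actions of an element and of its antipode. -/
theorem skewPairing_adjoint {i j : ZMod 2} {x : Uq m n q} (hx : x ∈ homog m n q i)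
    (u : (Fin k → Fin (m + n)) → ℂ) {t : (Fin k → Fin (m + n)) → ℂ}
    (ht : ∀ a, sgn (k + wordPar a) * t a = sgn j * t a) :
    ∑ a, sgn (i * k) * (sgn (i * wordPar a) *
        Matrix.vecMul u (tpow q k (antipodeInv m n q x)) a) * (pairVal q a * t a) =
      sgn (i * (i + j)) *
        ∑ b, u b * (pairVal q b * (tpow q k (antipode m n q x)).mulVec t b) := by
  simp only [Matrix.vecMul, Matrix.mulVec, dotProduct, Finset.mul_sum, Finset.sum_mul]
  rw [Finset.sum_comm]
  refine Finset.sum_congr rfl fun b _ => Finset.sum_congr rfl fun a _ => ?_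
  have h1 := antipode_antipode_apply (q := q) (antipodeInv m n q x) b a
  rw [antipode_antipodeInv] at h1
  have ha := sqVal_ne (q := q) a
  have hb := sqVal_ne (q := q) b
  have h2 : tpow q k (antipodeInv m n q x) b a =
      (sqVal q b)⁻¹ * (tpow q k (antipode m n q x) b a * sqVal q a) := by
    rw [h1, inv_mul_cancel_left₀ hb]
  by_cases hp : wordPar b + wordPar a = i
  · by_cases htj : (k : ZMod 2) + wordPar a = j
    · have hs : sgn (i * k) * sgn (i * wordPar a) * sgn (wordPar a) =
          sgn (i * (i + j)) * sgn (wordPar b) := by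
        rw [← sgn_add, ← sgn_add, ← sgn_add]
        congr 1
        rw [← htj, ← hp]
        generalize (k : ZMod 2) = c
        generalize wordPar a = d
        generalize wordPar b = e
        revert c d e; decide
      change sgn (i * k) * (sgn (i * wordPar a) * (u b * tpow q k (antipodeInv m n q x) b a)) *
        (pairVal q a * t a) = sgn (i * (i + j)) *
          (u b * (pairVal q b * (tpow q k (antipode m n q x) b a * t a)))
      rw [h2, pairVal, pairVal]
      field_simp
      linear_combination (u b * tpow q k (antipode m n q x) b a * t a) * hs
    · have ht0 : t a = 0 := by
        have h := ht a
        rcases zmod2 ((k : ZMod 2) + wordPar a) with h' | h' <;>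
          rcases zmod2 j with rfl | rfl <;> simp [h'] at h htj
        · simpa using (by linear_combination h / 2 : t a = 0)
        · simpa using (by linear_combination -h / 2 : t a = 0)
      simp [ht0]
  · have h0 := tpow_eq_zero (antipode_mem hx) hp
    rw [h0, zero_mul, mul_zero] at h2
    change sgn (i * k) * (sgn (i * wordPar a) * (u b * tpow q k (antipodeInv m n q x) b a)) *
        (pairVal q a * t a) = sgn (i * (i + j)) *
          (u b * (pairVal q b * (tpow q k (antipode m n q x) b a * t a)))
    rw [h0, h2]; simp

/-- An injective map from a finite-dimensional space to its dual is an equivalence, and is carried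
along equivalences of the two factors. -/
theorem exists_equiv_dual_of_injective {S A C : Type*} [AddCommGroup S] [Module ℂ S]
    [AddCommGroup A] [Module ℂ A] [AddCommGroup C] [Module ℂ C] [FiniteDimensional ℂ S]
    {f : S →ₗ[ℂ] Module.Dual ℂ S} (hf : Function.Injective f) (Ψ : S ≃ₗ[ℂ] A) (Φ : S ≃ₗ[ℂ] C) :
    ∃ D : A ≃ₗ[ℂ] Module.Dual ℂ C, ∀ u t, D (Ψ u) (Φ t) = f u t := by
  refine ⟨Ψ.symm ≪≫ₗ LinearEquiv.ofInjectiveOfFinrankEq f hf Subspace.dual_finrank_eq.symm ≪≫ₗ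
    Φ.symm.dualMap, fun u t => ?_⟩
  simp only [LinearEquiv.trans_apply, LinearEquiv.symm_apply_apply, LinearEquiv.dualMap_apply]
  rfl

theorem exists_dual_equiv (hn : 0 < n) :
    ∃ D : (skewTensors m n k q).map (psiV q hn k) ≃ₗ[ℂ]
        Module.Dual ℂ ((skewTensors m n k q).map (phiV q hn k)),
      ∀ (i j : ZMod 2), ∀ x ∈ homog m n q i,
        ∀ (ζ ζ' : (skewTensors m n k q).map (psiV q hn k))
          (w w' : (skewTensors m n k q).map (phiV q hn k)),
          (ζ' : VDual m n q) = dotV m n q x ζ →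
            parityV m n q w = sgn j • (w : VDual m n q) →
            (w' : VDual m n q) = dotV m n q (antipode m n q x) w →
              D ζ' w = sgn (i * (i + j)) * D ζ w' := by
  obtain ⟨Φ, hΦ⟩ := exists_equiv_map (S := skewTensors m n k q) (F := phiV q hn k)
    fun u hu => phiV_injOn hn hu
  obtain ⟨Ψ, hΨ⟩ := exists_equiv_map (S := skewTensors m n k q) (F := psiV q hn k)
    fun u hu => psiV_injOn hn hu
  obtain ⟨D, hD⟩ := exists_equiv_dual_of_injective skewPairing_injective Ψ Φ
  refine ⟨D, fun i j x hx ζ ζ' w w' hζ hw hw' => ?_⟩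
  obtain ⟨u, rfl⟩ := Ψ.surjective ζ
  obtain ⟨t, rfl⟩ := Φ.surjective w
  rw [hΨ, dotV_psiV hn hx] at hζ
  rw [hΦ, dotV_phiV] at hw'
  have m1 := Submodule.smul_mem _ (sgn (i * k))
    (sgn_wordPar_mem i (skew_vecMul (antipodeInv m n q x) u.2))
  have m2 := skew_stable (antipode m n q x) t.2
  have h1 : ζ' = Ψ ⟨_, m1⟩ := Subtype.ext (hζ.trans (hΨ ⟨_, m1⟩).symm)
  have h2 : w' = Φ ⟨_, m2⟩ := Subtype.ext (hw'.trans (hΦ ⟨_, m2⟩).symm)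
  rw [h1, h2, hD, hD, skewPairing_apply, skewPairing_apply]
  refine skewPairing_adjoint hx u.1 fun a => ?_
  -- the parity of `w` is the parity of its tensor, up to the parity of `N ⋯ N`
  have hmem : (fun a => sgn (k + wordPar a) * t.1 a) ∈ skewTensors m n k q :=
    skew_mul (fun a σ => by rw [wordPar_content (content_comp_perm a σ)]) t.2
  have h3 : phiV q hn k (fun a => sgn (k + wordPar a) * t.1 a) = phiV q hn k (sgn j • t.1) := by
    rw [map_smul, ← hΦ, ← hw, hΦ]
    exact congrArg (oneTensor m n q) (phiMap_parity hn t.1).symm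
  have h4 := phiV_injOn hn (Submodule.sub_mem _ hmem (Submodule.smul_mem _ (sgn j) t.2))
    (by rw [map_sub, h3, sub_self])
  exact congrFun (sub_eq_zero.1 h4) a

end Duality

end

end QuantumGL

theorem mainTheorem6 (m n : ℕ) (hm : 0 < m) (hn : 0 < n) (q : ℝ) [Fact (0 < q)] [Fact (q ≠ 1)]
    (k : ℕ) :
    (∃! φ : pPlus m n q →ₐ[ℂ] ℂ, IsPlusChar hn k φ) ∧
    (∃! ψ : pMinus m n q →ₐ[ℂ] ℂ, IsMinusChar hn k ψ) ∧
    ∀ (φ : pPlus m n q →ₐ[ℂ] ℂ) (ψ : pMinus m n q →ₐ[ℂ] ℂ),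
      IsPlusChar hn k φ → IsMinusChar hn k ψ →
      ∀ O Obar : Submodule ℂ (VDual m n q),
        O = induced φ (genAlg (tBarEl (m := m) (n := n) q)) →
        Obar = induced ψ (genAlg (tEl (m := m) (n := n) q)) →
        -- the monomial bases
        (LinearIndependent ℂ (fun L : MultiIndex m n k =>
            ((1 : ℂ) ⊗ₜ[ℂ] zBarMon q hn L.1 : VDual m n q)) ∧
          O = Submodule.span ℂ (Set.range fun L : MultiIndex m n k =>
            ((1 : ℂ) ⊗ₜ[ℂ] zBarMon q hn L.1 : VDual m n q))) ∧
        (LinearIndependent ℂ (fun L : MultiIndex m n k =>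
            ((1 : ℂ) ⊗ₜ[ℂ] zMon q hn L.1 : VDual m n q)) ∧
          Obar = Submodule.span ℂ (Set.range fun L : MultiIndex m n k =>
            ((1 : ℂ) ⊗ₜ[ℂ] zMon q hn L.1 : VDual m n q))) ∧
        -- the irreducible representations and their highest weights
        IsIrrepOfHighestWeight (dotV m n q) O (skewWeight m n k) ∧
        IsIrrepOfHighestWeight (dotV m n q) Obar (dualWeight k hn) ∧
        -- `O` is isomorphic to the module of skew supersymmetric tensors of rank `k`
        (∃ T : O ≃ₗ[ℂ] skewTensors m n k q, ∀ (x : Uq m n q) (ζ ζ' : O),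
          (ζ' : VDual m n q) = dotV m n q x ζ →
            (T ζ' : (Fin k → Fin (m + n)) → ℂ) = tensorAct q k x (T ζ)) ∧
        -- `Obar` is isomorphic to the dual module of `O`
        (∃ D : Obar ≃ₗ[ℂ] Module.Dual ℂ O, ∀ (i j : ZMod 2), ∀ x ∈ homog m n q i,
          ∀ (ζ ζ' : Obar) (w w' : O), (ζ' : VDual m n q) = dotV m n q x ζ →
            parityV m n q w = sgn j • (w : VDual m n q) →
            (w' : VDual m n q) = dotV m n q (antipode m n q x) w →
              D ζ' w = sgn (i * (i + j)) * D ζ w') := by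
  refine ⟨⟨plusChar q hn k, isPlusChar hn, fun φ h => h.eq_plusChar⟩,
    ⟨minusChar q hn k, isMinusChar hn, fun ψ h => h.eq_minusChar⟩, ?_⟩
  intro φ ψ hφ hψ O Obar hO hObar
  obtain rfl := hφ.eq_plusChar
  obtain rfl := hψ.eq_minusChar
  rw [induced_plus] at hO
  rw [induced_minus] at hObar
  subst hO hObar
  exact ⟨basis_image (fun u hu => phiV_injOn hn hu) (zBarMon_eq hn),
    basis_image (fun u hu => psiV_injOn hn hu) (zMon_eq hn),
    irrep_plus hn, irrep_minus hn, exists_skew_equiv hn, exists_dual_equiv hn⟩
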